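/- Let $\epsilon\in\{1,-1\}$, let $\mathbb{E}^{n+2}=\mathbb{E}^{n+1}\times\mathbb{R}$ carry the inner product $\langle x,y\rangle=\epsilon x_0y_0+\sum_{i=1}^{n+1}x_iy_i$, and let $\mathbb{Q}_\epsilon^n=\{x\in\mathbb{E}^{n+1}:\langle x,x\rangle=\epsilon\}$ (with $x_0>0$ if $\epsilon=-1$), so that $\mathbb{Q}_1^n=\mathbb{S}^n$ and $\mathbb{Q}_{-1}^n=\mathbb{H}^n$. Let $f\colon M^m\to\mathbb{Q}_\epsilon^n\times\mathbb{R}$, $m\ge 1$, be a smooth isometric immersion, and let $\tilde f=i\circ f$, where $i\colon\mathbb{Q}_\epsilon^n\times\mathbb{R}\to\mathbb{E}^{n+2}$ is the inclusion. Let $\frac{\partial}{\partial t}$ be the unit vector field spanning the factor $\mathbb{R}$ and write $\frac{\partial}{\partial t}=f_*T+\eta$ with $T$ tangent to $M$ and $\eta$ normal to $f$. An immersion has flat normal bundle if the curvature of its normal connection vanishes. The immersion $f$ belongs to class $\mathcal{A}$ if $T$ is at every point an eigenvector (in particular nonzero) of all shape operators of $f$. Then the following assertions are equivalent: (i) $T$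 is nowhere vanishing and $\tilde f$ has flat normal bundle; (ii) $f$ has flat normal bundle and belongs to class $\mathcal{A}$; (iii) every point of $M$ has an open neighbourhood that is diffeomorphic to a product $N^{m-1}\times I$, with $N^{m-1}$ a smooth manifold and $I\subseteq\mathbb{R}$ an open interval, on which $$\tilde f(x,s)=\alpha_0(s)\,g(x)+\sum_{i=1}^{k}\alpha_i(s)\,\xi_i(x)+\alpha_{k+1}(s)\,\frac{\partial}{\partial t}$$ for some integer $k\ge 0$, some isometric immersion $g\colon N^{m-1}\to\mathbb{Q}_\epsilon^n$ with flat normal bundle, some orthonormal parallel normal vector fields $\xi_1,\dots,\xi_k$ along $g$ (here $\mathbb{E}^{n+1}$ is identified with $\mathbb{E}^{n+1}\times\{0\}\subset\mathbb{E}^{n+2}$), and some smooth regular curve $\alpha=(\alpha_0,\dots,\alpha_{k+1})\colon I\to\mathbb{Q}_\epsilon^k\times\mathbb{R}\subset\mathbb{E}^{k+2}$ with $\alpha_{k+1}'$ nowhere vanishing. -/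

import Mathlib

open Set Function
open scoped Manifold ContDiff

noncomputable section

section GeneralImmersions

/-! Extrinsic geometry of a submanifold of a pseudo-Euclidean space `(W, B)`, or of a submanifold
`S` of it that has nondegenerate tangent spaces `τ p ⊆ W`, `p ∈ S` (with `τ p = W` if `S = W`).
The Levi-Civita connection of `S` is the `B`-orthogonal projection to `τ` of the derivative
of `W`. -/

variable {W : Type*} [NormedAddCommGroup W] [NormedSpace ℝ W]

open scoped Classical in
/-- The `B`-orthogonal projection of `W` onto the subspace `K` (used where `W` is the direct sum
of `K` and its `B`-orthogonal complement). -/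
def orthProj (B : LinearMap.BilinForm ℝ W) (K : Submodule ℝ W) : W →ₗ[ℝ] W :=
  if h : IsCompl K (B.orthogonal K) then K.projection (B.orthogonal K) h else 0

variable (d : ℕ) {M : Type*} [TopologicalSpace M] [ChartedSpace (EuclideanSpace ℝ (Fin d)) M]

/-- The differential `F_*` at `x` of a map `F : M → W`. -/
def dmap (F : M → W) (x : M) : TangentSpace (𝓡 d) x →ₗ[ℝ] W :=
  (mfderiv (𝓡 d) 𝓘(ℝ, W) F x).toLinearMap

/-- `F : M → W` is a smooth immersion. -/
def IsSmoothImmersion (F : M → W) : Prop :=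
  ContMDiff (𝓡 d) 𝓘(ℝ, W) ∞ F ∧ ∀ x : M, Injective (dmap d F x)

/-- The normal space at `x` of the immersion `F` of `M` into the ambient submanifold with
tangent spaces `τ`. -/
def normalSpace (B : LinearMap.BilinForm ℝ W) (τ : W → Submodule ℝ W) (F : M → W) (x : M) :
    Submodule ℝ W :=
  τ (F x) ⊓ B.orthogonal (LinearMap.range (dmap d F x))

/-- The normal connection: `∇^⊥_v ξ` is the normal component of the ambient covariant derivative
of the normal field `ξ` along `F`, in the direction `v` tangent to `M` at `x`. -/
def normalCov (B : LinearMap.BilinForm ℝ W) (τ : W → Submodule ℝ W) (F : M → W)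
    (ξ : M → W) (x : M) (v : TangentSpace (𝓡 d) x) : W :=
  orthProj B (normalSpace d B τ F x) (orthProj B (τ (F x)) (dmap d ξ x v))

/-- The curvature of the normal connection,
`R^⊥(X,Y)ξ = ∇^⊥_X ∇^⊥_Y ξ - ∇^⊥_Y ∇^⊥_X ξ - ∇^⊥_{[X,Y]} ξ`. -/
def normalCurvature (B : LinearMap.BilinForm ℝ W) (τ : W → Submodule ℝ W) (F : M → W)
    (X Y : Π x : M, TangentSpace (𝓡 d) x) (ξ : M → W) (x : M) : W :=
  normalCov d B τ F (fun y => normalCov d B τ F ξ y (Y y)) x (X x)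
    - normalCov d B τ F (fun y => normalCov d B τ F ξ y (X y)) x (Y x)
    - normalCov d B τ F ξ x (VectorField.mlieBracket (𝓡 d) X Y x)

/-- `X` is a smooth tangent vector field on the open set `U`. -/
def IsSmoothVectorFieldOn [IsManifold (𝓡 d) ∞ M] (X : Π x : M, TangentSpace (𝓡 d) x)
    (U : Set M) : Prop :=
  ContMDiffOn (𝓡 d) (𝓡 d).tangent ∞ (fun x => (⟨x, X x⟩ : TangentBundle (𝓡 d) M)) U

/-- `ξ` is a smooth normal vector field along `F` on the open set `U`. -/
def IsSmoothNormalFieldOn (B : LinearMap.BilinForm ℝ W) (τ : W → Submodule ℝ W) (F : M → W)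
    (ξ : M → W) (U : Set M) : Prop :=
  ContMDiffOn (𝓡 d) 𝓘(ℝ, W) ∞ ξ U ∧ ∀ x ∈ U, ξ x ∈ normalSpace d B τ F x

/-- `F` has flat normal bundle: its normal connection has vanishing curvature. -/
def HasFlatNormalBundle [IsManifold (𝓡 d) ∞ M] (B : LinearMap.BilinForm ℝ W)
    (τ : W → Submodule ℝ W) (F : M → W) : Prop :=
  ∀ (U : Set M) (X Y : Π x : M, TangentSpace (𝓡 d) x) (ξ : M → W), IsOpen U →
    IsSmoothVectorFieldOn d X U → IsSmoothVectorFieldOn d Y U → IsSmoothNormalFieldOn d B τ F ξ U →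
    ∀ x ∈ U, normalCurvature d B τ F X Y ξ x = 0

/-- `ξ` is a smooth normal vector field along `F` that is parallel in the normal connection. -/
def IsParallelNormalField (B : LinearMap.BilinForm ℝ W) (τ : W → Submodule ℝ W) (F : M → W)
    (ξ : M → W) : Prop :=
  IsSmoothNormalFieldOn d B τ F ξ univ ∧
    ∀ (x : M) (v : TangentSpace (𝓡 d) x), normalCov d B τ F ξ x v = 0

/-- The second fundamental form `α(v,w)` at `x`: the normal component of the ambient covariant
derivative in the direction `v` of `F_* Y`, where `Y` is the extension of `w` with constant
coefficients in the preferred chart at `x` (this is the chart through which Mathlib identifies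
`TangentSpace (𝓡 d) x` with the model space; the value is the same for every extension). -/
def secondFF (B : LinearMap.BilinForm ℝ W) (τ : W → Submodule ℝ W) (F : M → W) (x : M)
    (v w : TangentSpace (𝓡 d) x) : W :=
  orthProj B (normalSpace d B τ F x) (orthProj B (τ (F x))
    (fderiv ℝ (fderiv ℝ (F ∘ (extChartAt (𝓡 d) x).symm)) (extChartAt (𝓡 d) x x) v w))

/-- `A` is the shape operator of `F` at `x` in the normal direction `ζ`:
`⟨A v, w⟩ = ⟨α(v,w), ζ⟩`, where `M` carries the metric induced by `F`. -/
def IsShapeOperator (B : LinearMap.BilinForm ℝ W) (τ : W → Submodule ℝ W) (F : M → W) (x : M)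
    (ζ : W) (A : Module.End ℝ (TangentSpace (𝓡 d) x)) : Prop :=
  ∀ v w, B (dmap d F x (A v)) (dmap d F x w) = B (secondFF d B τ F x v w) ζ

/-- The shape operator `A_ζ` of `F` at `x` in the normal direction `ζ`. -/
def shapeOperator (B : LinearMap.BilinForm ℝ W) (τ : W → Submodule ℝ W) (F : M → W) (x : M)
    (ζ : W) : Module.End ℝ (TangentSpace (𝓡 d) x) :=
  Classical.epsilon (IsShapeOperator d B τ F x ζ)

/-- The tangent vector `T` at `x` for which `F_* T` is the tangential component of `u`, i.e. for
which `u - F_* T` is orthogonal to `F`. -/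
def tangentPart (B : LinearMap.BilinForm ℝ W) (F : M → W) (u : W) (x : M) :
    TangentSpace (𝓡 d) x :=
  invFun (dmap d F x) (orthProj B (LinearMap.range (dmap d F x)) u)

end GeneralImmersions

section Ambient

/-- `E^{n+1}`. -/
abbrev AmbE (n : ℕ) : Type := Fin (n + 1) → ℝ

/-- `E^{n+2} = E^{n+1} × ℝ`. -/
abbrev AmbER (n : ℕ) : Type := AmbE n × ℝ

/-- The inner product `ε x₀ y₀ + x₁ y₁ + ⋯ + xₙ yₙ` of `E^{n+1}`. -/
def formE (ε : ℝ) (n : ℕ) : LinearMap.BilinForm ℝ (AmbE n) :=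
  Matrix.toBilin' (Matrix.diagonal (Fin.cons ε (fun _ => 1) : Fin (n + 1) → ℝ))

/-- The inner product of `E^{n+2} = E^{n+1} × ℝ`. -/
def formER (ε : ℝ) (n : ℕ) : LinearMap.BilinForm ℝ (AmbER n) :=
  (formE ε n).compl₁₂ (LinearMap.fst ℝ (AmbE n) ℝ) (LinearMap.fst ℝ (AmbE n) ℝ) +
    (LinearMap.mul ℝ ℝ).compl₁₂ (LinearMap.snd ℝ (AmbE n) ℝ) (LinearMap.snd ℝ (AmbE n) ℝ)

/-- For `ε = 1` the unit sphere `S^n`, for `ε = -1` the hyperbolic space `H^n` (the upper sheet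
of the hyperboloid), as a subset of `E^{n+1}`. -/
def quadric (ε : ℝ) (n : ℕ) : Set (AmbE n) :=
  {x | formE ε n x x = ε ∧ (ε = -1 → 0 < x 0)}

/-- The canonical inclusion `i` of `Q_ε^n × ℝ` into `E^{n+2}`. -/
def inclQR (ε : ℝ) (n : ℕ) (p : quadric ε n × ℝ) : AmbER n := ((p.1 : AmbE n), p.2)

/-- The tangent space of `Q_ε^n` at `q`, as a subspace of `E^{n+1}`. -/
def tanQ (ε : ℝ) (n : ℕ) (q : AmbE n) : Submodule ℝ (AmbE n) :=
  (formE ε n).orthogonal (Submodule.span ℝ {q})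

/-- The tangent space of `Q_ε^n × ℝ` at `(q, t)`, as a subspace of `E^{n+2}`. -/
def tanQR (ε : ℝ) (n : ℕ) (p : AmbER n) : Submodule ℝ (AmbER n) :=
  (tanQ ε n p.1).prod ⊤

/-- The tangent space of `E^{n+2}`. -/
def tanER (n : ℕ) (_ : AmbER n) : Submodule ℝ (AmbER n) := ⊤

/-- The unit vector field `∂/∂t` spanning the factor `ℝ`. -/
def dt (n : ℕ) : AmbER n := (0, 1)

variable (d : ℕ) {n : ℕ} {M : Type*} [TopologicalSpace M] [ChartedSpace (EuclideanSpace ℝ (Fin d)) M]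

/-- The vector field `T` of an immersion `f` into `Q_ε^n × ℝ`, defined by
`∂/∂t = f_* T + η` with `η` normal. -/
def fieldT (ε : ℝ) (f : M → quadric ε n × ℝ) (x : M) : TangentSpace (𝓡 d) x :=
  tangentPart d (formER ε n) (inclQR ε n ∘ f) (dt n) x

/-- `f` is in the class `𝒜`: `T` is an eigenvector of all shape operators of `f` (as an immersion
into `Q_ε^n × ℝ`). Eigenvectors are nonzero. -/
def IsClassA (ε : ℝ) (f : M → quadric ε n × ℝ) : Prop :=
  ∀ x : M, ∀ ζ ∈ normalSpace d (formER ε n) (tanQR ε n) (inclQR ε n ∘ f) x,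
    ∃ μ : ℝ, (shapeOperator d (formER ε n) (tanQR ε n) (inclQR ε n ∘ f) x ζ).HasEigenvector μ
      (fieldT d ε f x)

/-- The isometry `φ_x(y) = y₀ g̃(x) + y₁ ξ̃₁(x) + ⋯ + y_k ξ̃_k(x) + y_{k+1} ∂/∂t` of `E^{k+2}`
into `E^{n+2}`, where a tilde denotes the inclusion `E^{n+1} = E^{n+1} × {0} ⊆ E^{n+2}`. -/
def tubeMap {k : ℕ} (g : M → AmbE n) (ξ : Fin k → M → AmbE n) (x : M) (y : AmbER k) : AmbER n :=
  y.1 0 • (g x, 0) + ∑ i : Fin k, y.1 i.succ • (ξ i x, 0) + y.2 • dt n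

end Ambient

section LocalConstruction

variable (d : ℕ) {n : ℕ} {M : Type*} [TopologicalSpace M]
  [ChartedSpace (EuclideanSpace ℝ (Fin (d + 1))) M]

/-- `f̃ : M^{d+1} → E^{n+2}` is locally of the form `f̃(x,s) = φ_x(α(s))` on a product `N^d × I`,
`I` an open interval, in terms of
* an immersion `g : N → Q_ε^n` (isometric for the induced metric) with flat normal bundle,
* orthonormal parallel normal vector fields `ξ₁, …, ξ_k` along `g`, and
* a smooth regular curve `α : I → Q_ε^k × ℝ` whose last coordinate has nowhere zero derivative.

The diffeomorphism `Ψ` identifies `N × I` with an open neighbourhood of the given point `p`. -/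
def IsLocallyFlatPartialTube (ε : ℝ) (F : M → AmbER n) : Prop :=
  ∀ p : M, ∃ (N : Type) (_ : TopologicalSpace N) (_ : ChartedSpace (EuclideanSpace ℝ (Fin d)) N)
    (_ : IsManifold (𝓡 d) ∞ N) (I : Set ℝ) (Ψ : OpenPartialHomeomorph (N × ℝ) M)
    (g : N → AmbE n) (k : ℕ) (ξ : Fin k → N → AmbE n) (α : ℝ → AmbER k),
    -- the local product structure
    IsOpen I ∧ I.OrdConnected ∧ Ψ.source = univ ×ˢ I ∧ p ∈ Ψ.target ∧
    ContMDiffOn ((𝓡 d).prod 𝓘(ℝ, ℝ)) (𝓡 (d + 1)) ∞ Ψ Ψ.source ∧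
    ContMDiffOn (𝓡 (d + 1)) ((𝓡 d).prod 𝓘(ℝ, ℝ)) ∞ Ψ.symm Ψ.target ∧
    -- the immersion `g`
    (∀ x, g x ∈ quadric ε n) ∧ IsSmoothImmersion d g ∧
    HasFlatNormalBundle d (formE ε n) (tanQ ε n) g ∧
    -- the normal fields
    (∀ i, IsParallelNormalField d (formE ε n) (tanQ ε n) g (ξ i)) ∧
    (∀ i j x, formE ε n (ξ i x) (ξ j x) = if i = j then 1 else 0) ∧
    -- the curve
    ContDiffOn ℝ ∞ α I ∧ (∀ s ∈ I, (α s).1 ∈ quadric ε k) ∧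
    (∀ s ∈ I, deriv α s ≠ 0) ∧ (∀ s ∈ I, deriv (fun r => (α r).2) s ≠ 0) ∧
    -- the formula
    ∀ x, ∀ s ∈ I, F (Ψ (x, s)) = tubeMap g ξ x (α s)

end LocalConstruction

end

/-! The normal bundle of an immersion F is the bundle of images of a smooth family P of
`B`-symmetric projections of one fixed vector space. The normal connection is P∘d, and its curvature
on a section ζ is P[dP(v), dP(w)]ζ. Flatness is therefore a condition on the 1-jet (P, dP) at each
point (`FlatJet`, `hasFlatNormalBundle_iff`). Since dP(v)ζ = -F_*A_ζ v (`form_deriv_coimageProj`),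
it says that the shape operators commute (`IsProjJet.flatJet_iff`). Every comparison of bundles
below is algebra with such jets.

(i) ⇔ (ii). The normal bundle of f̃ is that of f plus the line of the horizontal position vector ν,
and dν(v) = f̃_*v - ⟨v,T⟩ ∂/∂t. By `IsProjJet.flatJet_iff_of_sub`, f̃ is flat iff f is flat and
⟨v,T⟩⟨A_ζ T,w⟩ is symmetric in v, w for all ζ normal to f. When T ≠ 0, this symmetry says that A_ζ T
is a multiple of T.

(iii) ⇒ (i). In the product coordinates the normal bundle of f̃ is the orthogonal complement of z =
∂f̃/∂s in the normal bundle of g in E^{n+1} plus the line of ∂/∂t. That larger bundle is flat. As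
the ξ_i are parallel, the x-derivatives of z are tangent to g, so against normal vectors dz is a
multiple of the single covector ds. A term of that kind is symmetric and does not affect the
curvature (`flatJet_subProj`). Since α_{k+1}' ≠ 0, ∂f̃/∂s is not orthogonal to ∂/∂t, whence T ≠ 0.

(i) ⇒ (iii). This reverses the construction. Flatness makes every normal derivative of ∂/∂t
proportional to the covector ⟨T,·⟩ (`exists_form_deriv_coimageProj_dt`). Hence the hull, the normal
bundle plus the line of ∂/∂t, is also flat (`flatJet_hullProj`), its jet vanishes in the direction T
(`deriv_hullProj_tangent`), and ∂/∂t is a parallel section of it. Parallel sections of a flat family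
exist locally (`exists_parallel_section`). A parallel frame e_0, …, e_k with e_0 = ν at the base
point, completed by ∂/∂t, expands ν. Its vectors do not change along T, and the coefficients of ν do
not change along the level sets of the height. In coordinates (x, s), with s the height and x
obtained from e_0, the frame depends on x only and the coefficients on s only. Then g = e_0, ξ_i =
e_i, and the coefficients together with s form α (`exists_tube_coordinates`). -/

set_option maxSynthPendingDepth 3
set_option linter.unusedSectionVars false

/-! ### Orthogonal projection onto the image of a linear map, for an indefinite form -/

section BilinearProjections

variable {V W : Type*} [NormedAddCommGroup V] [NormedSpace ℝ V] [FiniteDimensional ℝ V]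
  [NormedAddCommGroup W] [NormedSpace ℝ W] [FiniteDimensional ℝ W]

/-- The linear map `L` is injective with nondegenerate image for the bilinear form `B`. -/
def NondegImage (B : LinearMap.BilinForm ℝ W) (L : V →L[ℝ] W) : Prop :=
  ∀ v, (∀ w, B (L v) (L w) = 0) → v = 0

/-- The map `w ↦ B(w, L ·)` into the dual space. -/
noncomputable def formPairing (B : LinearMap.BilinForm ℝ W) (L : V →L[ℝ] W) : W →L[ℝ] (V →L[ℝ] ℝ) :=
  ((ContinuousLinearMap.compL ℝ V W ℝ).flip L).comp (LinearMap.toContinuousBilinearMap B)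

@[simp] lemma formPairing_apply (B : LinearMap.BilinForm ℝ W) (L : V →L[ℝ] W) (w : W) (v : V) :
    formPairing B L w v = B w (L v) := by
  simp [formPairing]

/-- The `B`-orthogonal projection onto the image of `L`, as an explicit function of `L`. -/
noncomputable def imageProj (B : LinearMap.BilinForm ℝ W) (L : V →L[ℝ] W) : W →L[ℝ] W :=
  (L.comp ((formPairing B L).comp L).inverse).comp (formPairing B L)

/-- Nondegeneracy of the image says that the Gram map v ↦ B(L v, L ·) has trivial kernel, and `V`
and its dual have equal dimension. Hence `inverse` in `imageProj` is a true inverse and not its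
default value zero. -/
lemma exists_gramEquiv {B : LinearMap.BilinForm ℝ W} {L : V →L[ℝ] W} (hL : NondegImage B L) :
    ∃ e : V ≃L[ℝ] (V →L[ℝ] ℝ), (e : V →L[ℝ] (V →L[ℝ] ℝ)) = (formPairing B L).comp L := by
  have hinj : Injective (((formPairing B L).comp L : V →L[ℝ] (V →L[ℝ] ℝ)) :
      V →ₗ[ℝ] (V →L[ℝ] ℝ)) := by
    rw [injective_iff_map_eq_zero]
    intro v hv
    refine hL v fun w => ?_
    simpa using congrArg (fun φ : V →L[ℝ] ℝ => φ w) hv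
  have hfin : Module.finrank ℝ V = Module.finrank ℝ (V →L[ℝ] ℝ) := by
    rw [← LinearEquiv.finrank_eq (LinearMap.toContinuousLinearMap : (V →ₗ[ℝ] ℝ) ≃ₗ[ℝ] (V →L[ℝ] ℝ))]
    exact (Subspace.dual_finrank_eq (K := ℝ) (V := V)).symm
  refine ⟨(LinearEquiv.ofInjectiveOfFinrankEq _ hinj hfin).toContinuousLinearEquiv, ?_⟩
  ext v w
  rfl

lemma imageProj_mem (B : LinearMap.BilinForm ℝ W) (L : V →L[ℝ] W) (w : W) :
    ∃ v, imageProj B L w = L v := ⟨_, rfl⟩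

lemma form_imageProj {B : LinearMap.BilinForm ℝ W} {L : V →L[ℝ] W} (hL : NondegImage B L)
    (w : W) (v : V) : B (imageProj B L w) (L v) = B w (L v) := by
  obtain ⟨e, he⟩ := exists_gramEquiv hL
  have h : formPairing B L (imageProj B L w) = formPairing B L w := by
    have : formPairing B L (imageProj B L w)
        = ((formPairing B L).comp L) (((formPairing B L).comp L).inverse (formPairing B L w)) := rfl
    rw [this, ← he, ContinuousLinearMap.inverse_equiv]
    simp
  simpa using congrArg (fun φ : V →L[ℝ] ℝ => φ v) h

lemma imageProj_eq_of {B : LinearMap.BilinForm ℝ W} {L : V →L[ℝ] W} (hL : NondegImage B L)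
    {w u : W} (hu : u ∈ LinearMap.range (L : V →ₗ[ℝ] W)) (h : ∀ v, B (w - u) (L v) = 0) :
    imageProj B L w = u := by
  obtain ⟨a, ha⟩ := imageProj_mem B L w
  obtain ⟨b, rfl⟩ := hu
  have : a - b = 0 := hL _ fun v => by
    have h1 := form_imageProj hL w v
    have h2 := h v
    rw [ha] at h1
    simp only [map_sub, LinearMap.sub_apply, ContinuousLinearMap.coe_coe] at h2 ⊢
    linarith
  rw [ha, sub_eq_zero.1 this]; rfl

lemma imageProj_image {B : LinearMap.BilinForm ℝ W} {L : V →L[ℝ] W} (hL : NondegImage B L)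
    (v : V) : imageProj B L (L v) = L v :=
  imageProj_eq_of hL ⟨v, rfl⟩ (by simp)

lemma form_imageProj_left {B : LinearMap.BilinForm ℝ W} (hB : B.IsSymm) {L : V →L[ℝ] W}
    (hL : NondegImage B L) (x y : W) :
    B (imageProj B L x) y = B x (imageProj B L y) := by
  obtain ⟨a, ha⟩ := imageProj_mem B L x
  obtain ⟨b, hb⟩ := imageProj_mem B L y
  have h1 := form_imageProj hL x b
  have h2 := form_imageProj hL y a
  have h3 := hB.eq (L b) (L a)
  have h4 := hB.eq y (L a)
  rw [ha] at h1 ⊢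
  rw [hb] at h2 ⊢
  linarith

lemma imageProj_congr {V' : Type*} [NormedAddCommGroup V'] [NormedSpace ℝ V']
    [FiniteDimensional ℝ V'] {B : LinearMap.BilinForm ℝ W} {L : V →L[ℝ] W} {L' : V' →L[ℝ] W}
    (hL : NondegImage B L) (hL' : NondegImage B L')
    (h : LinearMap.range (L : V →ₗ[ℝ] W) = LinearMap.range (L' : V' →ₗ[ℝ] W)) :
    imageProj B L = imageProj B L' := by
  ext w
  refine imageProj_eq_of hL (h ▸ ⟨_, rfl⟩) fun v => ?_
  obtain ⟨v', hv'⟩ : L v ∈ LinearMap.range (L' : V' →ₗ[ℝ] W) := h ▸ ⟨v, rfl⟩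
  rw [← hv', map_sub, LinearMap.sub_apply, ContinuousLinearMap.coe_coe, form_imageProj hL', sub_self]

/-- The purpose of the explicit formula for `imageProj`: it is built from `L` by continuous
multilinear operations and the inversion of the Gram map, which is smooth at invertible maps. -/
lemma contDiffAt_imageProj {B : LinearMap.BilinForm ℝ W} {L : V →L[ℝ] W} (hL : NondegImage B L)
    {n : WithTop ℕ∞} :
    ContDiffAt ℝ n (fun L : V →L[ℝ] W => imageProj B L) L := by
  have hp : ContDiff ℝ n fun L : V →L[ℝ] W => formPairing B L := by
    have h : ContDiff ℝ n fun L : V →L[ℝ] W => (ContinuousLinearMap.compL ℝ V W ℝ).flip L := by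
      fun_prop
    exact h.clm_comp contDiff_const
  have hg : ContDiff ℝ n fun L : V →L[ℝ] W => (formPairing B L).comp L :=
    hp.clm_comp contDiff_id
  obtain ⟨e, he⟩ := exists_gramEquiv hL
  have hi : ContDiffAt ℝ n (fun L : V →L[ℝ] W => ((formPairing B L).comp L).inverse) L := by
    refine ContDiffAt.comp (g := ContinuousLinearMap.inverse) L ?_ hg.contDiffAt
    rw [← he]
    exact contDiffAt_map_inverse e
  exact (contDiffAt_id.clm_comp hi).clm_comp hp.contDiffAt

/-- In finite dimension disjointness from the orthogonal complement already gives a direct sum, so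
the default value zero of `orthProj` is not met. -/
lemma orthProj_eq_of {B : LinearMap.BilinForm ℝ W} (hB : B.IsSymm) {K : Submodule ℝ W}
    (hK : Disjoint K (B.orthogonal K)) {w u : W} (hu : u ∈ K) (h : ∀ k ∈ K, B k (w - u) = 0) :
    orthProj B K w = u := by
  have hc : IsCompl K (B.orthogonal K) :=
    (LinearMap.BilinForm.isCompl_orthogonal_iff_disjoint hB.isRefl).2 hK
  have h1 : w - u ∈ B.orthogonal K := LinearMap.BilinForm.mem_orthogonal_iff.2 h
  rw [orthProj, dif_pos hc]
  have h2 : w = u + (w - u) := by abel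
  rw [h2, map_add, Submodule.projection_apply_of_mem_left hc hu,
    (Submodule.projection_apply_eq_zero_iff hc).2 h1, add_zero]

end BilinearProjections

/-! ### First-order jets of families of projections, and their curvature -/

section ProjectionJets

variable {V W : Type*} [NormedAddCommGroup W] [NormedSpace ℝ W]

/-- `P` is a `B`-symmetric projection and `dP` has the algebraic properties of the derivative at
`P` of a family of such projections. -/
structure IsProjJet (B : LinearMap.BilinForm ℝ W) (P : W →L[ℝ] W) (dP : V → W →L[ℝ] W) :
    Prop where
  idem : ∀ x, P (P x) = P x
  symm : ∀ x y, B (P x) y = B x (P y)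
  didem : ∀ v x, dP v (P x) + P (dP v x) = dP v x
  dsymm : ∀ v x y, B (dP v x) y = B x (dP v y)

/-- Vanishing of the curvature `P [dP(v), dP(w)] P` of the connection that the family of
projections induces on the bundle of its images. -/
def FlatJet (P : W →L[ℝ] W) (dP : V → W →L[ℝ] W) : Prop :=
  ∀ v w ζ, P ζ = ζ → P (dP v (dP w ζ)) = P (dP w (dP v ζ))

lemma FlatJet.comp {V' : Type*} {P : W →L[ℝ] W} {dP : V → W →L[ℝ] W} (h : FlatJet P dP)
    (φ : V' → V) : FlatJet P (fun v => dP (φ v)) := fun v w ζ hζ => h (φ v) (φ w) ζ hζ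

lemma FlatJet.of_comp {V' : Type*} {P : W →L[ℝ] W} {dP : V → W →L[ℝ] W} {φ : V' → V}
    (h : FlatJet P (fun v => dP (φ v))) (hφ : Surjective φ) : FlatJet P dP := fun v w ζ hζ => by
  obtain ⟨a, rfl⟩ := hφ v
  obtain ⟨b, rfl⟩ := hφ w
  exact h a b ζ hζ

namespace IsProjJet

variable {B : LinearMap.BilinForm ℝ W} {P : W →L[ℝ] W} {dP : V → W →L[ℝ] W}

/-- For ζ in the image, `didem` reads dP ζ + P dP ζ = dP ζ. Together with the next lemma: dP(v)
interchanges the image and the kernel of P. -/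
lemma proj_deriv (h : IsProjJet B P dP) {ζ : W} (hζ : P ζ = ζ) (v : V) : P (dP v ζ) = 0 := by
  have := h.didem v ζ
  rw [hζ] at this
  simpa using this

lemma proj_deriv_of_eq_zero (h : IsProjJet B P dP) {x : W} (hx : P x = 0) (v : V) :
    P (dP v x) = dP v x := by
  have := h.didem v x
  rw [hx] at this
  simpa using this

lemma form_eq_zero (h : IsProjJet B P dP) {x ζ : W} (hx : P x = 0) (hζ : P ζ = ζ) :
    B x ζ = 0 := by
  rw [← hζ, ← h.symm, hx, map_zero, LinearMap.zero_apply]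

lemma form_eq_zero' (h : IsProjJet B P dP) {x ζ : W} (hx : P x = 0) (hζ : P ζ = ζ) :
    B ζ x = 0 := by
  rw [← hζ, h.symm, hx, map_zero]

/-- Symmetry of P and dP gives ⟨P dP(v) dP(w) ζ, ζ'⟩ = ⟨dP(w)ζ, dP(v)ζ'⟩. For a normal projection,
where dP(v)ζ = -F_*A_ζ v, this is the Ricci equation. -/
lemma flatJet_iff (hnd : ∀ x, (∀ y, B x y = 0) → x = 0) (h : IsProjJet B P dP) :
    FlatJet P dP ↔ ∀ v w ζ ζ', P ζ = ζ → P ζ' = ζ' →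
      B (dP v ζ) (dP w ζ') = B (dP w ζ) (dP v ζ') := by
  have key : ∀ v w ζ ζ', P ζ' = ζ' → B (P (dP v (dP w ζ))) ζ' = B (dP w ζ) (dP v ζ') :=
    fun v w ζ ζ' hζ' => by rw [h.symm, hζ', h.dsymm]
  refine ⟨fun hf v w ζ ζ' hζ hζ' => ?_, fun hs v w ζ hζ => ?_⟩
  · rw [← key w v ζ ζ' hζ', ← key v w ζ ζ' hζ', hf v w ζ hζ]
  · refine sub_eq_zero.1 (hnd _ fun y => ?_)
    have h1 := key v w ζ (P y) (h.idem y)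
    have h2 := key w v ζ (P y) (h.idem y)
    rw [← h.symm, h.idem] at h1 h2
    rw [map_sub, LinearMap.sub_apply, h1, h2, hs w v ζ (P y) hζ (h.idem y), sub_self]

/-- Two applications of dP lead from the image back to the image, so the outer P in `FlatJet` is
superfluous. Parallel transport uses this form. -/
lemma comm_of_flatJet (h : IsProjJet B P dP) (hf : FlatJet P dP) {ζ : W} (hζ : P ζ = ζ) (v w : V) :
    dP v (dP w ζ) = dP w (dP v ζ) := by
  rw [← h.proj_deriv_of_eq_zero (h.proj_deriv hζ w), hf v w ζ hζ,
    h.proj_deriv_of_eq_zero (h.proj_deriv hζ v)]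

/-- Flatness of the orthogonal complement of a section `ν` in terms of that of the whole bundle.
The derivative of `ν` is `L v - a v • e`, with `L v` tangent. -/
lemma flatJet_iff_of_sub (hB : B.IsSymm) (hnd : ∀ x, (∀ y, B x y = 0) → x = 0)
    (h : IsProjJet B P dP) {Pf : W →L[ℝ] W} {dPf : V → W →L[ℝ] W} (hf : IsProjJet B Pf dPf)
    {ν e : W} {dν : V → W} {L : V → W} {a : V → ℝ} {c : ℝ} (hc : c * B ν ν = 1)
    (hν : P ν = ν) (hPf : ∀ x, Pf x = P x - (c * B ν x) • ν)
    (hdPf : ∀ v x, dPf v x = dP v x - (c * B (dν v) x) • ν - (c * B ν x) • dν v)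
    (hdν : ∀ v, dP v ν = dν v - P (dν v)) (hL : ∀ v, dν v = L v - a v • e)
    (hPL : ∀ v, P (L v) = 0)
    (hsymm : ∀ v w ζ, P ζ = ζ → B (dP v ζ) (L w) = B (dP w ζ) (L v)) :
    FlatJet P dP ↔ FlatJet Pf dPf ∧ ∀ v w ζ, Pf ζ = ζ →
      a v * B (dP w ζ) e = a w * B (dP v ζ) e := by
  rw [h.flatJet_iff hnd, hf.flatJet_iff hnd]
  have hmem : ∀ ζ, Pf ζ = ζ → P ζ = ζ ∧ B ν ζ = 0 := by
    intro ζ hζ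
    have h1 : B ν ζ = 0 := by
      rw [← hζ, hPf, map_sub, map_smul, ← h.symm, hν, smul_eq_mul]
      linear_combination (-B ν ζ) * hc
    refine ⟨?_, h1⟩
    have := hPf ζ
    rw [hζ, h1] at this
    simpa using this.symm
  have hmem' : ∀ ζ, P ζ = ζ → B ν ζ = 0 → Pf ζ = ζ := by
    intro ζ h1 h2
    rw [hPf, h1, h2]; simp
  -- Passing from P to Pf adds a term that is symmetric in v and w, so it does not affect the
  -- symmetry condition on vectors orthogonal to ν.
  have hform : ∀ v w ζ ζ', Pf ζ = ζ → Pf ζ' = ζ' → B (dPf v ζ) (dPf w ζ') =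
      B (dP v ζ) (dP w ζ') + c * (a v * a w * (B e ζ * B e ζ')) := by
    intro v w ζ ζ' hζ hζ'
    obtain ⟨h1, h2⟩ := hmem ζ hζ
    obtain ⟨h1', h2'⟩ := hmem ζ' hζ'
    have h3 : ∀ v ζ, P ζ = ζ → B (dν v) ζ = - (a v * B e ζ) := by
      intro v ζ hζ
      rw [hL, map_sub, LinearMap.sub_apply, h.form_eq_zero (hPL v) hζ, map_smul]
      simp
    have h4 : B (dP v ζ) ν = 0 := h.form_eq_zero (h.proj_deriv h1 v) hν
    have h5 : B ν (dP w ζ') = 0 := h.form_eq_zero' (h.proj_deriv h1' w) hν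
    rw [hdPf, hdPf, h2, h2', h3 v ζ h1, h3 w ζ' h1']
    simp only [map_sub, map_smul, LinearMap.sub_apply, LinearMap.smul_apply, smul_eq_mul, h4, h5]
    linear_combination (a v * a w * B e ζ * B e ζ' * c) * hc
  -- The pairing with ν is the source of the extra condition: its first term is symmetric in v, w by
  -- `hsymm`, and only the term with `a` remains.
  have hnu : ∀ v w ζ, P ζ = ζ → B (dP w ζ) (dP v ν) = B (dP w ζ) (L v) - a v * B (dP w ζ) e := by
    intro v w ζ hζ
    rw [hdν, map_sub, h.form_eq_zero (h.proj_deriv hζ w) (h.idem _), hL]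
    simp
  constructor
  · intro hF
    refine ⟨fun v w ζ ζ' hζ hζ' => ?_, fun v w ζ hζ => ?_⟩
    · rw [hform v w ζ ζ' hζ hζ', hform w v ζ ζ' hζ hζ', hF v w ζ ζ' (hmem ζ hζ).1 (hmem ζ' hζ').1]
      ring
    · have hP := (hmem ζ hζ).1
      have h1 := hF v w ζ ν hP hν
      rw [hnu v w ζ hP, hnu w v ζ hP, hsymm v w ζ hP] at h1
      linarith
  · rintro ⟨hflat, ha⟩ v w
    have hνν : B (dP v ν) (dP w ν) = B (dP w ν) (dP v ν) := hB.eq _ _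
    have hζζ : ∀ ζ ζ', Pf ζ = ζ → Pf ζ' = ζ' →
        B (dP v ζ) (dP w ζ') = B (dP w ζ) (dP v ζ') := by
      intro ζ ζ' hζ hζ'
      have h1 := hflat v w ζ ζ' hζ hζ'
      rw [hform v w ζ ζ' hζ hζ', hform w v ζ ζ' hζ hζ'] at h1
      linarith
    have hζν : ∀ ζ, Pf ζ = ζ → B (dP v ζ) (dP w ν) = B (dP w ζ) (dP v ν) := by
      intro ζ hζ
      have hP := (hmem ζ hζ).1
      rw [hnu v w ζ hP, hnu w v ζ hP, hsymm v w ζ hP, ha v w ζ hζ]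
    have hdec : ∀ ζ, P ζ = ζ → ∃ ζ₀, ∃ t : ℝ, Pf ζ₀ = ζ₀ ∧ ζ = ζ₀ + t • ν := by
      intro ζ hζ
      refine ⟨Pf ζ, c * B ν ζ, hf.idem ζ, ?_⟩
      rw [hPf, hζ]; simp
    intro ζ ζ' hζ hζ'
    obtain ⟨ζ₀, t, h0, rfl⟩ := hdec ζ hζ
    obtain ⟨ζ₁, t', h1, rfl⟩ := hdec ζ' hζ'
    have e1 := hζζ ζ₀ ζ₁ h0 h1
    have e2 := hζν ζ₀ h0
    have e3 := hζν ζ₁ h1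
    have s1 := hB.eq (dP v ζ₁) (dP w ν)
    have s2 := hB.eq (dP w ζ₁) (dP v ν)
    simp only [map_add, map_smul, LinearMap.add_apply, LinearMap.smul_apply, smul_eq_mul]
    linear_combination e1 + t' * e2 - t * e3 + t * s1 - t * s2 + t * t' * hνν

end IsProjJet

end ProjectionJets

/-! ### Jets obtained by differentiating families of projections -/

section JetOfDerivative

variable {V W : Type*} [NormedAddCommGroup V] [NormedSpace ℝ V]
  [NormedAddCommGroup W] [NormedSpace ℝ W] [FiniteDimensional ℝ W]


lemma hasFDerivAt_form (B : LinearMap.BilinForm ℝ W) {F G : V → W} {F' G' : V →L[ℝ] W} {u : V}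
    (hF : HasFDerivAt F F' u) (hG : HasFDerivAt G G' u) :
    ∃ D : V →L[ℝ] ℝ, HasFDerivAt (fun x => B (F x) (G x)) D u ∧
      ∀ v, D v = B (F u) (G' v) + B (F' v) (G u) := by
  refine ⟨_, (LinearMap.toContinuousBilinearMap B).hasFDerivAt_of_bilinear hF hG, fun v => ?_⟩
  simp

lemma isProjJet_of_hasFDerivAt {B : LinearMap.BilinForm ℝ W} {P : V → W →L[ℝ] W}
    {dP : V →L[ℝ] W →L[ℝ] W} {u : V} (hP : HasFDerivAt P dP u)
    (hidem : ∀ᶠ y in nhds u, ∀ x, P y (P y x) = P y x)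
    (hsymm : ∀ᶠ y in nhds u, ∀ x x', B (P y x) x' = B x (P y x')) :
    IsProjJet B (P u) (fun v => dP v) where
  idem := hidem.self_of_nhds
  symm := hsymm.self_of_nhds
  didem v x := by
    have h1 : HasFDerivAt (fun y => P y x) (dP.flip x) u := by
      simpa using hP.clm_apply (hasFDerivAt_const x u)
    have h2 := hP.clm_apply h1
    have h3 := h2.unique (h1.congr_of_eventuallyEq (hidem.mono fun y hy => hy x))
    have h4 := congrArg (fun D : V →L[ℝ] W => D v) h3
    simpa [add_comm] using h4
  dsymm v x y := by
    have h1 : ∀ x, HasFDerivAt (fun y => P y x) (dP.flip x) u := fun x => by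
      simpa using hP.clm_apply (hasFDerivAt_const x u)
    obtain ⟨D, hD, hDv⟩ := hasFDerivAt_form B (h1 x) (hasFDerivAt_const y u)
    obtain ⟨D', hD', hDv'⟩ := hasFDerivAt_form B (hasFDerivAt_const x u) (h1 y)
    have h3 := hD.unique (hD'.congr_of_eventuallyEq (hsymm.mono fun z hz => hz x y))
    have h4 := congrArg (fun D : V →L[ℝ] ℝ => D v) h3
    simpa [hDv, hDv'] using h4

/-- The derivative of the normal projection on tangent vectors is minus the normal part of the
second derivative. -/
lemma deriv_proj_tangent {P : V → W →L[ℝ] W} {dP : V →L[ℝ] W →L[ℝ] W} {L : V → V →L[ℝ] W}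
    {H : V →L[ℝ] V →L[ℝ] W} {u : V} (hP : HasFDerivAt P dP u) (hL : HasFDerivAt L H u)
    (h0 : ∀ᶠ y in nhds u, ∀ v, P y (L y v) = 0) (v w : V) :
    dP v (L u w) = - P u (H v w) := by
  have h1 : HasFDerivAt (fun y => L y w) (H.flip w) u := by
    simpa using hL.clm_apply (hasFDerivAt_const w u)
  have h2 := hP.clm_apply h1
  have h3 := h2.unique ((hasFDerivAt_const (0 : W) u).congr_of_eventuallyEq
    (h0.mono fun y hy => hy w))
  have h4 := congrArg (fun D : V →L[ℝ] W => D v) h3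
  simp only [_root_.add_apply, ContinuousLinearMap.comp_apply,
    ContinuousLinearMap.flip_apply, _root_.zero_apply] at h4
  exact eq_neg_of_add_eq_zero_right h4

end JetOfDerivative

/-! ### Local parallel sections of a flat family of projections -/

section ParallelSections

variable {V W : Type*} [NormedAddCommGroup V] [NormedSpace ℝ V]
  [NormedAddCommGroup W] [NormedSpace ℝ W]

/-- On the ball of radius ‖ζ₀‖ about ζ₀ the speed is at most (1/2)·2‖ζ₀‖ = ‖ζ₀‖, so Picard–Lindelöf
reaches time 1 in one step. Gronwall gives the factor e^{1/2}, weakened to e. -/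
lemma exists_linearODE_solution [CompleteSpace W] {c : ℝ → W →L[ℝ] W}
    (hc : ContinuousOn c (Icc 0 1)) (hb : ∀ t ∈ Icc (0 : ℝ) 1, ‖c t‖ ≤ 1 / 2) (ζ₀ : W) :
    ∃ Z : ℝ → W, Z 0 = ζ₀ ∧
      (∀ t ∈ Icc (0 : ℝ) 1, HasDerivWithinAt Z (c t (Z t)) (Icc 0 1) t) ∧
      ∀ t ∈ Icc (0 : ℝ) 1, ‖Z t‖ ≤ ‖ζ₀‖ * Real.exp 1 := by
  have hPL : IsPicardLindelof (fun t x => c t x) (tmin := 0) (tmax := 1)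
      ⟨0, left_mem_Icc.2 zero_le_one⟩ ζ₀ ‖ζ₀‖₊ 0 ‖ζ₀‖₊ 1 := by
    refine ⟨fun t ht => ?_, fun x _ => hc.clm_apply continuousOn_const, fun t ht x hx => ?_, ?_⟩
    · refine (((c t).lipschitz).weaken ?_).lipschitzOnWith
      rw [← NNReal.coe_le_coe, coe_nnnorm]
      exact (hb t ht).trans (by norm_num)
    · have h1 : ‖x‖ ≤ ‖ζ₀‖ + ‖ζ₀‖ := by
        have : ‖x - ζ₀‖ ≤ ‖ζ₀‖ := by simpa [dist_eq_norm] using hx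
        linarith [norm_le_norm_add_norm_sub' x ζ₀]
      have h2 := (c t).le_of_opNorm_le_of_le (hb t ht) h1
      simp only [coe_nnnorm]
      linarith
    · simp
  obtain ⟨Z, hZ0, hZ⟩ := hPL.exists_eq_forall_mem_Icc_hasDerivWithinAt
    (x := ζ₀) (by simp)
  refine ⟨Z, hZ0, hZ, fun t ht => ?_⟩
  have h := norm_le_gronwallBound_of_norm_deriv_right_le (f := Z) (f' := fun t => c t (Z t))
    (δ := ‖ζ₀‖) (K := 1 / 2) (ε := 0) (a := 0) (b := 1)
    (fun t ht => (hZ t ht).continuousWithinAt)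
    (fun t ht => (hZ t (Ico_subset_Icc_self ht)).mono_of_mem_nhdsWithin
      (Icc_mem_nhdsGE_of_mem ht)) (by rw [← hZ0])
    (fun t ht => by
      simpa using (c t).le_of_opNorm_le (hb t (Ico_subset_Icc_self ht)) (Z t)) t ht
  rw [gronwallBound_ε0] at h
  refine h.trans (mul_le_mul_of_nonneg_left (Real.exp_le_exp.2 ?_) (norm_nonneg _))
  linarith [ht.2]

/-- The defect Y = Z - pZ satisfies Y' = -p c Y, because p c p = 0, and Y(0) = 0. Uniqueness for
this linear equation gives Y = 0. -/
lemma linearODE_solution_mem_range {p : ℝ → W →L[ℝ] W} {c : ℝ → W →L[ℝ] W} {Z : ℝ → W}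
    (hp : ∀ t ∈ Icc (0 : ℝ) 1, HasDerivWithinAt p (c t) (Icc 0 1) t)
    (hd : ∀ t ∈ Icc (0 : ℝ) 1, ∀ x, p t (c t (p t x)) = 0)
    (hb : ∀ t ∈ Icc (0 : ℝ) 1, ‖c t‖ ≤ 1 / 2) {C : ℝ} (hpb : ∀ t ∈ Icc (0 : ℝ) 1, ‖p t‖ ≤ C)
    (hZ : ∀ t ∈ Icc (0 : ℝ) 1, HasDerivWithinAt Z (c t (Z t)) (Icc 0 1) t)
    (h0 : p 0 (Z 0) = Z 0) : ∀ t ∈ Icc (0 : ℝ) 1, p t (Z t) = Z t := by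
  have hD : ∀ t ∈ Icc (0 : ℝ) 1, HasDerivWithinAt (fun t => Z t - p t (Z t))
      (- p t (c t (Z t - p t (Z t)))) (Icc 0 1) t := by
    intro t ht
    have h := (hZ t ht).sub ((hp t ht).clm_apply (hZ t ht))
    refine h.congr_deriv ?_
    rw [map_sub, map_sub, hd t ht]
    abel
  have hC : 0 ≤ C := (norm_nonneg _).trans (hpb 0 (by simp))
  intro t ht
  have := eq_zero_of_abs_deriv_le_mul_abs_self_of_eq_zero_right (K := C * (1 / 2))
    (fun t ht => (hD t ht).continuousWithinAt)
    (fun t ht => (hD t (Ico_subset_Icc_self ht)).mono_of_mem_nhdsWithin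
      (Icc_mem_nhdsGE_of_mem ht)) (by simp [h0])
    (fun t ht => by
      have ht' := Ico_subset_Icc_self ht
      rw [norm_neg, mul_assoc]
      exact (p t).le_of_opNorm_le_of_le (hpb t ht') ((c t).le_of_opNorm_le (hb t ht') _)) t ht
  exact (sub_eq_zero.1 this).symm

/-- Growth of z' - z - t A(y)v z, where z and z' are transported along two neighbouring rays.
Flatness (`hcomm`) and symmetry of the second derivative (`hsymm`) cancel all terms of first order
in v. There remain a linear term in the defect itself and a Taylor remainder of order ‖v‖². -/
lemma parallel_estimate {A : V → V →L[ℝ] W →L[ℝ] W} {A2 : V → V →L[ℝ] V →L[ℝ] W →L[ℝ] W}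
    {S : Set V} (hS : Convex ℝ S) {C M : ℝ} (hC : 0 ≤ C)
    (hA : ∀ y ∈ S, HasFDerivAt A (A2 y) y) (hAb : ∀ y ∈ S, ‖A y‖ ≤ C)
    (hA2b : ∀ y ∈ S, ‖A2 y‖ ≤ C) (hA2l : ∀ y ∈ S, ∀ z ∈ S, ‖A2 y - A2 z‖ ≤ C * ‖y - z‖)
    {y y' e v : V} (hy : y ∈ S) (hy' : y' ∈ S) {t : ℝ} (ht : t ∈ Icc (0 : ℝ) 1)
    (hyy : y' - y = t • v) (he : ‖e‖ ≤ 1) (hev : ‖A y' (e + v)‖ ≤ 1 / 2) {z z' : W} (hz : ‖z‖ ≤ M)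
    (hcomm : A y v (A y e z) = A y e (A y v z)) (hsymm : A2 y e v = A2 y v e) :
    ‖A y' (e + v) z' - A y e z - (A y v z + (t • (A2 y e v z + A y v (A y e z))))‖ ≤
      1 / 2 * ‖z' - z - t • A y v z‖ + (2 * C * M + 2 * C * C * M) * ‖v‖ ^ 2 := by
  have hM : 0 ≤ M := (norm_nonneg _).trans hz
  have hv := norm_nonneg v
  have ht0 := ht.1
  have ht1 := ht.2
  have htv : ‖y' - y‖ ≤ ‖v‖ := by
    rw [hyy, norm_smul, Real.norm_eq_abs, abs_of_nonneg ht0]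
    nlinarith
  have hlip : ‖A y' - A y‖ ≤ C * ‖v‖ :=
    (hS.norm_image_sub_le_of_norm_hasFDerivWithin_le (fun z hz => (hA z hz).hasFDerivWithinAt)
      hA2b hy hy').trans (mul_le_mul_of_nonneg_left htv hC)
  have htay : ‖A y' - A y - A2 y (t • v)‖ ≤ C * ‖v‖ ^ 2 := by
    have hseg : segment ℝ y y' ⊆ S := hS.segment_subset hy hy'
    have h := (convex_segment (𝕜 := ℝ) y y').norm_image_sub_le_of_norm_hasFDerivWithin_le' (f := A)
      (f' := A2) (φ := A2 y) (C := C * ‖v‖)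
      (fun z hz => (hA z (hseg hz)).hasFDerivWithinAt) (fun z hz => ?_)
      (left_mem_segment ℝ y y') (right_mem_segment ℝ y y')
    · rw [hyy] at h
      refine h.trans ?_
      have : ‖t • v‖ ≤ ‖v‖ := hyy ▸ htv
      calc C * ‖v‖ * ‖t • v‖ ≤ C * ‖v‖ * ‖v‖ := by gcongr
        _ = C * ‖v‖ ^ 2 := by ring
    · refine (hA2l z (hseg hz) y hy).trans (mul_le_mul_of_nonneg_left ?_ hC)
      obtain ⟨θ, hθ, rfl⟩ := (segment_eq_image' ℝ y y' ▸ hz : z ∈ _)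
      have : y + θ • (y' - y) - y = θ • (y' - y) := by abel
      rw [this, norm_smul, Real.norm_eq_abs, abs_of_nonneg hθ.1]
      nlinarith [hθ.2, norm_nonneg (y' - y)]
  -- After `hcomm` and `hsymm`, the first summand is linear in the defect, and every other one has
  -- two factors of size ‖v‖ or is a second-order Taylor remainder.
  have hid : A y' (e + v) z' - A y e z - (A y v z + (t • (A2 y e v z + A y v (A y e z)))) =
      A y' (e + v) (z' - z - t • A y v z) +
      ((A y' - A y - A2 y (t • v)) e z + (A y' - A y) v z +
      t • ((A y' - A y) e (A y v z) + A y' v (A y v z))) := by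
    rw [hcomm, hsymm]
    simp only [map_add, map_sub, map_smul, _root_.add_apply, _root_.sub_apply,
      _root_.smul_apply, smul_add, smul_sub]
    abel
  rw [hid]
  have b0 : ‖A y' (e + v) (z' - z - t • A y v z)‖ ≤ 1 / 2 * ‖z' - z - t • A y v z‖ :=
    (A y' (e + v)).le_of_opNorm_le hev _
  have bil : ∀ {T : V →L[ℝ] W →L[ℝ] W} {a b c : ℝ} {u : V} {x : W}, ‖T‖ ≤ a → ‖u‖ ≤ b → ‖x‖ ≤ c →
      ‖T u x‖ ≤ a * b * c := by
    intro T a b c u x h1 h2 h3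
    exact (T u).le_of_opNorm_le_of_le (T.le_of_opNorm_le_of_le h1 h2) h3
  have b1 := bil htay he hz
  have b2 := bil hlip le_rfl hz (u := v)
  have b5 := bil (hAb y hy) le_rfl hz (u := v)
  have b3 := bil hlip he b5
  have b4 := bil (hAb y' hy') le_rfl b5 (u := v)
  have b6 : ‖t • ((A y' - A y) e (A y v z) + A y' v (A y v z))‖ ≤
      ‖(A y' - A y) e (A y v z)‖ + ‖A y' v (A y v z)‖ := by
    rw [norm_smul, Real.norm_eq_abs, abs_of_nonneg ht0]
    nlinarith [norm_add_le ((A y' - A y) e (A y v z)) (A y' v (A y v z)),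
      norm_nonneg ((A y' - A y) e (A y v z) + A y' v (A y v z))]
  refine (norm_add_le _ _).trans (add_le_add b0 ?_)
  refine (norm_add_le _ _).trans ((add_le_add (norm_add_le _ _) b6).trans ?_)
  nlinarith

lemma hasDerivWithinAt_parallel_defect {A : V → V →L[ℝ] W →L[ℝ] W}
    {A2 : V →L[ℝ] V →L[ℝ] W →L[ℝ] W} {y : ℝ → V} {e v : V} {t : ℝ} {s : Set ℝ}
    (hy : HasDerivAt y e t) (hA : HasFDerivAt A A2 (y t)) {Z Z' : ℝ → W} {z z' : W}
    (hZ : HasDerivWithinAt Z z s t) (hZ' : HasDerivWithinAt Z' z' s t) :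
    HasDerivWithinAt (fun t => Z' t - Z t - t • A (y t) v (Z t))
      (z' - z - (A (y t) v (Z t) + t • (A2 e v (Z t) + A (y t) v z))) s t := by
  have hAt : HasDerivAt (fun t : ℝ => A (y t) v) (A2 e v) t := by
    simpa using (hA.comp_hasDerivAt t hy).clm_apply (hasDerivAt_const t v)
  have h := (hZ'.sub hZ).sub
    ((hasDerivWithinAt_id t s).smul (hAt.hasDerivWithinAt.clm_apply hZ))
  refine h.congr_deriv ?_
  simp [add_comm]

/-- Parallel sections on a ball that is small in terms of `C²` bounds. -/
lemma exists_parallel_section_ball [CompleteSpace W] {P : V → W →L[ℝ] W}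
    {A : V → V →L[ℝ] W →L[ℝ] W} {A2 : V → V →L[ℝ] V →L[ℝ] W →L[ℝ] W} {x₀ : V} {r C C₃ : ℝ}
    (hrpos : 0 < r) (hr1 : r ≤ 1) (hC0 : 0 ≤ C) (hCr : C * r ≤ 1 / 2)
    (hPA : ∀ y ∈ Metric.ball x₀ r, HasFDerivAt P (A y) y)
    (hAA : ∀ y ∈ Metric.ball x₀ r, HasFDerivAt A (A2 y) y)
    (hPb : ∀ y ∈ Metric.ball x₀ r, ‖P y‖ ≤ C₃)
    (hAb : ∀ y ∈ Metric.ball x₀ r, ‖A y‖ ≤ C)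
    (hA2b : ∀ y ∈ Metric.ball x₀ r, ‖A2 y‖ ≤ C)
    (hA2l : ∀ y ∈ Metric.ball x₀ r, ∀ z ∈ Metric.ball x₀ r, ‖A2 y - A2 z‖ ≤ C * ‖y - z‖)
    (hsymmA2 : ∀ y ∈ Metric.ball x₀ r, ∀ v w, A2 y v w = A2 y w v)
    (hidem : ∀ y ∈ Metric.ball x₀ r, ∀ ζ, P y (P y ζ) = P y ζ)
    (hflat : ∀ y ∈ Metric.ball x₀ r, ∀ v w ζ, P y ζ = ζ → A y v (A y w ζ) = A y w (A y v ζ))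
    {ζ₀ : W} (hζ₀ : P x₀ ζ₀ = ζ₀) :
    ∃ ζ : V → W, ζ x₀ = ζ₀ ∧ ∀ x ∈ Metric.ball x₀ r, P x (ζ x) = ζ x ∧
      HasFDerivAt ζ ((A x).flip (ζ x)) x := by
  have hray : ∀ x ∈ Metric.ball x₀ r, ∀ t ∈ Icc (0 : ℝ) 1,
      x₀ + t • (x - x₀) ∈ Metric.ball x₀ r := by
    intro x hx t ht
    rw [mem_ball_iff_norm] at hx ⊢
    rw [add_sub_cancel_left, norm_smul, Real.norm_eq_abs, abs_of_nonneg ht.1]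
    nlinarith [ht.2, norm_nonneg (x - x₀)]
  have hline : ∀ (x : V) (t : ℝ), HasDerivAt (fun t : ℝ => x₀ + t • (x - x₀)) (x - x₀) t := by
    intro x t
    simpa using ((hasDerivAt_id t).smul_const (x - x₀)).const_add x₀
  have hcb : ∀ x ∈ Metric.ball x₀ r, ∀ y ∈ Metric.ball x₀ r, ‖A y (x - x₀)‖ ≤ 1 / 2 := by
    intro x hx y hy
    refine ((A y).le_of_opNorm_le_of_le (hAb y hy) (mem_ball_iff_norm.1 hx).le).trans hCr
  -- The section at x is the end value of the transport of ζ₀ along the ray from x₀ to x. A parallel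
  -- section satisfies dζ(v) = dP(v)ζ, which along the ray is this linear equation.
  have hex : ∀ x, ∃ Z : ℝ → W, x ∈ Metric.ball x₀ r → Z 0 = ζ₀ ∧
      (∀ t ∈ Icc (0 : ℝ) 1,
        HasDerivWithinAt Z (A (x₀ + t • (x - x₀)) (x - x₀) (Z t)) (Icc 0 1) t) ∧
      (∀ t ∈ Icc (0 : ℝ) 1, ‖Z t‖ ≤ ‖ζ₀‖ * Real.exp 1) ∧
      ∀ t ∈ Icc (0 : ℝ) 1, P (x₀ + t • (x - x₀)) (Z t) = Z t := by
    intro x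
    by_cases hx : x ∈ Metric.ball x₀ r
    swap
    · exact ⟨0, fun h => absurd h hx⟩
    obtain ⟨Z, hZ0, hZ, hZb⟩ := exists_linearODE_solution (c := fun t => A (x₀ + t • (x - x₀)) (x - x₀))
      (fun t ht => (((hAA _ ((hray x hx t ht))).continuousAt.comp
        (f := fun t : ℝ => x₀ + t • (x - x₀))
        (hline x t).continuousAt).clm_apply continuousAt_const).continuousWithinAt)
      (fun t ht => hcb x hx _ (hray x hx t ht)) ζ₀
    refine ⟨Z, fun _ => ⟨hZ0, hZ, hZb, ?_⟩⟩
    refine linearODE_solution_mem_range (p := fun t => P (x₀ + t • (x - x₀)))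
      (fun t ht => ((hPA _ ((hray x hx t ht))).comp_hasDerivAt t
        (hline x t)).hasDerivWithinAt)
      (fun t ht y => ?_) (fun t ht => hcb x hx _ (hray x hx t ht))
      (fun t ht => hPb _ (hray x hx t ht)) hZ (by simpa [hZ0] using hζ₀)
    have hy := (hray x hx t ht)
    have h1 : HasFDerivAt (fun y' => P y' y) ((A (x₀ + t • (x - x₀))).flip y)
        (x₀ + t • (x - x₀)) := by
      simpa using (hPA _ hy).clm_apply (hasFDerivAt_const y (x₀ + t • (x - x₀)))
    have h2 := (hPA _ hy).clm_apply h1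
    have h3 := h2.unique (h1.congr_of_eventuallyEq
      (Filter.eventually_of_mem (Metric.isOpen_ball.mem_nhds hy) fun z hz => hidem z hz y))
    have h4 := congrArg (fun D : V →L[ℝ] W => P (x₀ + t • (x - x₀)) (D (x - x₀))) h3
    simpa [hidem _ hy] using h4
  choose Z hZ using hex
  refine ⟨fun x => Z x 1, ?_, fun x hx => ⟨?_, ?_⟩⟩
  · obtain ⟨h0, hd, -⟩ := hZ x₀ (Metric.mem_ball_self hrpos)
    have h1 : ∀ t ∈ Icc (0 : ℝ) 1, HasDerivWithinAt (Z x₀) 0 (Icc 0 1) t := fun t ht => by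
      simpa using hd t ht
    have := constant_of_has_deriv_right_zero (fun t ht => (h1 t ht).continuousWithinAt)
      (fun t ht => (h1 t (Ico_subset_Icc_self ht)).mono_of_mem_nhdsWithin
        (Icc_mem_nhdsGE_of_mem ht)) 1 (right_mem_Icc.2 zero_le_one)
    simpa [h0] using this
  · have := (hZ x hx).2.2.2 1 (right_mem_Icc.2 zero_le_one)
    simpa using this
  · obtain ⟨h0, hd, hb, hp⟩ := hZ x hx
    set M := ‖ζ₀‖ * Real.exp 1 with hM
    set D := 2 * C * M + 2 * C * C * M with hD
    -- Gronwall for the defect of the rays to x and x + v. Both transports start at ζ₀, so its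
    -- initial value is zero and only the quadratic source term contributes.
    have hest : ∀ v, x + v ∈ Metric.ball x₀ r →
        ‖Z (x + v) 1 - Z x 1 - A x v (Z x 1)‖ ≤
          (D * ‖v‖ ^ 2) / (1 / 2) * (Real.exp (1 / 2) - 1) := by
      intro v hv
      obtain ⟨h0', hd', -, -⟩ := hZ (x + v) hv
      have hY : ∀ t ∈ Icc (0 : ℝ) 1, HasDerivWithinAt
          (fun t => Z (x + v) t - Z x t - t • A (x₀ + t • (x - x₀)) v (Z x t))
          (A (x₀ + t • (x + v - x₀)) (x - x₀ + v) (Z (x + v) t) -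
            A (x₀ + t • (x - x₀)) (x - x₀) (Z x t) - (A (x₀ + t • (x - x₀)) v (Z x t) +
            (t • (A2 (x₀ + t • (x - x₀)) (x - x₀) v (Z x t) +
              A (x₀ + t • (x - x₀)) v (A (x₀ + t • (x - x₀)) (x - x₀) (Z x t))))))
          (Icc 0 1) t := by
        intro t ht
        have h2 := hasDerivWithinAt_parallel_defect (v := v) (hline x t)
          (hAA _ (hray x hx t ht)) (hd t ht) (hd' t ht)
        rwa [show x + v - x₀ = x - x₀ + v by abel] at h2 ⊢
      have h := norm_le_gronwallBound_of_norm_deriv_right_le (δ := 0) (K := 1 / 2)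
        (ε := D * ‖v‖ ^ 2) (fun t ht => (hY t ht).continuousWithinAt)
        (fun t ht => (hY t (Ico_subset_Icc_self ht)).mono_of_mem_nhdsWithin
          (Icc_mem_nhdsGE_of_mem ht)) (by simp [h0, h0'])
        (fun t ht => by
          have ht' := Ico_subset_Icc_self ht
          have hyS := hray x hx t ht'
          have hyS' := hray (x + v) hv t ht'
          refine parallel_estimate (S := Metric.ball x₀ r) (convex_ball x₀ r)
            hC0
            (fun y hy => hAA y (hy)) hAb hA2b hA2l hyS hyS' ht' ?_
            ((mem_ball_iff_norm.1 hx).le.trans hr1) ?_ (hb t ht') ?_ (hsymmA2 _ (hyS) _ _)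
          · rw [add_sub_add_left_eq_sub, ← smul_sub]; congr 1; abel
          · have := hcb (x + v) hv _ hyS'
            rwa [show x + v - x₀ = x - x₀ + v by abel] at this ⊢
          · exact hflat _ (hyS) _ _ _ (hp t ht')) 1 (right_mem_Icc.2 zero_le_one)
      rw [gronwallBound_of_K_ne_0 (by norm_num)] at h
      simpa using h
    rw [hasFDerivAt_iff_isLittleO_nhds_zero]
    refine Asymptotics.IsBigO.trans_isLittleO (g := fun v : V => ‖v‖ ^ 2) ?_
      (Asymptotics.isLittleO_norm_pow_id one_lt_two)
    refine Asymptotics.IsBigO.of_bound (D / (1 / 2) * (Real.exp (1 / 2) - 1)) ?_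
    have hnear : ∀ᶠ v in nhds (0 : V), x + v ∈ Metric.ball x₀ r := by
      have : Filter.Tendsto (fun v : V => x + v) (nhds 0) (nhds x) := by
        have := (continuous_const_add x).tendsto (0 : V)
        rwa [add_zero] at this
      exact this (Metric.isOpen_ball.mem_nhds hx)
    filter_upwards [hnear] with v hv
    rw [norm_pow, norm_norm]
    refine (hest v hv).trans (le_of_eq ?_)
    ring

/-- A flat family of projections near a point has parallel sections through every vector of the
image at that point. -/
theorem exists_parallel_section [CompleteSpace W] {P : V → W →L[ℝ] W} {O : Set V} (hO : IsOpen O)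
    {x₀ : V} (hx₀ : x₀ ∈ O) (hP : ContDiffOn ℝ ∞ P O)
    (hidem : ∀ x ∈ O, ∀ ζ, P x (P x ζ) = P x ζ)
    (hflat : ∀ x ∈ O, ∀ v w ζ, P x ζ = ζ →
      fderiv ℝ P x v (fderiv ℝ P x w ζ) = fderiv ℝ P x w (fderiv ℝ P x v ζ)) :
    ∃ r > 0, Metric.ball x₀ r ⊆ O ∧ ∀ ζ₀, P x₀ ζ₀ = ζ₀ → ∃ ζ : V → W, ζ x₀ = ζ₀ ∧
      ∀ x ∈ Metric.ball x₀ r, P x (ζ x) = ζ x ∧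
        HasFDerivAt ζ ((fderiv ℝ P x).flip (ζ x)) x := by
  set A := fderiv ℝ P with hA
  set A2 := fderiv ℝ A with hA2
  have hPA : ∀ y ∈ O, HasFDerivAt P (A y) y := fun y hy =>
    ((hP.contDiffAt (hO.mem_nhds hy)).differentiableAt (by simp)).hasFDerivAt
  have hAc : ContDiffOn ℝ ∞ A O := hP.fderiv_of_isOpen hO (by simp)
  have hAA : ∀ y ∈ O, HasFDerivAt A (A2 y) y := fun y hy =>
    ((hAc.contDiffAt (hO.mem_nhds hy)).differentiableAt (by simp)).hasFDerivAt
  have hA2c : ContDiffOn ℝ ∞ A2 O := hAc.fderiv_of_isOpen hO (by simp)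
  have hOx := hO.mem_nhds hx₀
  have hsymmA2 : ∀ y ∈ O, ∀ v w, A2 y v w = A2 y w v := fun y hy v w =>
    ((hP.contDiffAt (hO.mem_nhds hy)).isSymmSndFDerivAt (by
      rw [minSmoothness_of_isRCLikeNormedField]
      exact ENat.LEInfty.out)).eq v w
  -- Local Lipschitz continuity of the second derivative; it makes the Taylor remainder of A
  -- quadratic.
  obtain ⟨K, S, hS, hK⟩ := ((hA2c.contDiffAt hOx).of_le
    (by simp : (1 : WithTop ℕ∞) ≤ ∞)).exists_lipschitzOnWith
  obtain ⟨C₁, hC₁⟩ : ∃ C₁, ∀ᶠ y in nhds x₀, ‖A y‖ ≤ C₁ :=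
    ⟨‖A x₀‖ + 1, ((hAc.contDiffAt hOx).continuousAt.norm.eventually_le_const (by simp))⟩
  obtain ⟨C₂, hC₂⟩ : ∃ C₂, ∀ᶠ y in nhds x₀, ‖A2 y‖ ≤ C₂ :=
    ⟨‖A2 x₀‖ + 1, ((hA2c.contDiffAt hOx).continuousAt.norm.eventually_le_const (by simp))⟩
  obtain ⟨C₃, hC₃⟩ : ∃ C₃, ∀ᶠ y in nhds x₀, ‖P y‖ ≤ C₃ :=
    ⟨‖P x₀‖ + 1, ((hP.contDiffAt hOx).continuousAt.norm.eventually_le_const (by simp))⟩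
  obtain ⟨C, hCK, hC1, hCC₁, hCC₂⟩ : ∃ C : ℝ, K ≤ C ∧ 1 ≤ C ∧ C₁ ≤ C ∧ C₂ ≤ C :=
    ⟨max (max K 1) (max C₁ C₂), by simp, by simp, by simp, by simp⟩
  obtain ⟨r₀, hr₀, hball⟩ := Metric.eventually_nhds_iff_ball.1
    (hC₁.and (hC₂.and (hC₃.and ((Filter.eventually_of_mem hOx fun _ h => h :
      ∀ᶠ y in nhds x₀, y ∈ O).and hS))))
  -- The second bound makes ‖A y‖‖x - x₀‖ ≤ 1/2 on the ball, as the transport equation requires.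
  set r := min r₀ (1 / (2 * C)) with hr
  have hrpos : 0 < r := lt_min hr₀ (by positivity)
  have hCr : C * r ≤ 1 / 2 := by
    have : r ≤ 1 / (2 * C) := min_le_right _ _
    calc C * r ≤ C * (1 / (2 * C)) := by gcongr
      _ = 1 / 2 := by field_simp
  have hr1 : r ≤ 1 := by nlinarith
  have hsub : Metric.ball x₀ r ⊆ Metric.ball x₀ r₀ := Metric.ball_subset_ball (min_le_left _ _)
  have hBO : Metric.ball x₀ r ⊆ O := fun y hy => (hball y (hsub hy)).2.2.2.1
  have hAb : ∀ y ∈ Metric.ball x₀ r, ‖A y‖ ≤ C := fun y hy => (hball y (hsub hy)).1.trans hCC₁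
  have hA2b : ∀ y ∈ Metric.ball x₀ r, ‖A2 y‖ ≤ C := fun y hy => (hball y (hsub hy)).2.1.trans hCC₂
  have hPb : ∀ y ∈ Metric.ball x₀ r, ‖P y‖ ≤ C₃ := fun y hy => (hball y (hsub hy)).2.2.1
  have hA2l : ∀ y ∈ Metric.ball x₀ r, ∀ z ∈ Metric.ball x₀ r, ‖A2 y - A2 z‖ ≤ C * ‖y - z‖ :=
    fun y hy z hz => (hK.norm_sub_le (hball y (hsub hy)).2.2.2.2
      (hball z (hsub hz)).2.2.2.2).trans (mul_le_mul_of_nonneg_right hCK (norm_nonneg _))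
  exact ⟨r, hrpos, hBO, fun ζ₀ hζ₀ => exists_parallel_section_ball hrpos hr1 (zero_le_one.trans hC1)
    hCr (fun y hy => hPA y (hBO hy)) (fun y hy => hAA y (hBO hy)) hPb hAb hA2b hA2l
    (fun y hy => hsymmA2 y (hBO hy)) (fun y hy => hidem y (hBO hy))
    (fun y hy => hflat y (hBO hy)) hζ₀⟩

/-- Sections that satisfy the linear differential equation of a parallel section are smooth. -/
lemma contDiffOn_of_hasFDerivAt_flip {A : V → V →L[ℝ] W →L[ℝ] W} {S : Set V} (hS : IsOpen S)
    (hA : ContDiffOn ℝ ∞ A S) {ζ : V → W} (hζ : ∀ x ∈ S, HasFDerivAt ζ ((A x).flip (ζ x)) x) :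
    ContDiffOn ℝ ∞ ζ S := by
  rw [contDiffOn_infty]
  intro n
  induction n with
  | zero =>
    exact contDiffOn_zero.2 fun x hx => (hζ x hx).continuousAt.continuousWithinAt
  | succ n ih =>
    push_cast
    rw [contDiffOn_succ_iff_fderiv_of_isOpen hS]
    refine ⟨fun x hx => (hζ x hx).differentiableAt.differentiableWithinAt, by simp, ?_⟩
    -- Bootstrap: the equation expresses the derivative of ζ through ζ, so n derivatives of ζ give
    -- one more.
    have h : ContDiffOn ℝ n (fun x => (A x).flip (ζ x)) S := by
      refine ContDiffOn.clm_apply ?_ ih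
      exact (ContinuousLinearMap.flipₗᵢ ℝ V W W).contDiff.comp_contDiffOn
        (hA.of_le (by exact_mod_cast le_top))
    exact h.congr fun x hx => (hζ x hx).fderiv

end ParallelSections

/-! ### Differentials, vector fields and Lie brackets in the preferred chart -/

section ChartCoordinates

variable {d : ℕ} {M : Type*} [TopologicalSpace M] [ChartedSpace (EuclideanSpace ℝ (Fin d)) M]
  [IsManifold (𝓡 d) ∞ M] {W : Type*} [NormedAddCommGroup W] [NormedSpace ℝ W]

lemma contMDiffAt_chart_symm {x₀ : M} {u : EuclideanSpace ℝ (Fin d)}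
    (hu : u ∈ (extChartAt (𝓡 d) x₀).target) :
    ContMDiffAt 𝓘(ℝ, EuclideanSpace ℝ (Fin d)) (𝓡 d) ∞ (extChartAt (𝓡 d) x₀).symm u :=
  (contMDiffOn_extChartAt_symm x₀).contMDiffAt
    ((isOpen_extChartAt_target x₀).mem_nhds hu)

lemma contDiffAt_comp_chart_symm {G : M → W} {x₀ : M} {u : EuclideanSpace ℝ (Fin d)}
    (hu : u ∈ (extChartAt (𝓡 d) x₀).target)
    (hG : ContMDiffAt (𝓡 d) 𝓘(ℝ, W) ∞ G ((extChartAt (𝓡 d) x₀).symm u)) :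
    ContDiffAt ℝ ∞ (G ∘ (extChartAt (𝓡 d) x₀).symm) u :=
  (hG.comp u (contMDiffAt_chart_symm hu)).contDiffAt

/-- The differential of `G : M → W` at `x`, as a continuous linear map on the model space. -/
noncomputable def dmapL (d : ℕ) {M : Type*} [TopologicalSpace M]
    [ChartedSpace (EuclideanSpace ℝ (Fin d)) M] {W : Type*} [NormedAddCommGroup W]
    [NormedSpace ℝ W] (G : M → W) (x : M) : EuclideanSpace ℝ (Fin d) →L[ℝ] W :=
  mfderiv (𝓡 d) 𝓘(ℝ, W) G x

/-- The differential of the inverse of the preferred chart at `x₀`. -/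
noncomputable def chartJac (x₀ : M) (u : EuclideanSpace ℝ (Fin d)) :
    EuclideanSpace ℝ (Fin d) →L[ℝ] EuclideanSpace ℝ (Fin d) :=
  mfderiv 𝓘(ℝ, EuclideanSpace ℝ (Fin d)) (𝓡 d) (extChartAt (𝓡 d) x₀).symm u

lemma hasFDerivAt_comp_chart_symm {G : M → W} {x₀ : M} {u : EuclideanSpace ℝ (Fin d)}
    (hu : u ∈ (extChartAt (𝓡 d) x₀).target)
    (hG : MDifferentiableAt (𝓡 d) 𝓘(ℝ, W) G ((extChartAt (𝓡 d) x₀).symm u)) :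
    HasFDerivAt (G ∘ (extChartAt (𝓡 d) x₀).symm)
      ((dmapL d G ((extChartAt (𝓡 d) x₀).symm u)).comp (chartJac x₀ u)) u :=
  (hG.hasMFDerivAt.comp u ((contMDiffAt_chart_symm hu).mdifferentiableAt
    (by simp)).hasMFDerivAt).hasFDerivAt

lemma chartJac_isInvertible {x₀ : M} {u : EuclideanSpace ℝ (Fin d)}
    (hu : u ∈ (extChartAt (𝓡 d) x₀).target) : (chartJac x₀ u).IsInvertible := by
  have := IsManifold.of_le (I := 𝓡 d) (M := M) (m := 1) (n := ∞) (by simp)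
  have h := isInvertible_mfderivWithin_extChartAt_symm (I := 𝓡 d) hu
  rwa [ModelWithCorners.range_eq_univ, mfderivWithin_univ] at h

lemma chartJac_self (x₀ : M) (v : EuclideanSpace ℝ (Fin d)) :
    chartJac x₀ (extChartAt (𝓡 d) x₀ x₀) v = v := by
  have := IsManifold.of_le (I := 𝓡 d) (M := M) (m := 1) (n := ∞) (by simp)
  have h := mfderivWithin_range_extChartAt_symm (I := 𝓡 d) (x := x₀)
  rw [ModelWithCorners.range_eq_univ, mfderivWithin_univ] at h
  rw [chartJac, h]; rfl

lemma hasFDerivAt_comp_chart_symm_self {G : M → W} {x₀ : M}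
    (hG : MDifferentiableAt (𝓡 d) 𝓘(ℝ, W) G x₀) :
    HasFDerivAt (G ∘ (extChartAt (𝓡 d) x₀).symm) (dmapL d G x₀) (extChartAt (𝓡 d) x₀ x₀) := by
  have h := hasFDerivAt_comp_chart_symm (G := G) (mem_extChartAt_target (I := 𝓡 d) x₀)
    (by rwa [extChartAt_to_inv])
  refine h.congr_fderiv ?_
  ext1 v
  rw [ContinuousLinearMap.comp_apply, chartJac_self, extChartAt_to_inv]

lemma comp_chart_symm_comp_eventuallyEq (G : M → W) (x₀ : M) :
    G =ᶠ[nhds x₀] (G ∘ (extChartAt (𝓡 d) x₀).symm) ∘ extChartAt (𝓡 d) x₀ := by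
  filter_upwards [extChartAt_source_mem_nhds (I := 𝓡 d) x₀] with y hy
  simp only [comp_apply, (extChartAt (𝓡 d) x₀).left_inv hy]

lemma contMDiffAt_of_comp_chart_symm {G : M → W} {x₀ : M}
    (hG : ContDiffAt ℝ ∞ (G ∘ (extChartAt (𝓡 d) x₀).symm) (extChartAt (𝓡 d) x₀ x₀)) :
    ContMDiffAt (𝓡 d) 𝓘(ℝ, W) ∞ G x₀ :=
  (hG.contMDiffAt.comp x₀ contMDiffAt_extChartAt).congr_of_eventuallyEq
    (comp_chart_symm_comp_eventuallyEq G x₀)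

lemma mdifferentiableAt_of_comp_chart_symm {G : M → W} {x₀ : M}
    (hG : DifferentiableAt ℝ (G ∘ (extChartAt (𝓡 d) x₀).symm) (extChartAt (𝓡 d) x₀ x₀)) :
    MDifferentiableAt (𝓡 d) 𝓘(ℝ, W) G x₀ :=
  (hG.mdifferentiableAt.comp x₀
    ((contMDiffAt_extChartAt (n := ∞)).mdifferentiableAt (by simp))).congr_of_eventuallyEq
    (comp_chart_symm_comp_eventuallyEq G x₀)

/-- The expression of a tangent vector field in the preferred chart at `x₀`. -/
noncomputable def chartField (X : Π x : M, TangentSpace (𝓡 d) x) (x₀ : M)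
    (u : EuclideanSpace ℝ (Fin d)) : EuclideanSpace ℝ (Fin d) :=
  VectorField.mpullbackWithin 𝓘(ℝ, EuclideanSpace ℝ (Fin d)) (𝓡 d)
    (extChartAt (𝓡 d) x₀).symm X (range (𝓡 d)) u

lemma differentiableAt_chartField {X : Π x : M, TangentSpace (𝓡 d) x} {U : Set M} (hU : IsOpen U)
    (hX : IsSmoothVectorFieldOn d X U) {x₀ : M} (hx₀ : x₀ ∈ U) :
    DifferentiableAt ℝ (chartField X x₀) (extChartAt (𝓡 d) x₀ x₀) := by
  have := IsManifold.of_le (I := 𝓡 d) (M := M) (m := 2) (n := ∞) ENat.LEInfty.out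
  have h1 : MDifferentiableWithinAt (𝓡 d) (𝓡 d).tangent
      (fun x => (X x : TangentBundle (𝓡 d) M)) univ x₀ :=
    ((hX.contMDiffAt (hU.mem_nhds hx₀)).mdifferentiableAt (by simp)).mdifferentiableWithinAt
  have h := h1.differentiableWithinAt_mpullbackWithin_vectorField
  rw [preimage_univ, univ_inter] at h
  exact h.differentiableAt (by simp)

lemma chartJac_chartField (X : Π x : M, TangentSpace (𝓡 d) x) {x₀ : M}
    {u : EuclideanSpace ℝ (Fin d)} (hu : u ∈ (extChartAt (𝓡 d) x₀).target) :
    chartJac x₀ u (chartField X x₀ u) = X ((extChartAt (𝓡 d) x₀).symm u) := by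
  have h : chartField X x₀ u = (chartJac x₀ u).inverse (X ((extChartAt (𝓡 d) x₀).symm u)) := by
    rw [chartField, VectorField.mpullbackWithin_apply, ModelWithCorners.range_eq_univ,
      mfderivWithin_univ]
    rfl
  obtain ⟨e, he⟩ := chartJac_isInvertible (M := M) hu
  rw [h, ← he, ContinuousLinearMap.inverse_equiv]
  exact e.apply_symm_apply _

lemma chartField_self (X : Π x : M, TangentSpace (𝓡 d) x) (x₀ : M) :
    chartField X x₀ (extChartAt (𝓡 d) x₀ x₀) = X x₀ := by
  have h := chartJac_chartField X (mem_extChartAt_target (I := 𝓡 d) x₀)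
  rw [chartJac_self] at h
  -- The type of `X y` depends on `y`, so the equality of base points is transported inside the
  -- common model space.
  have h2 : ∀ y, y = x₀ → (X y : EuclideanSpace ℝ (Fin d)) = X x₀ := by rintro y rfl; rfl
  exact h.trans (h2 _ (extChartAt_to_inv x₀))

/-- At its centre the preferred chart has the identity as derivative, so the pullback in the
definition of the bracket disappears. -/
lemma mlieBracket_eq_chartField (X Y : Π x : M, TangentSpace (𝓡 d) x) (x₀ : M) :
    VectorField.mlieBracket (𝓡 d) X Y x₀ =
    (fderiv ℝ (chartField Y x₀) (extChartAt (𝓡 d) x₀ x₀) (X x₀) -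
      fderiv ℝ (chartField X x₀) (extChartAt (𝓡 d) x₀ x₀) (Y x₀) :
      EuclideanSpace ℝ (Fin d)) := by
  have := IsManifold.of_le (I := 𝓡 d) (M := M) (m := 1) (n := ∞) (by simp)
  rw [← VectorField.mlieBracketWithin_univ, VectorField.mlieBracketWithin_apply,
    mfderiv_extChartAt_self]
  have h : ∀ v : EuclideanSpace ℝ (Fin d),
      (ContinuousLinearMap.id ℝ (EuclideanSpace ℝ (Fin d))).inverse v = v := by simp
  refine (h _).trans ?_
  change VectorField.lieBracketWithin ℝ (chartField X x₀) (chartField Y x₀)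
    ((extChartAt (𝓡 d) x₀).symm ⁻¹' univ ∩ range (𝓡 d)) (extChartAt (𝓡 d) x₀ x₀) = _
  rw [preimage_univ, univ_inter, ModelWithCorners.range_eq_univ,
    VectorField.lieBracketWithin_univ, VectorField.lieBracket_eq]
  simp only [chartField_self]

/-- In the chart the derivative of ξ along X is Dξ'(X'), with X' the coordinate field. The product
rule gives a term in DX', which builds the bracket, and a Hessian term, which cancels in the
commutator. -/
lemma hasFDerivAt_dmap_vectorField {X : Π x : M, TangentSpace (𝓡 d) x} {U : Set M} (hU : IsOpen U)
    (hX : IsSmoothVectorFieldOn d X U) {ξ : M → W} (hξ : ContMDiffOn (𝓡 d) 𝓘(ℝ, W) ∞ ξ U)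
    {x₀ : M} (hx₀ : x₀ ∈ U) {ξ' : EuclideanSpace ℝ (Fin d) → W}
    (hξξ' : ξ' = ξ ∘ (extChartAt (𝓡 d) x₀).symm) {u₀ : EuclideanSpace ℝ (Fin d)}
    (hu : u₀ = extChartAt (𝓡 d) x₀ x₀) :
    HasFDerivAt ((fun y => dmap d ξ y (X y)) ∘ (extChartAt (𝓡 d) x₀).symm)
      ((fderiv ℝ ξ' u₀).comp (fderiv ℝ (chartField X x₀) u₀) +
        (fderiv ℝ (fderiv ℝ ξ') u₀).flip (X x₀)) u₀ := by
  have hu₀ : (extChartAt (𝓡 d) x₀).symm u₀ = x₀ := hu ▸ extChartAt_to_inv x₀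
  have hut : u₀ ∈ (extChartAt (𝓡 d) x₀).target := hu ▸ mem_extChartAt_target x₀
  have hξ' : ContDiffAt ℝ ∞ ξ' u₀ := by
    rw [hξξ']
    exact contDiffAt_comp_chart_symm hut (by rw [hu₀]; exact hξ.contMDiffAt (hU.mem_nhds hx₀))
  have h1 : HasFDerivAt (fderiv ℝ ξ') (fderiv ℝ (fderiv ℝ ξ') u₀) u₀ :=
    ((hξ'.fderiv_right (m := ∞) (by simp)).differentiableAt (by simp)).hasFDerivAt
  have h2 : HasFDerivAt (chartField X x₀) (fderiv ℝ (chartField X x₀) u₀) u₀ := by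
    rw [hu]
    exact (differentiableAt_chartField hU hX hx₀).hasFDerivAt
  have h12 := h1.clm_apply h2
  rw [hu, chartField_self, ← hu] at h12
  refine h12.congr_of_eventuallyEq ?_
  have hcont : ContinuousAt (extChartAt (𝓡 d) x₀).symm u₀ := hu ▸ continuousAt_extChartAt_symm x₀
  filter_upwards [(isOpen_extChartAt_target x₀).mem_nhds hut,
    hcont.preimage_mem_nhds (by rw [hu₀]; exact hU.mem_nhds hx₀)] with u hu huU
  have h3 := (hasFDerivAt_comp_chart_symm hu
    ((hξ.contMDiffAt (hU.mem_nhds huU)).mdifferentiableAt (by simp))).fderiv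
  rw [hξξ', h3]
  rw [ContinuousLinearMap.comp_apply, chartJac_chartField X hu]
  rfl

lemma commutator_algebra {E : Type*} [NormedAddCommGroup E] [NormedSpace ℝ E] {D : E →L[ℝ] W}
    {DX DY : E →L[ℝ] E} {H : E →L[ℝ] E →L[ℝ] W} (hH : ∀ a b, H a b = H b a) (a b : E) :
    (D.comp DY + H.flip b) a - (D.comp DX + H.flip a) b = D (DY a - DX b) := by
  simp only [_root_.add_apply, ContinuousLinearMap.comp_apply, ContinuousLinearMap.flip_apply,
    map_sub, hH a b]
  abel

/-- The derivatives of a function along two vector fields commute up to the Lie bracket. -/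
lemma dmap_commutator {X Y : Π x : M, TangentSpace (𝓡 d) x} {U : Set M} (hU : IsOpen U)
    (hX : IsSmoothVectorFieldOn d X U) (hY : IsSmoothVectorFieldOn d Y U) {ξ : M → W}
    (hξ : ContMDiffOn (𝓡 d) 𝓘(ℝ, W) ∞ ξ U) {x₀ : M} (hx₀ : x₀ ∈ U) :
    MDifferentiableAt (𝓡 d) 𝓘(ℝ, W) (fun y => dmap d ξ y (X y)) x₀ ∧
    dmap d (fun y => dmap d ξ y (Y y)) x₀ (X x₀) - dmap d (fun y => dmap d ξ y (X y)) x₀ (Y x₀)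
      = dmap d ξ x₀ (VectorField.mlieBracket (𝓡 d) X Y x₀) := by
  have h1 := hasFDerivAt_dmap_vectorField hU hX hξ hx₀ rfl rfl
  have h2 := hasFDerivAt_dmap_vectorField hU hY hξ hx₀ rfl rfl
  have m1 := mdifferentiableAt_of_comp_chart_symm h1.differentiableAt
  have m2 := mdifferentiableAt_of_comp_chart_symm h2.differentiableAt
  refine ⟨m1, ?_⟩
  have e1 := (hasFDerivAt_comp_chart_symm_self m1).unique h1
  have e2 := (hasFDerivAt_comp_chart_symm_self m2).unique h2
  have hξ1 := hξ.contMDiffAt (hU.mem_nhds hx₀)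
  have e3 := (hasFDerivAt_comp_chart_symm_self (hξ1.mdifferentiableAt (by simp))).fderiv
  have hξ' : ContDiffAt ℝ ∞ (ξ ∘ (extChartAt (𝓡 d) x₀).symm) (extChartAt (𝓡 d) x₀ x₀) :=
    contDiffAt_comp_chart_symm (mem_extChartAt_target x₀) (by rwa [extChartAt_to_inv])
  have hs := (hξ'.isSymmSndFDerivAt (by
    rw [minSmoothness_of_isRCLikeNormedField]; exact ENat.LEInfty.out)).eq
  have t1 := congrArg (fun D : EuclideanSpace ℝ (Fin d) →L[ℝ] W => D (X x₀)) e2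
  have t2 := congrArg (fun D : EuclideanSpace ℝ (Fin d) →L[ℝ] W => D (Y x₀)) e1
  have t3 := congrArg (fun D : EuclideanSpace ℝ (Fin d) →L[ℝ] W =>
    D (VectorField.mlieBracket (𝓡 d) X Y x₀)) e3
  have b := mlieBracket_eq_chartField X Y x₀
  refine (congrArg₂ (· - ·) t1 t2).trans (Eq.trans ?_ t3)
  exact (commutator_algebra hs (X x₀) (Y x₀)).trans (congrArg _ b).symm

end ChartCoordinates

/-! ### Normal curvature as the curvature of the family of normal projections -/

section FlatNormalBundle

variable {d : ℕ} {M : Type*} [TopologicalSpace M] [ChartedSpace (EuclideanSpace ℝ (Fin d)) M]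
  [IsManifold (𝓡 d) ∞ M] {W : Type*} [NormedAddCommGroup W] [NormedSpace ℝ W]

lemma mdifferentiableAt_clm_apply {P : M → W →L[ℝ] W} {g : M → W} {x : M}
    (hP : MDifferentiableAt (𝓡 d) 𝓘(ℝ, W →L[ℝ] W) P x)
    (hg : MDifferentiableAt (𝓡 d) 𝓘(ℝ, W) g x) :
    MDifferentiableAt (𝓡 d) 𝓘(ℝ, W) (fun y => P y (g y)) x ∧
    ∀ v, dmapL d (fun y => P y (g y)) x v = dmapL d P x v (g x) + P x (dmapL d g x v) := by
  have h1 := hasFDerivAt_comp_chart_symm_self hP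
  have h2 := hasFDerivAt_comp_chart_symm_self hg
  have h3 := h1.clm_apply h2
  have h4 : MDifferentiableAt (𝓡 d) 𝓘(ℝ, W) (fun y => P y (g y)) x :=
    mdifferentiableAt_of_comp_chart_symm h3.differentiableAt
  refine ⟨h4, fun v => ?_⟩
  rw [(hasFDerivAt_comp_chart_symm_self h4).unique h3]
  have h5 : (extChartAt (𝓡 d) x).symm (extChartAt (𝓡 d) x x) = x := extChartAt_to_inv x
  simp only [_root_.add_apply, ContinuousLinearMap.comp_apply, ContinuousLinearMap.flip_apply,
    comp_apply, h5]
  abel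

/-- Fields with constant coefficients in the chart. They allow the curvature to be tested on
arbitrary tangent vectors. -/
lemma exists_smooth_vectorField (x₀ : M) (v : EuclideanSpace ℝ (Fin d)) :
    ∃ X : Π x : M, TangentSpace (𝓡 d) x,
      IsSmoothVectorFieldOn d X (extChartAt (𝓡 d) x₀).source ∧ X x₀ = v := by
  have := IsManifold.of_le (I := 𝓡 d) (M := M) (m := 1) (n := ∞) (by simp)
  refine ⟨VectorField.mpullback (𝓡 d) 𝓘(ℝ, EuclideanSpace ℝ (Fin d)) (extChartAt (𝓡 d) x₀)
    (fun _ => v), fun y hy => ?_, ?_⟩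
  · refine ContMDiffAt.contMDiffWithinAt ?_
    refine ContMDiffAt.mpullback_vectorField_preimage (n := ∞) ?_
      (contMDiffAt_extChartAt' (by simpa using hy)) (isInvertible_mfderiv_extChartAt hy) (by simp)
    exact (contMDiff_vectorSpace_iff_contDiff.2 contDiff_const).contMDiffAt
  · have h : ∀ v : EuclideanSpace ℝ (Fin d),
      (ContinuousLinearMap.id ℝ (EuclideanSpace ℝ (Fin d))).inverse v = v := by simp
    have h2 : (mfderiv (𝓡 d) 𝓘(ℝ, EuclideanSpace ℝ (Fin d)) (extChartAt (𝓡 d) x₀) x₀ :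
        EuclideanSpace ℝ (Fin d) →L[ℝ] EuclideanSpace ℝ (Fin d)) = ContinuousLinearMap.id ℝ _ :=
      mfderiv_extChartAt_self
    exact (congrArg (fun D : EuclideanSpace ℝ (Fin d) →L[ℝ] EuclideanSpace ℝ (Fin d) =>
      D.inverse v) h2).trans (h v)

variable {B : LinearMap.BilinForm ℝ W} {τ : W → Submodule ℝ W} {F : M → W} {P : M → W →L[ℝ] W}

/-- The curvature of the normal connection in terms of the derivative of the normal projection. -/
lemma normalCurvature_eq (hP : ContMDiff (𝓡 d) 𝓘(ℝ, W →L[ℝ] W) ∞ P)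
    (hcov : ∀ ξ x v, normalCov d B τ F ξ x v = P x (dmap d ξ x v))
    (hmem : ∀ x ζ, ζ ∈ normalSpace d B τ F x ↔ P x ζ = ζ)
    (hidem : ∀ x ζ, P x (P x ζ) = P x ζ) {X Y : Π x : M, TangentSpace (𝓡 d) x} {U : Set M}
    (hU : IsOpen U) (hX : IsSmoothVectorFieldOn d X U) (hY : IsSmoothVectorFieldOn d Y U)
    {ξ : M → W} (hξ : IsSmoothNormalFieldOn d B τ F ξ U) {x : M} (hx : x ∈ U) :
    normalCurvature d B τ F X Y ξ x =
      P x (dmapL d P x (X x) (dmapL d P x (Y x) (ξ x))) -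
      P x (dmapL d P x (Y x) (dmapL d P x (X x) (ξ x))) := by
  obtain ⟨mX, -⟩ := dmap_commutator hU hX hY hξ.1 hx
  obtain ⟨mY, -⟩ := dmap_commutator hU hY hX hξ.1 hx
  obtain ⟨-, hcomm⟩ := dmap_commutator hU hX hY hξ.1 hx
  have hPx : MDifferentiableAt (𝓡 d) 𝓘(ℝ, W →L[ℝ] W) P x := (hP x).mdifferentiableAt (by simp)
  have hξx : MDifferentiableAt (𝓡 d) 𝓘(ℝ, W) ξ x :=
    (hξ.1.contMDiffAt (hU.mem_nhds hx)).mdifferentiableAt (by simp)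
  obtain ⟨-, dX⟩ := mdifferentiableAt_clm_apply hPx mX
  obtain ⟨-, dY⟩ := mdifferentiableAt_clm_apply hPx mY
  obtain ⟨mξ, dξ⟩ := mdifferentiableAt_clm_apply hPx hξx
  have hξP : dmapL d (fun y => P y (ξ y)) x = dmapL d ξ x := by
    refine Filter.EventuallyEq.mfderiv_eq ?_
    filter_upwards [hU.mem_nhds hx] with y hy
    exact (hmem y _).1 (hξ.2 y hy)
  rw [hξP] at dξ
  -- The derivative of P(Pz) = Pz for a constant vector z.
  have hdidem : ∀ v z, dmapL d P x v (P x z) + P x (dmapL d P x v z) = dmapL d P x v z := by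
    intro v z
    obtain ⟨m1, d1⟩ := mdifferentiableAt_clm_apply hPx
      (mdifferentiableAt_const (c := z) (I := 𝓡 d) (I' := 𝓘(ℝ, W)) (x := x))
    obtain ⟨-, d2⟩ := mdifferentiableAt_clm_apply hPx m1
    have h0 : dmapL d (fun _ : M => z) x = 0 := mfderiv_const
    simp only [hidem] at d2
    rw [← sub_eq_zero]
    have e1 := d1 v
    have e2 := d2 v
    rw [h0] at e1
    rw [e1] at e2
    simp only [_root_.zero_apply, map_zero, add_zero] at e2
    rw [← e2, sub_self]
  have hPdP : ∀ v z, P x (dmapL d P x v (P x z)) = 0 := by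
    intro v z
    have h := congrArg (P x) (hdidem v z)
    rw [map_add, hidem] at h
    simpa using h
  -- From ξ = Pξ follows dξ = dP ξ + P dξ, and the last term is killed by P dP P = 0.
  have hterm : ∀ v w, P x (dmapL d P x v (dmapL d ξ x w)) =
      P x (dmapL d P x v (dmapL d P x w (ξ x))) := by
    intro v w
    rw [dξ w, map_add, map_add, hPdP, add_zero]
  -- The tangent vectors are replaced by variables in the model space, so that rewriting is not
  -- hindered by the dependent types.
  have main : ∀ a b z : EuclideanSpace ℝ (Fin d), a = X x → b = Y x →
      z = VectorField.mlieBracket (𝓡 d) X Y x → normalCurvature d B τ F X Y ξ x =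
        P x (dmapL d P x a (dmapL d P x b (ξ x))) -
        P x (dmapL d P x b (dmapL d P x a (ξ x))) := by
    intro a b z ha hb hz
    have hcomm' : dmapL d (fun y => dmap d ξ y (Y y)) x a - dmapL d (fun y => dmap d ξ y (X y)) x b
        = dmapL d ξ x z := by
      rw [ha, hb, hz]; exact hcomm
    have dX' : ∀ v, dmapL d (fun y => P y (dmap d ξ y (X y))) x v =
        dmapL d P x v (dmapL d ξ x a) + P x (dmapL d (fun y => dmap d ξ y (X y)) x v) := by
      intro v; rw [ha]; exact dX v
    have dY' : ∀ v, dmapL d (fun y => P y (dmap d ξ y (Y y))) x v =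
        dmapL d P x v (dmapL d ξ x b) + P x (dmapL d (fun y => dmap d ξ y (Y y)) x v) := by
      intro v; rw [hb]; exact dY v
    have key : normalCurvature d B τ F X Y ξ x =
        P x (dmapL d (fun y => P y (dmap d ξ y (Y y))) x a)
        - P x (dmapL d (fun y => P y (dmap d ξ y (X y))) x b) - P x (dmapL d ξ x z) := by
      rw [ha, hb, hz]
      simp only [normalCurvature, hcov]
      rfl
    rw [key, dX', dY', map_add, map_add, hidem, hidem, ← hcomm', map_sub, hterm, hterm]
    abel
  exact main _ _ _ rfl rfl rfl

/-- By `normalCurvature_eq` the curvature depends only on values at the point. Conversely every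
normal vector ζ at a point extends to the smooth normal field y ↦ P y ζ. -/
theorem hasFlatNormalBundle_iff (hP : ContMDiff (𝓡 d) 𝓘(ℝ, W →L[ℝ] W) ∞ P)
    (hcov : ∀ ξ x v, normalCov d B τ F ξ x v = P x (dmap d ξ x v))
    (hmem : ∀ x ζ, ζ ∈ normalSpace d B τ F x ↔ P x ζ = ζ)
    (hidem : ∀ x ζ, P x (P x ζ) = P x ζ) :
    HasFlatNormalBundle d B τ F ↔ ∀ x, FlatJet (P x) (dmapL d P x) := by
  constructor
  · intro h x v w ζ hζ
    obtain ⟨X, hX, hXv⟩ := exists_smooth_vectorField x v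
    obtain ⟨Y, hY, hYw⟩ := exists_smooth_vectorField x w
    have hU := isOpen_extChartAt_source (I := 𝓡 d) x
    have hx := mem_extChartAt_source (I := 𝓡 d) x
    have hξ : IsSmoothNormalFieldOn d B τ F (fun y => P y ζ) (extChartAt (𝓡 d) x).source :=
      ⟨(hP.clm_apply contMDiff_const).contMDiffOn, fun y _ => (hmem y _).2 (hidem y ζ)⟩
    have h1 := h _ X Y _ hU hX hY hξ x hx
    rw [normalCurvature_eq hP hcov hmem hidem hU hX hY hξ hx, sub_eq_zero, hζ] at h1
    rwa [hXv, hYw] at h1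
  · intro h U X Y ξ hU hX hY hξ x hx
    rw [normalCurvature_eq hP hcov hmem hidem hU hX hY hξ hx, sub_eq_zero]
    exact h x _ _ _ ((hmem x _).1 (hξ.2 x hx))

end FlatNormalBundle

/-! ### Symmetric projections, complements of images and of single vectors -/

section FormProjections

variable {W : Type*} [NormedAddCommGroup W] [NormedSpace ℝ W] [FiniteDimensional ℝ W]
  {B : LinearMap.BilinForm ℝ W}

/-- `P` is a `B`-symmetric projection. -/
structure IsFormProj (B : LinearMap.BilinForm ℝ W) (P : W →L[ℝ] W) : Prop where
  idem : ∀ x, P (P x) = P x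
  symm : ∀ x y, B (P x) y = B x (P y)

lemma IsFormProj.id : IsFormProj B (ContinuousLinearMap.id ℝ W) := ⟨fun _ => rfl, fun _ _ => rfl⟩

lemma IsFormProj.orthProj_eq {P : W →L[ℝ] W} (hP : IsFormProj B P) (hB : B.IsSymm)
    (hnd : ∀ x, (∀ y, B x y = 0) → x = 0) {N : Submodule ℝ W} (hN : ∀ ζ, ζ ∈ N ↔ P ζ = ζ) (w : W) :
    orthProj B N w = P w := by
  refine orthProj_eq_of hB ?_ ((hN _).2 (hP.idem w)) fun k hk => ?_
  · rw [Submodule.disjoint_def]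
    intro x hx hx'
    refine hnd x fun y => ?_
    have h := LinearMap.BilinForm.mem_orthogonal_iff.1 hx' (P y) ((hN _).2 (hP.idem y))
    rw [← (hN x).1 hx, hP.symm]
    exact (hB.eq _ _).trans h
  · rw [← (hN k).1 hk, hP.symm, map_sub, hP.idem, sub_self, map_zero]

/-- The projection of `w` orthogonal to `ν`, where `c = 1 / B(ν, ν)`, after the projection `P`. -/
noncomputable def subProj (B : LinearMap.BilinForm ℝ W) (c : ℝ) (P : W →L[ℝ] W) (ν : W) :
    W →L[ℝ] W :=
  P - c • (LinearMap.toContinuousBilinearMap B ν).smulRight ν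

lemma subProj_apply (c : ℝ) (P : W →L[ℝ] W) (ν x : W) :
    subProj B c P ν x = P x - (c * B ν x) • ν := by
  simp [subProj, smul_smul]

lemma IsFormProj.subProj {c : ℝ} {P : W →L[ℝ] W} {ν : W} (hP : IsFormProj B P) (hB : B.IsSymm)
    (hc : c * B ν ν = 1) (hν : P ν = ν) : IsFormProj B (subProj B c P ν) where
  idem x := by
    have h : B ν (P x) = B ν x := by rw [← hP.symm, hν]
    rw [subProj_apply, subProj_apply, map_sub, map_smul, hP.idem, hν, map_sub, map_smul, h]
    have : c * (B ν x - (c * B ν x) • B ν ν) = 0 := by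
      rw [smul_eq_mul]; linear_combination (- c * B ν x) * hc
    rw [this, zero_smul, sub_zero]
  symm x y := by
    rw [subProj_apply, subProj_apply]
    have h : B x ν = B ν x := hB.eq _ _
    simp only [map_sub, map_smul, LinearMap.sub_apply, LinearMap.smul_apply, hP.symm, smul_eq_mul, h]
    ring

lemma subProj_eq_self_iff {c : ℝ} {P : W →L[ℝ] W} {ν : W} (hP : IsFormProj B P)
    (hc : c * B ν ν = 1) (hν : P ν = ν) (ζ : W) :
    subProj B c P ν ζ = ζ ↔ P ζ = ζ ∧ B ν ζ = 0 := by
  rw [subProj_apply]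
  constructor
  · intro h
    have h1 : B ν ζ = 0 := by
      rw [← h, map_sub, map_smul, ← hP.symm, hν, smul_eq_mul]
      linear_combination (- B ν ζ) * hc
    rw [h1] at h
    exact ⟨by simpa using h, h1⟩
  · rintro ⟨h1, h2⟩
    rw [h1, h2]; simp

variable {V : Type*} [NormedAddCommGroup V] [NormedSpace ℝ V] [FiniteDimensional ℝ V]

lemma isFormProj_imageProj (hB : B.IsSymm) {L : V →L[ℝ] W} (hL : NondegImage B L) :
    IsFormProj B (imageProj B L) :=
  ⟨fun x => by obtain ⟨v, hv⟩ := imageProj_mem B L x; rw [hv, imageProj_image hL],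
    form_imageProj_left hB hL⟩

/-- The `B`-orthogonal projection onto the orthogonal complement of the image of `L`. -/
noncomputable def coimageProj (B : LinearMap.BilinForm ℝ W) (L : V →L[ℝ] W) : W →L[ℝ] W :=
  ContinuousLinearMap.id ℝ W - imageProj B L

lemma coimageProj_apply (L : V →L[ℝ] W) (x : W) :
    coimageProj B L x = x - imageProj B L x := rfl

lemma isFormProj_coimageProj (hB : B.IsSymm) {L : V →L[ℝ] W} (hL : NondegImage B L) :
    IsFormProj B (coimageProj B L) := by
  have h := isFormProj_imageProj hB hL
  constructor
  · intro x
    simp only [coimageProj_apply, map_sub, h.idem]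
    abel
  · intro x y
    simp only [coimageProj_apply, map_sub, LinearMap.sub_apply, h.symm]

lemma coimageProj_image {L : V →L[ℝ] W} (hL : NondegImage B L) (v : V) :
    coimageProj B L (L v) = 0 := by
  rw [coimageProj_apply, imageProj_image hL, sub_self]

lemma coimageProj_eq_self_iff (hB : B.IsSymm) {L : V →L[ℝ] W} (hL : NondegImage B L) (ζ : W) :
    coimageProj B L ζ = ζ ↔ ∀ v, B (L v) ζ = 0 := by
  rw [coimageProj_apply, sub_eq_self]
  constructor
  · intro h v
    rw [← imageProj_image hL v, form_imageProj_left hB hL, h, map_zero]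
  · intro h
    refine imageProj_eq_of hL (Submodule.zero_mem _) fun v => ?_
    rw [sub_zero]
    exact (hB.eq _ _).trans (h v)

lemma coimageProj_eq_zero_iff {L : V →L[ℝ] W} (hL : NondegImage B L) (w : W) :
    coimageProj B L w = 0 ↔ ∃ v, w = L v := by
  rw [coimageProj_apply, sub_eq_zero]
  exact ⟨fun h => h ▸ imageProj_mem B L w, fun ⟨v, hv⟩ => by rw [hv, imageProj_image hL]⟩

variable {d : ℕ} {M : Type*} [TopologicalSpace M] [ChartedSpace (EuclideanSpace ℝ (Fin d)) M]
  [IsManifold (𝓡 d) ∞ M]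

lemma nondegImage_comp {V' : Type*} [NormedAddCommGroup V'] [NormedSpace ℝ V']
    {L : V →L[ℝ] W} (hL : NondegImage B L) {J : V' →L[ℝ] V} (hJ : J.IsInvertible) :
    NondegImage B (L.comp J) := by
  obtain ⟨e, rfl⟩ := hJ
  intro v hv
  have := hL (e v) fun w => by simpa using hv (e.symm w)
  simpa using this

/-- The projection sees only the image of `L`, so the manifold differential and its chart expression
define the same normal projection. -/
lemma coimageProj_comp_invertible {V' : Type*} [NormedAddCommGroup V'] [NormedSpace ℝ V']
    [FiniteDimensional ℝ V'] {L : V →L[ℝ] W} (hL : NondegImage B L) {J : V' →L[ℝ] V}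
    (hJ : J.IsInvertible) : coimageProj B (L.comp J) = coimageProj B L := by
  have h := nondegImage_comp hL hJ
  obtain ⟨e, rfl⟩ := hJ
  rw [coimageProj, coimageProj, imageProj_congr h hL]
  ext w
  constructor
  · rintro ⟨v, rfl⟩; exact ⟨e v, rfl⟩
  · rintro ⟨v, rfl⟩; exact ⟨e.symm v, by simp⟩

lemma coimageProj_chart {F : M → W} (hF : ContMDiff (𝓡 d) 𝓘(ℝ, W) ∞ F)
    (hnd : ∀ x, NondegImage B (dmapL d F x)) {x₀ : M} {u : EuclideanSpace ℝ (Fin d)}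
    (hu : u ∈ (extChartAt (𝓡 d) x₀).target) :
    NondegImage B (fderiv ℝ (F ∘ (extChartAt (𝓡 d) x₀).symm) u) ∧
    coimageProj B (dmapL d F ((extChartAt (𝓡 d) x₀).symm u)) =
      coimageProj B (fderiv ℝ (F ∘ (extChartAt (𝓡 d) x₀).symm) u) := by
  have h := (hasFDerivAt_comp_chart_symm hu ((hF _).mdifferentiableAt (by simp))).fderiv
  rw [h]
  exact ⟨nondegImage_comp (hnd _) (chartJac_isInvertible hu),
    (coimageProj_comp_invertible (hnd _) (chartJac_isInvertible hu)).symm⟩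

lemma contMDiff_coimageProj {F : M → W} (hF : ContMDiff (𝓡 d) 𝓘(ℝ, W) ∞ F)
    (hnd : ∀ x, NondegImage B (dmapL d F x)) :
    ContMDiff (𝓡 d) 𝓘(ℝ, W →L[ℝ] W) ∞ (fun x => coimageProj B (dmapL d F x)) := by
  intro x₀
  refine contMDiffAt_of_comp_chart_symm ?_
  have hmem := mem_extChartAt_target (I := 𝓡 d) x₀
  have h1 : ContDiffAt ℝ ∞ (F ∘ (extChartAt (𝓡 d) x₀).symm) (extChartAt (𝓡 d) x₀ x₀) :=
    contDiffAt_comp_chart_symm hmem (hF _)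
  have h2 : ContDiffAt ℝ ∞ (fderiv ℝ (F ∘ (extChartAt (𝓡 d) x₀).symm))
      (extChartAt (𝓡 d) x₀ x₀) := h1.fderiv_right (by simp)
  have h3 := (contDiffAt_imageProj (n := ∞) (coimageProj_chart hF hnd hmem).1).comp _ h2
  refine ((contDiffAt_const (c := ContinuousLinearMap.id ℝ W)).sub h3).congr_of_eventuallyEq ?_
  filter_upwards [(isOpen_extChartAt_target x₀).mem_nhds hmem] with u hu
  exact (coimageProj_chart hF hnd hu).2

lemma contMDiff_subProj {c : ℝ} {P : M → W →L[ℝ] W} {ν : M → W}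
    (hP : ContMDiff (𝓡 d) 𝓘(ℝ, W →L[ℝ] W) ∞ P) (hν : ContMDiff (𝓡 d) 𝓘(ℝ, W) ∞ ν) :
    ContMDiff (𝓡 d) 𝓘(ℝ, W →L[ℝ] W) ∞ (fun x => subProj B c (P x) (ν x)) := by
  have h : ContDiff ℝ ∞ fun p : (W →L[ℝ] W) × W => subProj B c p.1 p.2 := by
    unfold subProj
    refine contDiff_fst.sub (ContDiff.const_smul c ?_)
    exact ((LinearMap.toContinuousBilinearMap B).contDiff.comp contDiff_snd).smulRight contDiff_snd
  exact h.contMDiff.comp (hP.prodMk_space hν)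

/-- The normal space lies in the ambient tangent space, hence PQ = P. Thus the intermediate
projection `Q` onto the tangent space of the quadric drops out of the normal connection and of the
second fundamental form. -/
lemma normalCov_eq_proj {τ : W → Submodule ℝ W} {F : M → W} (hB : B.IsSymm)
    (hnd : ∀ x, (∀ y, B x y = 0) → x = 0) {P Q : W →L[ℝ] W} (hP : IsFormProj B P)
    (hQ : IsFormProj B Q) {x : M} (hτ : ∀ ζ, ζ ∈ τ (F x) ↔ Q ζ = ζ)
    (hN : ∀ ζ, ζ ∈ normalSpace d B τ F x ↔ P ζ = ζ) (w : W) :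
    orthProj B (normalSpace d B τ F x) (orthProj B (τ (F x)) w) = P w := by
  rw [hP.orthProj_eq hB hnd hN, hQ.orthProj_eq hB hnd hτ]
  refine sub_eq_zero.1 (hnd _ fun y => ?_)
  have h1 : Q (P y) = P y := (hτ _).1 ((hN _).2 (hP.idem y)).1
  rw [map_sub, LinearMap.sub_apply, hP.symm, hP.symm, hQ.symm, h1, sub_self]

end FormProjections

/-! ### The inner products of E^{n+1} and E^{n+2} -/

section AmbientForms

variable {n : ℕ} {ε : ℝ}

lemma formE_apply (ε : ℝ) (n : ℕ) (x y : AmbE n) :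
    formE ε n x y = ε * x 0 * y 0 + ∑ i : Fin n, x i.succ * y i.succ := by
  rw [formE, Matrix.toBilin'_apply']
  simp [dotProduct, Matrix.mulVec_diagonal, Fin.sum_univ_succ]
  ring

lemma formER_apply (ε : ℝ) (n : ℕ) (p q : AmbER n) :
    formER ε n p q = formE ε n p.1 q.1 + p.2 * q.2 := by
  simp [formER]

lemma formE_isSymm (ε : ℝ) (n : ℕ) : (formE ε n).IsSymm :=
  ⟨fun x y => by simp only [formE_apply, mul_comm, mul_left_comm]⟩

lemma formER_isSymm (ε : ℝ) (n : ℕ) : (formER ε n).IsSymm :=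
  ⟨fun x y => by
    rw [formER_apply, formER_apply, mul_comm, (formE_isSymm ε n).eq x.1 y.1]⟩

lemma formE_nondeg (hε : ε = 1 ∨ ε = -1) (x : AmbE n) (h : ∀ y, formE ε n x y = 0) : x = 0 := by
  ext i
  have h1 := h (Pi.single i 1)
  rw [formE_apply] at h1
  refine Fin.cases (fun h1 => ?_) (fun j h1 => ?_) i h1
  · rcases hε with rfl | rfl <;> simpa using h1
  · simpa [Pi.single_apply] using h1

lemma formER_nondeg (hε : ε = 1 ∨ ε = -1) (x : AmbER n) (h : ∀ y, formER ε n x y = 0) : x = 0 := by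
  refine Prod.ext (formE_nondeg hε _ fun y => ?_) ?_
  · simpa [formER_apply] using h (y, 0)
  · simpa [formER_apply] using h (0, 1)

/-- For ε = 1 the form is Euclidean. For ε = -1 this is the Lorentzian fact that vectors orthogonal
to a timelike vector are spacelike; it follows from Cauchy–Schwarz in the spatial coordinates and
needs no choice of sheet. -/
lemma formE_tangent_pos (hε : ε = 1 ∨ ε = -1) {q x : AmbE n} (hq : formE ε n q q = ε)
    (hx : formE ε n q x = 0) : 0 ≤ formE ε n x x ∧ (formE ε n x x = 0 → x = 0) := by
  have hsum : ∀ z : AmbE n, 0 ≤ ∑ i : Fin n, z i.succ * z i.succ :=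
    fun z => Finset.sum_nonneg fun i _ => mul_self_nonneg _
  have hzero : x 0 = 0 → ∑ i : Fin n, x i.succ * x i.succ = 0 → x = 0 := by
    intro h0 h1
    rw [Finset.sum_eq_zero_iff_of_nonneg fun i _ => mul_self_nonneg _] at h1
    ext i
    refine Fin.cases h0 (fun j => ?_) i
    simpa using h1 j (Finset.mem_univ j)
  rw [formE_apply] at *
  have hx2 := hsum x
  rcases hε with rfl | rfl
  · refine ⟨by nlinarith [mul_self_nonneg (x 0)], fun h => ?_⟩
    have h0 : x 0 = 0 := by nlinarith [mul_self_nonneg (x 0)]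
    refine hzero h0 ?_
    rw [h0] at h; linarith
  · have hcs := Finset.sum_mul_sq_le_sq_mul_sq Finset.univ (fun i : Fin n => q i.succ)
      (fun i : Fin n => x i.succ)
    simp only [pow_two] at hcs
    set S := ∑ i : Fin n, q i.succ * x i.succ
    set Q := ∑ i : Fin n, q i.succ * q i.succ
    set X := ∑ i : Fin n, x i.succ * x i.succ
    have hS : S = q 0 * x 0 := by linarith
    have hQ : q 0 * q 0 = 1 + Q := by linarith
    have hQ0 : 0 ≤ Q := hsum q
    -- Cauchy–Schwarz S² ≤ QX with the orthogonality S = q₀x₀ and the normalization q₀² = 1 + Q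
    -- inserted.
    have hkey : x 0 * x 0 * (1 + Q) ≤ Q * X := by
      rw [← hQ]
      rw [hS] at hcs
      linarith
    have hle : x 0 * x 0 ≤ X := by
      by_contra hlt
      push Not at hlt
      nlinarith [mul_self_nonneg (x 0), mul_le_mul_of_nonneg_left hlt.le hQ0]
    refine ⟨by linarith, fun h => ?_⟩
    have hXx : X = x 0 * x 0 := by linarith
    have hx0 : x 0 * x 0 = 0 := by
      rw [hXx] at hkey
      nlinarith [mul_self_nonneg (x 0)]
    exact hzero (mul_self_eq_zero.1 hx0) (by rw [← hx0, ← hXx])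

lemma formER_tangent_pos (hε : ε = 1 ∨ ε = -1) {q : AmbE n} {x : AmbER n} (hq : formE ε n q q = ε)
    (hx : formER ε n (q, 0) x = 0) : 0 ≤ formER ε n x x ∧ (formER ε n x x = 0 → x = 0) := by
  rw [formER_apply] at *
  have hx1 : formE ε n q x.1 = 0 := by simpa using hx
  obtain ⟨h1, h2⟩ := formE_tangent_pos hε hq hx1
  have h3 := mul_self_nonneg x.2
  refine ⟨by linarith, fun h => Prod.ext (h2 (by linarith)) ?_⟩
  exact mul_self_eq_zero.1 (show x.2 * x.2 = 0 by linarith)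

lemma mem_tanQ {q x : AmbE n} : x ∈ tanQ ε n q ↔ formE ε n q x = 0 := by
  rw [tanQ, LinearMap.BilinForm.mem_orthogonal_iff]
  constructor
  · exact fun h => h q (Submodule.mem_span_singleton_self q)
  · intro h y hy
    obtain ⟨a, rfl⟩ := Submodule.mem_span_singleton.1 hy
    simp [h]

lemma mem_tanQR {p x : AmbER n} : x ∈ tanQR ε n p ↔ formER ε n (p.1, 0) x = 0 := by
  rw [tanQR, Submodule.mem_prod, mem_tanQ, formER_apply]
  simp

lemma formER_dt (p : AmbER n) : formER ε n p (dt n) = p.2 := by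
  simp [formER_apply, dt]

lemma epsilon_mul_self (hε : ε = 1 ∨ ε = -1) : ε * ε = 1 := by
  rcases hε with rfl | rfl <;> norm_num

end AmbientForms

/-! ### The derivative of the normal projection and the Weingarten formula -/

section NormalProjection

variable {W : Type*} [NormedAddCommGroup W] [NormedSpace ℝ W] [FiniteDimensional ℝ W]
  {B : LinearMap.BilinForm ℝ W} {d : ℕ} {M : Type*} [TopologicalSpace M]
  [ChartedSpace (EuclideanSpace ℝ (Fin d)) M] [IsManifold (𝓡 d) ∞ M]

lemma dmapL_clm_comp {W' : Type*} [NormedAddCommGroup W'] [NormedSpace ℝ W'] (A : W →L[ℝ] W')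
    {F : M → W} {x : M} (hF : MDifferentiableAt (𝓡 d) 𝓘(ℝ, W) F x) :
    dmapL d (fun y => A (F y)) x = A.comp (dmapL d F x) := by
  have h := A.hasFDerivAt.comp _ (hasFDerivAt_comp_chart_symm_self hF)
  have hm : MDifferentiableAt (𝓡 d) 𝓘(ℝ, W') (fun y => A (F y)) x :=
    mdifferentiableAt_of_comp_chart_symm h.differentiableAt
  exact (hasFDerivAt_comp_chart_symm_self hm).unique h

lemma form_dmapL_of_const {F G : M → W} {x : M} (hF : MDifferentiableAt (𝓡 d) 𝓘(ℝ, W) F x)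
    (hG : MDifferentiableAt (𝓡 d) 𝓘(ℝ, W) G x) {c : ℝ} (h : ∀ y, B (F y) (G y) = c)
    (v : EuclideanSpace ℝ (Fin d)) : B (F x) (dmapL d G x v) + B (dmapL d F x v) (G x) = 0 := by
  obtain ⟨D, hD, hDv⟩ := hasFDerivAt_form B (hasFDerivAt_comp_chart_symm_self hF)
    (hasFDerivAt_comp_chart_symm_self hG)
  have h1 := hD.unique (HasFDerivAt.congr_of_eventuallyEq (hasFDerivAt_const c _)
    (Filter.Eventually.of_forall fun u => h _))
  have h2 := hDv v
  rw [h1] at h2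
  simp only [comp_apply, extChartAt_to_inv] at h2
  simpa using h2.symm

lemma isProjJet_dmapL {P : M → W →L[ℝ] W} (hP : ContMDiff (𝓡 d) 𝓘(ℝ, W →L[ℝ] W) ∞ P)
    (hform : ∀ x, IsFormProj B (P x)) (x : M) : IsProjJet B (P x) (fun v => dmapL d P x v) := by
  have h := isProjJet_of_hasFDerivAt (B := B)
    (hasFDerivAt_comp_chart_symm_self ((hP x).mdifferentiableAt (by simp)))
    (Filter.Eventually.of_forall fun u => (hform _).idem)
    (Filter.Eventually.of_forall fun u => (hform _).symm)
  rwa [comp_apply, extChartAt_to_inv] at h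

/-- The second derivative at `x` of `F` in the preferred chart at `x`. -/
noncomputable def chartHessian (d : ℕ) {M : Type*} [TopologicalSpace M]
    [ChartedSpace (EuclideanSpace ℝ (Fin d)) M] (F : M → W) (x : M) :
    EuclideanSpace ℝ (Fin d) →L[ℝ] EuclideanSpace ℝ (Fin d) →L[ℝ] W :=
  fderiv ℝ (fderiv ℝ (F ∘ (extChartAt (𝓡 d) x).symm)) (extChartAt (𝓡 d) x x)

lemma chartHessian_symm {F : M → W} (hF : ContMDiff (𝓡 d) 𝓘(ℝ, W) ∞ F) (x : M)
    (v w : EuclideanSpace ℝ (Fin d)) : chartHessian d F x v w = chartHessian d F x w v :=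
  ((contDiffAt_comp_chart_symm (mem_extChartAt_target x) (hF _)).isSymmSndFDerivAt (by
    rw [minSmoothness_of_isRCLikeNormedField]; exact ENat.LEInfty.out)).eq v w

/-- Differentiating P(F_*w) = 0 gives dP(v)F_*w = -P(Hess F(v,w)). The symmetry of dP then moves it
to ζ, which shows that dP(v)ζ = -F_*A_ζ v. -/
lemma form_deriv_coimageProj (hB : B.IsSymm) {F : M → W} (hF : ContMDiff (𝓡 d) 𝓘(ℝ, W) ∞ F)
    (hnd : ∀ x, NondegImage B (dmapL d F x)) {x : M} {ζ : W}
    (hζ : coimageProj B (dmapL d F x) ζ = ζ) (v w : EuclideanSpace ℝ (Fin d)) :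
    B (dmapL d (fun y => coimageProj B (dmapL d F y)) x v ζ) (dmapL d F x w) =
      - B (chartHessian d F x v w) ζ := by
  have hPs := contMDiff_coimageProj hF hnd
  have hjet := isProjJet_dmapL hPs (fun x => isFormProj_coimageProj hB (hnd x)) x
  have hmem := mem_extChartAt_target (I := 𝓡 d) x
  have hF' : ContDiffAt ℝ ∞ (F ∘ (extChartAt (𝓡 d) x).symm) (extChartAt (𝓡 d) x x) :=
    contDiffAt_comp_chart_symm hmem (hF _)
  have hH : HasFDerivAt (fderiv ℝ (F ∘ (extChartAt (𝓡 d) x).symm)) (chartHessian d F x)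
      (extChartAt (𝓡 d) x x) :=
    ((hF'.fderiv_right (m := ∞) (by simp)).differentiableAt (by simp)).hasFDerivAt
  have hP := hasFDerivAt_comp_chart_symm_self ((hPs x).mdifferentiableAt (by simp))
  have h := deriv_proj_tangent hP hH (by
    filter_upwards [(isOpen_extChartAt_target x).mem_nhds hmem] with u hu v
    obtain ⟨h1, h2⟩ := coimageProj_chart hF hnd hu
    rw [comp_apply, h2]
    exact coimageProj_image h1 v) v w
  rw [(hasFDerivAt_comp_chart_symm_self ((hF x).mdifferentiableAt (by simp))).fderiv] at h
  simp only [comp_apply, extChartAt_to_inv] at h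
  rw [hjet.dsymm, h, map_neg, ← hjet.symm, hζ]
  exact congrArg _ (hB.eq _ _)

lemma dmapL_subProj {c : ℝ} {P : M → W →L[ℝ] W} {ν : M → W}
    (hP : ContMDiff (𝓡 d) 𝓘(ℝ, W →L[ℝ] W) ∞ P) (hν : ContMDiff (𝓡 d) 𝓘(ℝ, W) ∞ ν) (x : M)
    (v : EuclideanSpace ℝ (Fin d)) (z : W) :
    dmapL d (fun y => subProj B c (P y) (ν y)) x v z =
      dmapL d P x v z - (c * B (dmapL d ν x v) z) • ν x - (c * B (ν x) z) • dmapL d ν x v := by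
  have hs : ContMDiff (𝓡 d) 𝓘(ℝ, W →L[ℝ] W) ∞ (fun x => subProj B c (P x) (ν x)) :=
    contMDiff_subProj hP hν
  have h1 := (hasFDerivAt_comp_chart_symm_self ((hs x).mdifferentiableAt (by simp))).clm_apply
    (hasFDerivAt_const z (extChartAt (𝓡 d) x x))
  have h2 := (hasFDerivAt_comp_chart_symm_self ((hP x).mdifferentiableAt (by simp))).clm_apply
    (hasFDerivAt_const z (extChartAt (𝓡 d) x x))
  have h3 := hasFDerivAt_comp_chart_symm_self ((hν x).mdifferentiableAt (by simp))
  obtain ⟨D, hD, hDv⟩ := hasFDerivAt_form B h3 (hasFDerivAt_const z (extChartAt (𝓡 d) x x))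
  have h4 := h2.sub ((hD.const_mul c).smul h3)
  have h5 := h1.unique (h4.congr_of_eventuallyEq (Filter.Eventually.of_forall fun u => by
    simp only [comp_apply]
    exact subProj_apply _ _ _ _))
  have h6 := congrArg (fun D : EuclideanSpace ℝ (Fin d) →L[ℝ] W => D v) h5
  simp [hDv] at h6
  rw [h6]
  abel

/-- Flatness of the normal bundle of `F` in terms of flatness of the orthogonal complement in it
of a normal field `ν`. -/
lemma flatJet_coimageProj_iff (hB : B.IsSymm) (hBnd : ∀ x, (∀ y, B x y = 0) → x = 0)
    {F : M → W} (hF : ContMDiff (𝓡 d) 𝓘(ℝ, W) ∞ F) (hnd : ∀ x, NondegImage B (dmapL d F x))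
    {ν : M → W} (hν : ContMDiff (𝓡 d) 𝓘(ℝ, W) ∞ ν) (hFν : ∀ x v, B (dmapL d F x v) (ν x) = 0)
    {c : ℝ} (hc : ∀ x, c * B (ν x) (ν x) = 1) {x : M} {a : EuclideanSpace ℝ (Fin d) → ℝ} {e : W}
    (hdν : ∀ v, dmapL d ν x v = dmapL d F x v - a v • e) :
    FlatJet (coimageProj B (dmapL d F x))
        (fun v => dmapL d (fun y => coimageProj B (dmapL d F y)) x v) ↔
      FlatJet (subProj B c (coimageProj B (dmapL d F x)) (ν x))
        (fun v => dmapL d (fun y => subProj B c (coimageProj B (dmapL d F y)) (ν y)) x v) ∧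
      ∀ v w ζ, subProj B c (coimageProj B (dmapL d F x)) (ν x) ζ = ζ →
        a v * B (dmapL d (fun y => coimageProj B (dmapL d F y)) x w ζ) e =
        a w * B (dmapL d (fun y => coimageProj B (dmapL d F y)) x v ζ) e := by
  have hPs := contMDiff_coimageProj hF hnd
  have hform := fun x => isFormProj_coimageProj hB (hnd x)
  have hPν : ∀ x, coimageProj B (dmapL d F x) (ν x) = ν x := fun x =>
    (coimageProj_eq_self_iff hB (hnd x) _).2 (hFν x)
  have hfs : ContMDiff (𝓡 d) 𝓘(ℝ, W →L[ℝ] W) ∞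
    (fun x => subProj B c (coimageProj B (dmapL d F x)) (ν x)) := contMDiff_subProj hPs hν
  have hfform := fun x => (hform x).subProj hB (hc x) (hPν x)
  refine (isProjJet_dmapL hPs hform x).flatJet_iff_of_sub hB hBnd
    (isProjJet_dmapL hfs hfform x) (hc x) (hPν x) (fun y => subProj_apply _ _ _ _)
    (fun v y => dmapL_subProj hPs hν x v y) (fun v => ?_) hdν
    (fun v => coimageProj_image (hnd x) v) (fun v w ζ hζ => ?_)
  · obtain ⟨-, h⟩ := mdifferentiableAt_clm_apply ((hPs x).mdifferentiableAt (by simp))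
      ((hν x).mdifferentiableAt (by simp))
    have h1 := h v
    simp only [hPν] at h1
    exact eq_sub_of_add_eq h1.symm
  · rw [form_deriv_coimageProj hB hF hnd hζ, form_deriv_coimageProj hB hF hnd hζ,
      chartHessian_symm hF]

lemma hasFlatNormalBundle_iff_flatJet (hB : B.IsSymm) (hBnd : ∀ x, (∀ y, B x y = 0) → x = 0)
    {τ : W → Submodule ℝ W} {F : M → W} {P Q : M → W →L[ℝ] W}
    (hPs : ContMDiff (𝓡 d) 𝓘(ℝ, W →L[ℝ] W) ∞ P) (hP : ∀ x, IsFormProj B (P x))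
    (hQ : ∀ x, IsFormProj B (Q x)) (hτ : ∀ x ζ, ζ ∈ τ (F x) ↔ Q x ζ = ζ)
    (hN : ∀ x ζ, ζ ∈ normalSpace d B τ F x ↔ P x ζ = ζ) :
    HasFlatNormalBundle d B τ F ↔ ∀ x, FlatJet (P x) (fun v => dmapL d P x v) :=
  hasFlatNormalBundle_iff hPs
    (fun _ x _ => normalCov_eq_proj hB hBnd (hP x) (hQ x) (hτ x) (hN x) _) hN
    (fun x => (hP x).idem)

lemma mem_orthogonal_range_dmap {F : M → W} {x : M} {ζ : W} :
    ζ ∈ B.orthogonal (LinearMap.range (dmap d F x)) ↔ ∀ v, B (dmapL d F x v) ζ = 0 := by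
  rw [LinearMap.BilinForm.mem_orthogonal_iff]
  constructor
  · exact fun h v => h _ ⟨v, rfl⟩
  · rintro h _ ⟨v, rfl⟩
    exact h v

end NormalProjection

/-! ### Tangential parts and shape operators in terms of the Hessian -/

section ShapeOperators

variable {W : Type*} [NormedAddCommGroup W] [NormedSpace ℝ W] [FiniteDimensional ℝ W]
  {B : LinearMap.BilinForm ℝ W} {d : ℕ} {M : Type*} [TopologicalSpace M]
  [ChartedSpace (EuclideanSpace ℝ (Fin d)) M] [IsManifold (𝓡 d) ∞ M]

lemma nondegImage_of_pos {V : Type*} [NormedAddCommGroup V] [NormedSpace ℝ V] {L : V →L[ℝ] W}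
    (hL : ∀ v, B (L v) (L v) = 0 → v = 0) : NondegImage B L := fun v hv => hL v (hv v)

lemma dmapL_tangentPart (hB : B.IsSymm) (hBnd : ∀ x, (∀ y, B x y = 0) → x = 0) {F : M → W} {x : M}
    (hnd : NondegImage B (dmapL d F x)) (u : W) :
    dmapL d F x (tangentPart d B F u x) = imageProj B (dmapL d F x) u := by
  have h1 : orthProj B (LinearMap.range (dmap d F x)) u = imageProj B (dmapL d F x) u := by
    refine (isFormProj_imageProj hB hnd).orthProj_eq hB hBnd (fun ζ => ⟨?_, fun h => ?_⟩) u
    · rintro ⟨v, rfl⟩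
      exact imageProj_image hnd v
    · obtain ⟨v, hv⟩ := imageProj_mem B (dmapL d F x) ζ
      exact ⟨v, (h.symm.trans hv).symm⟩
  obtain ⟨v, hv⟩ := imageProj_mem B (dmapL d F x) u
  rw [← h1]
  refine invFun_eq (f := dmap d F x) ⟨v, ?_⟩
  rw [h1]
  exact hv.symm

/-- `shapeOperator` is a choice by `epsilon`; the Gram isomorphism supplies an operator with the
defining property. Against a normal vector the second fundamental form equals the chart Hessian. -/
lemma form_shapeOperator (hB : B.IsSymm) (hBnd : ∀ x, (∀ y, B x y = 0) → x = 0)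
    {τ : W → Submodule ℝ W} {F : M → W} {x : M} (hnd : NondegImage B (dmapL d F x))
    {P Q : W →L[ℝ] W} (hP : IsFormProj B P) (hQ : IsFormProj B Q)
    (hτ : ∀ ζ, ζ ∈ τ (F x) ↔ Q ζ = ζ) (hN : ∀ ζ, ζ ∈ normalSpace d B τ F x ↔ P ζ = ζ)
    {ζ : W} (hζ : P ζ = ζ) (v w : EuclideanSpace ℝ (Fin d)) :
    B (dmapL d F x (shapeOperator d B τ F x ζ v)) (dmapL d F x w) =
      B (chartHessian d F x v w) ζ := by
  have hII : ∀ v w : EuclideanSpace ℝ (Fin d),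
      B (secondFF d B τ F x v w) ζ = B (chartHessian d F x v w) ζ := by
    intro v w
    have h : secondFF d B τ F x v w = P (chartHessian d F x v w) :=
      normalCov_eq_proj hB hBnd hP hQ hτ hN _
    rw [h, hP.symm, hζ]
  have hex : ∃ A, IsShapeOperator d B τ F x ζ A := by
    obtain ⟨e, he⟩ := exists_gramEquiv hnd
    let H : EuclideanSpace ℝ (Fin d) →ₗ[ℝ] (EuclideanSpace ℝ (Fin d) →L[ℝ] ℝ) :=
      { toFun := fun v => ((LinearMap.toContinuousBilinearMap B).flip ζ).comp (chartHessian d F x v)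
        map_add' := fun v w => by ext; simp
        map_smul' := fun c v => by ext; simp }
    refine ⟨(e.symm : (EuclideanSpace ℝ (Fin d) →L[ℝ] ℝ) →ₗ[ℝ] EuclideanSpace ℝ (Fin d)) ∘ₗ H,
      fun v w => ?_⟩
    have h : ∀ v w : EuclideanSpace ℝ (Fin d), B (dmapL d F x (e.symm (H v))) (dmapL d F x w) =
        B (secondFF d B τ F x v w) ζ := by
      intro v w
      have h1 : e (e.symm (H v)) w = B (dmapL d F x (e.symm (H v))) (dmapL d F x w) := by
        have := congrArg (fun D : EuclideanSpace ℝ (Fin d) →L[ℝ] EuclideanSpace ℝ (Fin d) →L[ℝ] ℝ =>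
          D (e.symm (H v)) w) he
        simpa using this
      rw [← h1, e.apply_symm_apply, hII]
      rfl
    exact h v w
  exact (Classical.epsilon_spec hex v w).trans (hII v w)

end ShapeOperators

/-! ### The horizontal position vector as a normal field -/

section HorizontalField

variable {n : ℕ} {ε : ℝ}

/-- The projection of `E^{n+1} × ℝ` to `E^{n+1} × {0}`. -/
noncomputable def horizL (n : ℕ) : AmbER n →L[ℝ] AmbER n :=
  (ContinuousLinearMap.fst ℝ (AmbE n) ℝ).prod 0

lemma horizL_apply (p : AmbER n) : horizL n p = (p.1, 0) := rfl

lemma horizL_eq_sub (p : AmbER n) : horizL n p = p - formER ε n p (dt n) • dt n := by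
  rw [formER_dt, horizL_apply]
  ext <;> simp [dt]

variable {d : ℕ} {M : Type*} [TopologicalSpace M] [ChartedSpace (EuclideanSpace ℝ (Fin d)) M]
  [IsManifold (𝓡 d) ∞ M] {F : M → AmbER n}

lemma IsSmoothImmersion.mdifferentiableAt {W : Type*} [NormedAddCommGroup W] [NormedSpace ℝ W]
    {F : M → W} (hF : IsSmoothImmersion d F) (x : M) : MDifferentiableAt (𝓡 d) 𝓘(ℝ, W) F x :=
  (hF.1 x).mdifferentiableAt (by simp)

lemma contMDiff_horizL (hF : IsSmoothImmersion d F) :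
    ContMDiff (𝓡 d) 𝓘(ℝ, AmbER n) ∞ fun y => horizL n (F y) :=
  (horizL n).contDiff.contMDiff.comp hF.1

lemma dmapL_horizL (hF : IsSmoothImmersion d F) (x : M) (v : EuclideanSpace ℝ (Fin d)) :
    dmapL d (fun y => horizL n (F y)) x v =
      dmapL d F x v - formER ε n (dmapL d F x v) (dt n) • dt n := by
  rw [dmapL_clm_comp _ (hF.mdifferentiableAt x), ← horizL_eq_sub]
  rfl

lemma formER_horizL_self (p : AmbER n) :
    formER ε n (horizL n p) (horizL n p) = formE ε n p.1 p.1 := by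
  simp [formER_apply, horizL_apply]

lemma formER_horizL (p q : AmbER n) :
    formER ε n p (horizL n q) = formER ε n (horizL n p) (horizL n q) := by
  simp [formER_apply, horizL_apply]

lemma form_dmapL_horizL (hF : IsSmoothImmersion d F) (hq : ∀ x, formE ε n (F x).1 (F x).1 = ε)
    (x : M) (v : EuclideanSpace ℝ (Fin d)) :
    formER ε n (dmapL d F x v) (horizL n (F x)) = 0 := by
  have hm := (contMDiff_horizL hF x).mdifferentiableAt (by simp)
  have h := form_dmapL_of_const (B := formER ε n) hm hm
    (fun y => (formER_horizL_self _).trans (hq y)) v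
  have h1 : dmapL d (fun y => horizL n (F y)) x v = horizL n (dmapL d F x v) := by
    rw [dmapL_clm_comp _ (hF.mdifferentiableAt x)]
    rfl
  rw [h1, (formER_isSymm ε n).eq] at h
  rw [formER_horizL]
  have h2 : formER ε n (horizL n (F x)) (horizL n (dmapL d F x v)) =
      formER ε n (horizL n (dmapL d F x v)) (horizL n (F x)) := (formER_isSymm ε n).eq _ _
  linarith

/-- F_*v is orthogonal to the position vector of the quadric, and the form is positive definite on
such vectors. The induced metric is therefore Riemannian also for ε = -1. -/
lemma formER_dmapL_pos (hε : ε = 1 ∨ ε = -1) (hF : IsSmoothImmersion d F)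
    (hq : ∀ x, formE ε n (F x).1 (F x).1 = ε) (x : M) (v : EuclideanSpace ℝ (Fin d)) :
    0 ≤ formER ε n (dmapL d F x v) (dmapL d F x v) ∧
      (formER ε n (dmapL d F x v) (dmapL d F x v) = 0 → v = 0) := by
  obtain ⟨h1, h2⟩ := formER_tangent_pos hε (hq x) (x := dmapL d F x v)
    (((formER_isSymm ε n).eq _ _).trans (form_dmapL_horizL hF hq x v))
  refine ⟨h1, fun h => ?_⟩
  have h3 : dmap d F x v = dmap d F x 0 := by rw [map_zero]; exact h2 h
  exact hF.2 x h3

lemma nondegImage_dmapL_formER (hε : ε = 1 ∨ ε = -1) (hF : IsSmoothImmersion d F)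
    (hq : ∀ x, formE ε n (F x).1 (F x).1 = ε) (x : M) :
    NondegImage (formER ε n) (dmapL d F x) :=
  nondegImage_of_pos fun v => (formER_dmapL_pos hε hF hq x v).2

lemma epsilon_mul_horizL (hε : ε = 1 ∨ ε = -1) {p : AmbER n} (hq : formE ε n p.1 p.1 = ε) :
    ε * formER ε n (horizL n p) (horizL n p) = 1 := by
  rw [formER_horizL_self, hq, epsilon_mul_self hε]

lemma mem_normalSpace_tanER (hε : ε = 1 ∨ ε = -1) (hF : IsSmoothImmersion d F)
    (hq : ∀ x, formE ε n (F x).1 (F x).1 = ε) (x : M) (ζ : AmbER n) :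
    ζ ∈ normalSpace d (formER ε n) (tanER n) F x ↔
      coimageProj (formER ε n) (dmapL d F x) ζ = ζ := by
  rw [coimageProj_eq_self_iff (formER_isSymm ε n) (nondegImage_dmapL_formER hε hF hq x),
    normalSpace, tanER, top_inf_eq, mem_orthogonal_range_dmap]

lemma mem_normalSpace_tanQR (hε : ε = 1 ∨ ε = -1) (hF : IsSmoothImmersion d F)
    (hq : ∀ x, formE ε n (F x).1 (F x).1 = ε) (x : M) (ζ : AmbER n) :
    ζ ∈ normalSpace d (formER ε n) (tanQR ε n) F x ↔
      subProj (formER ε n) ε (coimageProj (formER ε n) (dmapL d F x)) (horizL n (F x)) ζ = ζ := by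
  have hnd := nondegImage_dmapL_formER hε hF hq x
  have hB := formER_isSymm ε n
  rw [subProj_eq_self_iff (isFormProj_coimageProj hB hnd) (epsilon_mul_horizL hε (hq x))
    ((coimageProj_eq_self_iff hB hnd _).2 (form_dmapL_horizL hF hq x)),
    coimageProj_eq_self_iff hB hnd, normalSpace, Submodule.mem_inf, mem_tanQR,
    mem_orthogonal_range_dmap, and_comm]
  rfl

lemma mem_tanQR_iff (hε : ε = 1 ∨ ε = -1) {p : AmbER n} (hq : formE ε n p.1 p.1 = ε)
    (ζ : AmbER n) : ζ ∈ tanQR ε n p ↔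
      subProj (formER ε n) ε (ContinuousLinearMap.id ℝ _) (horizL n p) ζ = ζ := by
  rw [subProj_eq_self_iff IsFormProj.id (epsilon_mul_horizL hε hq) rfl, mem_tanQR]
  simp [horizL_apply]

lemma hasFlatNormalBundle_tanER_iff (hε : ε = 1 ∨ ε = -1) (hF : IsSmoothImmersion d F)
    (hq : ∀ x, formE ε n (F x).1 (F x).1 = ε) :
    HasFlatNormalBundle d (formER ε n) (tanER n) F ↔
      ∀ x, FlatJet (coimageProj (formER ε n) (dmapL d F x))
        (fun v => dmapL d (fun y => coimageProj (formER ε n) (dmapL d F y)) x v) := by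
  have hB := formER_isSymm ε n
  have hnd := nondegImage_dmapL_formER hε hF hq
  refine hasFlatNormalBundle_iff_flatJet hB (formER_nondeg hε)
    (contMDiff_coimageProj hF.1 hnd) (fun x => isFormProj_coimageProj hB (hnd x))
    (Q := fun _ => ContinuousLinearMap.id ℝ _) (fun _ => IsFormProj.id) ?_
    (mem_normalSpace_tanER hε hF hq)
  intro x ζ
  simp [tanER]

lemma hasFlatNormalBundle_tanQR_iff (hε : ε = 1 ∨ ε = -1) (hF : IsSmoothImmersion d F)
    (hq : ∀ x, formE ε n (F x).1 (F x).1 = ε) :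
    HasFlatNormalBundle d (formER ε n) (tanQR ε n) F ↔
      ∀ x, FlatJet
        (subProj (formER ε n) ε (coimageProj (formER ε n) (dmapL d F x)) (horizL n (F x)))
        (fun v => dmapL d (fun y => subProj (formER ε n) ε
          (coimageProj (formER ε n) (dmapL d F y)) (horizL n (F y))) x v) := by
  have hB := formER_isSymm ε n
  have hnd := nondegImage_dmapL_formER hε hF hq
  exact hasFlatNormalBundle_iff_flatJet hB (formER_nondeg hε)
    (contMDiff_subProj (contMDiff_coimageProj hF.1 hnd) (contMDiff_horizL hF))
    (fun x => (isFormProj_coimageProj hB (hnd x)).subProj hB (epsilon_mul_horizL hε (hq x))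
      ((coimageProj_eq_self_iff hB (hnd x) _).2 (form_dmapL_horizL hF hq x)))
    (fun x => IsFormProj.id.subProj hB (epsilon_mul_horizL hε (hq x)) rfl)
    (fun x => mem_tanQR_iff hε (hq x)) (mem_normalSpace_tanQR hε hF hq)

/-- The case in which ν is the horizontal position vector: its derivative is F_*v without the
vertical component, so a(v) = ⟨F_*v, ∂/∂t⟩ and e = ∂/∂t. -/
lemma flatJet_coimageProj_formER_iff (hε : ε = 1 ∨ ε = -1) (hF : IsSmoothImmersion d F)
    (hq : ∀ x, formE ε n (F x).1 (F x).1 = ε) (x : M) :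
    FlatJet (coimageProj (formER ε n) (dmapL d F x))
        (fun v => dmapL d (fun y => coimageProj (formER ε n) (dmapL d F y)) x v) ↔
      FlatJet (subProj (formER ε n) ε (coimageProj (formER ε n) (dmapL d F x)) (horizL n (F x)))
        (fun v => dmapL d (fun y => subProj (formER ε n) ε
          (coimageProj (formER ε n) (dmapL d F y)) (horizL n (F y))) x v) ∧
      ∀ v w ζ, subProj (formER ε n) ε (coimageProj (formER ε n) (dmapL d F x))
          (horizL n (F x)) ζ = ζ →
        formER ε n (dmapL d F x v) (dt n) *
          formER ε n (dmapL d (fun y => coimageProj (formER ε n) (dmapL d F y)) x w ζ) (dt n) =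
        formER ε n (dmapL d F x w) (dt n) *
          formER ε n (dmapL d (fun y => coimageProj (formER ε n) (dmapL d F y)) x v ζ) (dt n) :=
  flatJet_coimageProj_iff (formER_isSymm ε n) (formER_nondeg hε) hF.1
    (nondegImage_dmapL_formER hε hF hq) (contMDiff_horizL hF) (form_dmapL_horizL hF hq)
    (fun y => epsilon_mul_horizL hε (hq y)) (dmapL_horizL hF x)

/-- The derivative of the normal projection pairs with `∂/∂t` as with its tangential part. -/
lemma form_deriv_coimageProj_dt (hε : ε = 1 ∨ ε = -1) (hF : IsSmoothImmersion d F)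
    (hq : ∀ x, formE ε n (F x).1 (F x).1 = ε) {x : M} {T : EuclideanSpace ℝ (Fin d)}
    (hT : dmapL d F x T = imageProj (formER ε n) (dmapL d F x) (dt n)) {ζ : AmbER n}
    (hζ : coimageProj (formER ε n) (dmapL d F x) ζ = ζ) (w : EuclideanSpace ℝ (Fin d)) :
    formER ε n (dmapL d (fun y => coimageProj (formER ε n) (dmapL d F y)) x w ζ) (dt n) =
      - formER ε n (chartHessian d F x T w) ζ := by
  have hB := formER_isSymm ε n
  have hnd := nondegImage_dmapL_formER hε hF hq
  have hjet := isProjJet_dmapL (contMDiff_coimageProj hF.1 hnd)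
    (fun x => isFormProj_coimageProj hB (hnd x)) x
  obtain ⟨u, hu⟩ := (coimageProj_eq_zero_iff (hnd x) _).1 (hjet.proj_deriv hζ w)
  rw [chartHessian_symm hF.1, ← form_deriv_coimageProj hB hF.1 hnd hζ, hT, hu,
    hB.eq (dmapL d F x u) (dt n), ← form_imageProj (hnd x), hB.eq]

lemma form_dmapL_dt (hε : ε = 1 ∨ ε = -1) (hF : IsSmoothImmersion d F)
    (hq : ∀ x, formE ε n (F x).1 (F x).1 = ε) {x : M} {T : EuclideanSpace ℝ (Fin d)}
    (hT : dmapL d F x T = imageProj (formER ε n) (dmapL d F x) (dt n))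
    (v : EuclideanSpace ℝ (Fin d)) :
    formER ε n (dmapL d F x v) (dt n) = formER ε n (dmapL d F x v) (dmapL d F x T) := by
  have hB := formER_isSymm ε n
  rw [hT, hB.eq (dmapL d F x v) (imageProj _ _ _),
    form_imageProj (nondegImage_dmapL_formER hε hF hq x), hB.eq]

end HorizontalField

/-! ### Equivalence of (i) and (ii) -/

section ClassA

variable {n : ℕ} {ε : ℝ} {d : ℕ} {M : Type*} [TopologicalSpace M]
  [ChartedSpace (EuclideanSpace ℝ (Fin d)) M] [IsManifold (𝓡 d) ∞ M] {f : M → quadric ε n × ℝ}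

lemma formE_inclQR_comp (f : M → quadric ε n × ℝ) (x : M) :
    formE ε n ((inclQR ε n ∘ f) x).1 ((inclQR ε n ∘ f) x).1 = ε := (f x).1.2.1

lemma dmapL_fieldT (hε : ε = 1 ∨ ε = -1) (hf : IsSmoothImmersion d (inclQR ε n ∘ f)) (x : M) :
    dmapL d (inclQR ε n ∘ f) x (fieldT d ε f x) =
      imageProj (formER ε n) (dmapL d (inclQR ε n ∘ f) x) (dt n) :=
  dmapL_tangentPart (formER_isSymm ε n) (formER_nondeg hε)
    (nondegImage_dmapL_formER hε hf (formE_inclQR_comp f) x) _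

lemma hasEigenvector_shapeOperator_iff (hε : ε = 1 ∨ ε = -1)
    (hf : IsSmoothImmersion d (inclQR ε n ∘ f)) (x : M) {ζ : AmbER n}
    (hζ : ζ ∈ normalSpace d (formER ε n) (tanQR ε n) (inclQR ε n ∘ f) x)
    {T : EuclideanSpace ℝ (Fin d)} (hT : T = fieldT d ε f x) (μ : ℝ) :
    (shapeOperator d (formER ε n) (tanQR ε n) (inclQR ε n ∘ f) x ζ).HasEigenvector μ
      (fieldT d ε f x) ↔
    (∀ w, formER ε n (chartHessian d (inclQR ε n ∘ f) x T w) ζ =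
      μ * formER ε n (dmapL d (inclQR ε n ∘ f) x T) (dmapL d (inclQR ε n ∘ f) x w)) ∧ T ≠ 0 := by
  have hq := formE_inclQR_comp f
  have hB := formER_isSymm ε n
  have hnd := nondegImage_dmapL_formER hε hf hq
  have hA := form_shapeOperator hB (formER_nondeg hε) (hnd x)
    ((isFormProj_coimageProj hB (hnd x)).subProj hB (epsilon_mul_horizL hε (hq x))
      ((coimageProj_eq_self_iff hB (hnd x) _).2 (form_dmapL_horizL hf hq x)))
    (IsFormProj.id.subProj hB (epsilon_mul_horizL hε (hq x)) rfl)
    (mem_tanQR_iff hε (hq x)) (mem_normalSpace_tanQR hε hf hq x)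
    ((mem_normalSpace_tanQR hε hf hq x ζ).1 hζ) T
  rw [Module.End.hasEigenvector_iff, Module.End.mem_eigenspace_iff]
  refine and_congr ?_ (by rw [hT]; exact Iff.rfl)
  have key : ∀ S : EuclideanSpace ℝ (Fin d),
      (∀ w, formER ε n (dmapL d (inclQR ε n ∘ f) x S) (dmapL d (inclQR ε n ∘ f) x w) =
        formER ε n (chartHessian d (inclQR ε n ∘ f) x T w) ζ) →
      (S = μ • T ↔ ∀ w, formER ε n (chartHessian d (inclQR ε n ∘ f) x T w) ζ =
      μ * formER ε n (dmapL d (inclQR ε n ∘ f) x T) (dmapL d (inclQR ε n ∘ f) x w)) := by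
    intro S hS
    constructor
    · intro h w
      rw [← hS, h]
      simp
    · intro h
      refine sub_eq_zero.1 (hnd x _ fun w => ?_)
      simp only [map_sub, LinearMap.sub_apply, hS, h, map_smul, LinearMap.smul_apply, smul_eq_mul,
        sub_self]
  rw [← key _ hA, hT]
  exact Iff.rfl

/-- An immersion into `Q_ε^n × ℝ` with `T` nowhere zero has flat normal bundle in `E^{n+2}` if and
only if it has flat normal bundle in `Q_ε^n × ℝ` and belongs to the class `𝒜`. -/
theorem flat_tanER_iff_flat_tanQR_and_isClassA (hε : ε = 1 ∨ ε = -1)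
    (hf : IsSmoothImmersion d (inclQR ε n ∘ f)) :
    ((∀ x : M, fieldT d ε f x ≠ 0) ∧
        HasFlatNormalBundle d (formER ε n) (tanER n) (inclQR ε n ∘ f)) ↔
      HasFlatNormalBundle d (formER ε n) (tanQR ε n) (inclQR ε n ∘ f) ∧ IsClassA d ε f := by
  have hq := formE_inclQR_comp f
  have hB := formER_isSymm ε n
  have hnd := nondegImage_dmapL_formER hε hf hq
  have hmem := fun x => mem_normalSpace_tanQR hε hf hq x
  have hnorm : ∀ x ζ, subProj (formER ε n) ε (coimageProj (formER ε n)
      (dmapL d (inclQR ε n ∘ f) x)) (horizL n ((inclQR ε n ∘ f) x)) ζ = ζ →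
      coimageProj (formER ε n) (dmapL d (inclQR ε n ∘ f) x) ζ = ζ := fun x ζ h =>
    ((subProj_eq_self_iff (isFormProj_coimageProj hB (hnd x)) (epsilon_mul_horizL hε (hq x))
      ((coimageProj_eq_self_iff hB (hnd x) _).2 (form_dmapL_horizL hf hq x)) ζ).1 h).1
  rw [hasFlatNormalBundle_tanER_iff hε hf hq, hasFlatNormalBundle_tanQR_iff hε hf hq]
  -- Translates the extra condition into symmetry of ⟨v,T⟩⟨α(T,w),ζ⟩ in v and w.
  have hcond : ∀ x (T : EuclideanSpace ℝ (Fin d)), T = fieldT d ε f x → ∀ w ζ,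
      ζ ∈ normalSpace d (formER ε n) (tanQR ε n) (inclQR ε n ∘ f) x →
      formER ε n (dmapL d (fun y => coimageProj (formER ε n) (dmapL d (inclQR ε n ∘ f) y)) x w ζ)
        (dt n) = - formER ε n (chartHessian d (inclQR ε n ∘ f) x T w) ζ ∧
      formER ε n (dmapL d (inclQR ε n ∘ f) x w) (dt n) =
        formER ε n (dmapL d (inclQR ε n ∘ f) x w) (dmapL d (inclQR ε n ∘ f) x T) := by
    intro x T hT w ζ hζ
    have hT' : dmapL d (inclQR ε n ∘ f) x T =
        imageProj (formER ε n) (dmapL d (inclQR ε n ∘ f) x) (dt n) := by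
      rw [hT]; exact dmapL_fieldT hε hf x
    exact ⟨form_deriv_coimageProj_dt hε hf hq hT' (hnorm x ζ ((hmem x ζ).1 hζ)) w,
      form_dmapL_dt hε hf hq hT' w⟩
  constructor
  · rintro ⟨hT0, hflat⟩
    refine ⟨fun x => ((flatJet_coimageProj_formER_iff hε hf hq x).1 (hflat x)).1, fun x ζ hζ => ?_⟩
    obtain ⟨T, hT⟩ : ∃ T : EuclideanSpace ℝ (Fin d), T = fieldT d ε f x := ⟨_, rfl⟩
    have hTne : T ≠ 0 := by rw [hT]; exact hT0 x
    have h2 := ((flatJet_coimageProj_formER_iff hε hf hq x).1 (hflat x)).2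
    set b := formER ε n (dmapL d (inclQR ε n ∘ f) x T) (dmapL d (inclQR ε n ∘ f) x T) with hb
    have hb0 : b ≠ 0 := fun h => hTne ((formER_dmapL_pos hε hf hq x T).2 h)
    -- The eigenvalue ⟨α(T,T),ζ⟩/⟨T,T⟩ is read off from the symmetry condition with one argument
    -- equal to T.
    refine ⟨formER ε n (chartHessian d (inclQR ε n ∘ f) x T T) ζ / b,
      (hasEigenvector_shapeOperator_iff hε hf x hζ hT _).2 ⟨fun w => ?_, hTne⟩⟩
    have h3 := h2 T w ζ ((hmem x ζ).1 hζ)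
    rw [(hcond x T hT w ζ hζ).1, (hcond x T hT T ζ hζ).1, (hcond x T hT w ζ hζ).2,
      (hcond x T hT T ζ hζ).2, ← hb] at h3
    rw [hB.eq (dmapL d (inclQR ε n ∘ f) x T) (dmapL d (inclQR ε n ∘ f) x w)]
    rw [div_mul_eq_mul_div, eq_div_iff hb0]
    linarith
  · rintro ⟨hflat, hA⟩
    refine ⟨fun x => ?_, fun x => (flatJet_coimageProj_formER_iff hε hf hq x).2
      ⟨hflat x, fun v w ζ hζ' => ?_⟩⟩
    -- The zero normal vector already yields T ≠ 0, also when f has codimension zero.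
    · obtain ⟨μ, hμ⟩ := hA x 0 (Submodule.zero_mem _)
      exact hμ.2
    · have hζ := (hmem x ζ).2 hζ'
      obtain ⟨T, hT⟩ : ∃ T : EuclideanSpace ℝ (Fin d), T = fieldT d ε f x := ⟨_, rfl⟩
      obtain ⟨μ, hμ⟩ := hA x ζ hζ
      obtain ⟨h1, -⟩ := (hasEigenvector_shapeOperator_iff hε hf x hζ hT _).1 hμ
      rw [(hcond x T hT w ζ hζ).1, (hcond x T hT v ζ hζ).1, (hcond x T hT w ζ hζ).2,
        (hcond x T hT v ζ hζ).2, h1, h1, hB.eq (dmapL d (inclQR ε n ∘ f) x T),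
        hB.eq (dmapL d (inclQR ε n ∘ f) x T)]
      ring

end ClassA

/-! ### Flatness when a line is split off from a bundle -/

section SplitProjection

variable {W : Type*} [NormedAddCommGroup W] [NormedSpace ℝ W] [FiniteDimensional ℝ W]
  {B : LinearMap.BilinForm ℝ W} {E : Type*} [NormedAddCommGroup E] [NormedSpace ℝ E]
  {P Q : E → W →L[ℝ] W} {P' Q' : E →L[ℝ] W →L[ℝ] W} {z : E → W} {z' : E →L[ℝ] W} {c : E → ℝ}
  {u : E}

/-- On vectors orthogonal to z the terms with the derivative of the scalar c, or with z
differentiated outside the pairing, carry the factor ⟨z,ζ⟩ = 0. -/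
lemma deriv_subProj_apply (hP : HasFDerivAt P P' u) (hQ : HasFDerivAt Q Q' u)
    (hz : HasFDerivAt z z' u) (hc : DifferentiableAt ℝ c u)
    (heq : ∀ᶠ y in nhds u, P y = subProj B (c y) (Q y) (z y)) {ζ : W} (hζ : B (z u) ζ = 0) (v : E) :
    P' v ζ = Q' v ζ - (c u * B (z' v) ζ) • z u := by
  have h1 := hP.clm_apply (hasFDerivAt_const ζ u)
  have h2 := hQ.clm_apply (hasFDerivAt_const ζ u)
  obtain ⟨D, hD, hDv⟩ := hasFDerivAt_form B hz (hasFDerivAt_const ζ u)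
  have h4 := h2.sub ((hc.hasFDerivAt.mul hD).smul hz)
  have h5 := h1.unique (h4.congr_of_eventuallyEq (heq.mono fun y hy => by
    simp only [hy]; exact subProj_apply _ _ _ _))
  have h6 := congrArg (fun D : E →L[ℝ] W => D v) h5
  simpa [hDv, hζ] using h6

variable {P₀ Q₀ : W →L[ℝ] W} {z₀ : W} {c₀ : ℝ}

lemma form_deriv_subProj (hQ' : IsProjJet B (Q₀) (fun v => Q' v))
    (hz : Q₀ (z₀) = z₀) (hc : c₀ * B (z₀) (z₀) = 1)
    (hP' : ∀ ζ, B (z₀) ζ = 0 → ∀ v, P' v ζ = Q' v ζ - (c₀ * B (z' v) ζ) • z₀)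
    {ζ ζ' : W} (h1 : Q₀ ζ = ζ) (h1' : Q₀ ζ' = ζ') (h2 : B (z₀) ζ = 0) (h2' : B (z₀) ζ' = 0)
    (v w : E) : B (P' v ζ) (P' w ζ') =
      B (Q' v ζ) (Q' w ζ') + c₀ * (B (z' v) ζ * B (z' w) ζ') := by
  rw [hP' ζ h2, hP' ζ' h2']
  have h3 : B (Q' v ζ) (z₀) = 0 := hQ'.form_eq_zero (hQ'.proj_deriv h1 v) hz
  have h4 : B (z₀) (Q' w ζ') = 0 := hQ'.form_eq_zero' (hQ'.proj_deriv h1' w) hz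
  simp only [map_sub, map_smul, LinearMap.sub_apply, LinearMap.smul_apply, smul_eq_mul, h3, h4]
  linear_combination (c₀ * B (z' v) ζ * B (z' w) ζ') * hc

/-- Flatness passes to the orthogonal complement of a section `z` the derivatives of which in the
complement are all proportional to the same covector. -/
lemma flatJet_subProj (hnd : ∀ x, (∀ y, B x y = 0) → x = 0)
    (hP' : IsProjJet B (P₀) (fun v => P' v)) (hQ' : IsProjJet B (Q₀) (fun v => Q' v))
    (hz : Q₀ (z₀) = z₀) (hc : c₀ * B (z₀) (z₀) = 1)
    (hPζ : ∀ ζ, P₀ ζ = ζ ↔ Q₀ ζ = ζ ∧ B (z₀) ζ = 0)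
    (hPd : ∀ ζ, B (z₀) ζ = 0 → ∀ v, P' v ζ = Q' v ζ - (c₀ * B (z' v) ζ) • z₀)
    {ρ : E → ℝ} (hρ : ∀ ζ, P₀ ζ = ζ → ∃ r, ∀ v, B (z' v) ζ = ρ v * r)
    (h : FlatJet (Q₀) (fun v => Q' v)) : FlatJet (P₀) (fun v => P' v) := by
  rw [hP'.flatJet_iff hnd]
  rw [hQ'.flatJet_iff hnd] at h
  intro v w ζ ζ' hζ hζ'
  obtain ⟨h1, h2⟩ := (hPζ ζ).1 hζ
  obtain ⟨h1', h2'⟩ := (hPζ ζ').1 hζ'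
  obtain ⟨r, hr⟩ := hρ ζ hζ
  obtain ⟨r', hr'⟩ := hρ ζ' hζ'
  -- The correction term becomes c ρ(v)ρ(w) r r', which is symmetric in v and w.
  rw [form_deriv_subProj hQ' hz hc hPd h1 h1' h2 h2',
    form_deriv_subProj hQ' hz hc hPd h1 h1' h2 h2', h v w ζ ζ' h1 h1', hr, hr, hr', hr']
  ring

/-- A converse of `flatJet_subProj`, if the larger bundle has a constant section that is not
orthogonal to `z`. -/
lemma flatJet_of_subProj (hnd : ∀ x, (∀ y, B x y = 0) → x = 0)
    (hP' : IsProjJet B (P₀) (fun v => P' v)) (hQ' : IsProjJet B (Q₀) (fun v => Q' v))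
    (hz : Q₀ (z₀) = z₀) (hc : c₀ * B (z₀) (z₀) = 1)
    (hPζ : ∀ ζ, P₀ ζ = ζ ↔ Q₀ ζ = ζ ∧ B (z₀) ζ = 0)
    (hPd : ∀ ζ, B (z₀) ζ = 0 → ∀ v, P' v ζ = Q' v ζ - (c₀ * B (z' v) ζ) • z₀)
    {ρ : E → ℝ} (hρ : ∀ ζ, P₀ ζ = ζ → ∃ r, ∀ v, B (z' v) ζ = ρ v * r)
    {e : W} (he : Q₀ e = e) (hde : ∀ v, Q' v e = 0) (hze : B (z₀) e ≠ 0)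
    (h : FlatJet (P₀) (fun v => P' v)) : FlatJet (Q₀) (fun v => Q' v) := by
  rw [hQ'.flatJet_iff hnd]
  rw [hP'.flatJet_iff hnd] at h
  intro v w ζ ζ' hζ hζ'
  -- Subtracting a multiple of the constant section `e` moves ζ into the complement of z and leaves
  -- all its derivatives Q'(v)ζ unchanged.
  have hdec : ∀ ζ, Q₀ ζ = ζ → ∃ ζ₀, P₀ ζ₀ = ζ₀ ∧ Q₀ ζ₀ = ζ₀ ∧ B (z₀) ζ₀ = 0 ∧
      ∀ v, Q' v ζ = Q' v ζ₀ := by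
    intro ζ hζ
    have h1 : Q₀ (ζ - (B (z₀) ζ / B (z₀) e) • e) = ζ - (B (z₀) ζ / B (z₀) e) • e := by
      rw [map_sub, map_smul, hζ, he]
    have h2 : B (z₀) (ζ - (B (z₀) ζ / B (z₀) e) • e) = 0 := by
      rw [map_sub, map_smul, smul_eq_mul, div_mul_cancel₀ _ hze, sub_self]
    exact ⟨_, (hPζ _).2 ⟨h1, h2⟩, h1, h2, fun v => by rw [map_sub, map_smul, hde]; simp⟩
  obtain ⟨ζ₀, h0, h1, h2, h3⟩ := hdec ζ hζ
  obtain ⟨ζ₀', h0', h1', h2', h3'⟩ := hdec ζ' hζ'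
  obtain ⟨r, hr⟩ := hρ ζ₀ h0
  obtain ⟨r', hr'⟩ := hρ ζ₀' h0'
  have h4 := h v w ζ₀ ζ₀' h0 h0'
  rw [form_deriv_subProj hQ' hz hc hPd h1 h1' h2 h2',
    form_deriv_subProj hQ' hz hc hPd h1 h1' h2 h2', hr, hr, hr', hr'] at h4
  rw [h3, h3, h3', h3']
  linear_combination h4

end SplitProjection

/-! ### Complements of images of maps on a product with ℝ -/

section ImageSplit

variable {W : Type*} [NormedAddCommGroup W] [NormedSpace ℝ W] [FiniteDimensional ℝ W]
  {B : LinearMap.BilinForm ℝ W} {U V : Type*} [NormedAddCommGroup U] [NormedSpace ℝ U]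
  [FiniteDimensional ℝ U] [NormedAddCommGroup V] [NormedSpace ℝ V] [FiniteDimensional ℝ V]

lemma coimageProj_comp_injective {L : V →L[ℝ] W} (hL : NondegImage B L) {J : U →L[ℝ] V}
    (hJ : Injective J) (hfin : Module.finrank ℝ U = Module.finrank ℝ V) :
    NondegImage B (L.comp J) ∧ coimageProj B (L.comp J) = coimageProj B L := by
  have hJ' : J.IsInvertible :=
    ⟨(LinearEquiv.ofInjectiveOfFinrankEq (J : U →ₗ[ℝ] V) hJ hfin).toContinuousLinearEquiv, rfl⟩
  exact ⟨nondegImage_comp hL hJ', coimageProj_comp_invertible hL hJ'⟩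

/-- If the restriction of `L` to the first factor has the same image as `D`, the projection to the
complement of the image of `L` is obtained from that of `D` by splitting off `z = L (0, 1)`. -/
lemma coimageProj_prod_eq (hB : B.IsSymm) {L : U × ℝ →L[ℝ] W} (hL : NondegImage B L)
    {D : U →L[ℝ] W} (hD : NondegImage B D) (hLD : ∀ a, ∃ b, L (a, 0) = D b)
    (hz : ∀ b, B (D b) (L (0, 1)) = 0) {c : ℝ} (hc : c * B (L (0, 1)) (L (0, 1)) = 1) :
    coimageProj B L = subProj B c (coimageProj B D) (L (0, 1)) := by
  -- The assignment a ↦ b with L(a,0) = D b is an injective endomorphism of the finite-dimensional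
  -- space `U`, hence onto.
  have hsurj : ∀ b, ∃ a, D b = L (a, 0) := by
    choose S hS using hLD
    have hDinj : Injective D := fun a b hab => sub_eq_zero.1 (hD _ fun w => by
      rw [map_sub, hab, sub_self, map_zero, LinearMap.zero_apply])
    have hLinj : ∀ a b, L (a, 0) = L (b, 0) → a = b := fun a b hab => by
      have := hL ((a, 0) - (b, 0)) fun w => by
        rw [map_sub, hab, sub_self, map_zero, LinearMap.zero_apply]
      simpa [sub_eq_zero] using this
    let Sl : U →ₗ[ℝ] U :=
      { toFun := S
        map_add' := fun a b => hDinj <| by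
          rw [map_add, ← hS, ← hS, ← hS, ← map_add]; simp
        map_smul' := fun t a => hDinj <| by
          rw [map_smul, ← hS, ← hS, ← map_smul]; simp }
    have hSl : Surjective Sl := LinearMap.injective_iff_surjective.1 fun a b hab => hLinj a b <| by
      rw [hS, hS]; exact congrArg D hab
    intro b
    obtain ⟨a, rfl⟩ := hSl b
    exact ⟨a, (hS a).symm⟩
  have hdec : ∀ a r, L (a, r) = L (a, 0) + r • L (0, 1) := fun a r => by
    rw [← map_smul, ← map_add]; simp
  ext1 w
  rw [subProj_apply, coimageProj_apply, coimageProj_apply]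
  have h : imageProj B L w = imageProj B D w + (c * B (L (0, 1)) w) • L (0, 1) := by
    refine imageProj_eq_of hL ?_ ?_
    · obtain ⟨b, hb⟩ := imageProj_mem B D w
      obtain ⟨a, ha⟩ := hsurj b
      refine ⟨(a, c * B (L (0, 1)) w), ?_⟩
      rw [hb, ha]
      exact hdec _ _
    · rintro ⟨a, r⟩
      obtain ⟨b, hb⟩ := hLD a
      rw [hdec a r, hb]
      have h1 := form_imageProj hD w b
      obtain ⟨b', hb'⟩ := imageProj_mem B D w
      have h2 := hz b
      have h3 := hz b'
      rw [hB.eq] at h2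
      rw [← hb'] at h3
      have h4 := hB.eq (L (0, 1)) w
      simp only [map_sub, map_add, map_smul, LinearMap.sub_apply, LinearMap.add_apply,
        LinearMap.smul_apply, smul_eq_mul, h1, h2, h3, h4]
      linear_combination (- r * B w (L (0, 1))) * hc
  rw [h]
  abel

end ImageSplit

/-! ### Bundles in E^{n+1} enlarged by the vertical line -/

section HorizontalSplit

variable {n : ℕ} {ε : ℝ} {U : Type*} [NormedAddCommGroup U] [NormedSpace ℝ U]
  [FiniteDimensional ℝ U]

/-- The inclusion of `E^{n+1}` in `E^{n+1} × ℝ`. -/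
noncomputable def inclE (n : ℕ) : AmbE n →L[ℝ] AmbER n := ContinuousLinearMap.inl ℝ (AmbE n) ℝ

lemma inclE_apply (x : AmbE n) : inclE n x = (x, 0) := rfl

lemma formER_inclE (x : AmbE n) (p : AmbER n) : formER ε n (inclE n x) p = formE ε n x p.1 := by
  simp [formER_apply, inclE_apply]

/-- The direct sum of an endomorphism of `E^{n+1}` and the identity of `ℝ`. -/
noncomputable def liftEnd (n : ℕ) (A : AmbE n →L[ℝ] AmbE n) : AmbER n →L[ℝ] AmbER n :=
  ContinuousLinearMap.prodMap A (ContinuousLinearMap.id ℝ ℝ)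

lemma liftEnd_apply (A : AmbE n →L[ℝ] AmbE n) (p : AmbER n) : liftEnd n A p = (A p.1, p.2) := rfl

lemma hasFDerivAt_liftEnd {E : Type*} [NormedAddCommGroup E] [NormedSpace ℝ E]
    {A : E → AmbE n →L[ℝ] AmbE n} {A' : E →L[ℝ] AmbE n →L[ℝ] AmbE n} {u : E}
    (hA : HasFDerivAt A A' u) : ∃ D : E →L[ℝ] AmbER n →L[ℝ] AmbER n,
      HasFDerivAt (fun y => liftEnd n (A y)) D u ∧ ∀ v p, D v p = (A' v p.1, 0) := by
  have h : ∀ y, liftEnd n (A y) = (inclE n).comp ((A y).comp (ContinuousLinearMap.fst ℝ _ _)) +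
      (ContinuousLinearMap.inr ℝ (AmbE n) ℝ).comp (ContinuousLinearMap.snd ℝ _ _) := by
    intro y
    ext p <;> simp [liftEnd_apply, inclE_apply]
  simp only [h]
  refine ⟨_, ((hasFDerivAt_const (inclE n) u).clm_comp
    (hA.clm_comp (hasFDerivAt_const (ContinuousLinearMap.fst ℝ (AmbE n) ℝ) u))).add_const _, ?_⟩
  intro v p
  simp [inclE_apply]

lemma nondegImage_inclE {L : U →L[ℝ] AmbE n} (hL : NondegImage (formE ε n) L) :
    NondegImage (formER ε n) ((inclE n).comp L) := fun v hv => hL v fun w => by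
  have := hv w
  rwa [ContinuousLinearMap.comp_apply, formER_inclE] at this

/-- A horizontal subspace is orthogonal to ∂/∂t, so passing from E^{n+1} to E^{n+2} only adds the
vertical line to its complement. By the next lemma, this constant line is a flat summand. -/
lemma coimageProj_inclE {L : U →L[ℝ] AmbE n} (hL : NondegImage (formE ε n) L) :
    coimageProj (formER ε n) ((inclE n).comp L) = liftEnd n (coimageProj (formE ε n) L) := by
  refine ContinuousLinearMap.ext fun p => ?_
  rw [coimageProj_apply, liftEnd_apply, coimageProj_apply, sub_eq_iff_eq_add, ← sub_eq_iff_eq_add',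
    eq_comm]
  refine imageProj_eq_of (nondegImage_inclE hL) ?_ fun v => ?_
  · obtain ⟨v, hv⟩ := imageProj_mem (formE ε n) L p.1
    refine ⟨v, ?_⟩
    ext1 <;> simp [inclE_apply, hv]
  · rw [(formER_isSymm ε n).eq, ContinuousLinearMap.comp_apply, formER_inclE]
    simp only [sub_sub_cancel]
    rw [(formE_isSymm ε n).eq]
    have := form_imageProj hL p.1 v
    simp [this]

lemma flatJet_liftEnd {E : Type*} {P : AmbE n →L[ℝ] AmbE n} {dP : E → AmbE n →L[ℝ] AmbE n}
    {D : E → AmbER n →L[ℝ] AmbER n} (hD : ∀ v p, D v p = (dP v p.1, 0)) :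
    FlatJet (liftEnd n P) D ↔ FlatJet P dP := by
  constructor
  · intro h v w ζ hζ
    have := h v w (ζ, 0) (by rw [liftEnd_apply, hζ])
    simpa [liftEnd_apply, hD] using this
  · intro h v w ζ hζ
    have h1 := h v w ζ.1 (by simpa [liftEnd_apply] using congrArg Prod.fst hζ)
    simp [liftEnd_apply, hD, h1]

end HorizontalSplit

/-! ### Immersions into the quadric and their parallel normal fields -/

section QuadricImmersion

variable {n : ℕ} {ε : ℝ} {d : ℕ} {N : Type*} [TopologicalSpace N]
  [ChartedSpace (EuclideanSpace ℝ (Fin d)) N] [IsManifold (𝓡 d) ∞ N] {g : N → AmbE n}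

lemma form_dmapL_quadric (hg : IsSmoothImmersion d g) (hq : ∀ x, formE ε n (g x) (g x) = ε) (x : N)
    (v : EuclideanSpace ℝ (Fin d)) : formE ε n (dmapL d g x v) (g x) = 0 := by
  have hm := hg.mdifferentiableAt x
  have h := form_dmapL_of_const (B := formE ε n) hm hm hq v
  rw [(formE_isSymm ε n).eq] at h
  linarith

lemma nondegImage_dmapL_formE (hε : ε = 1 ∨ ε = -1) (hg : IsSmoothImmersion d g)
    (hq : ∀ x, formE ε n (g x) (g x) = ε) (x : N) : NondegImage (formE ε n) (dmapL d g x) := by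
  refine nondegImage_of_pos fun v hv => ?_
  have h := (formE_tangent_pos hε (hq x) (x := dmapL d g x v)
    (((formE_isSymm ε n).eq _ _).trans (form_dmapL_quadric hg hq x v))).2 hv
  have h3 : dmap d g x v = dmap d g x 0 := by rw [map_zero]; exact h
  exact hg.2 x h3

lemma epsilon_mul_quadric (hε : ε = 1 ∨ ε = -1) {q : AmbE n} (hq : formE ε n q q = ε) :
    ε * formE ε n q q = 1 := by
  rw [hq, epsilon_mul_self hε]

lemma coimageProj_quadric (hε : ε = 1 ∨ ε = -1) (hg : IsSmoothImmersion d g)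
    (hq : ∀ x, formE ε n (g x) (g x) = ε) (x : N) :
    coimageProj (formE ε n) (dmapL d g x) (g x) = g x :=
  (coimageProj_eq_self_iff (formE_isSymm ε n) (nondegImage_dmapL_formE hε hg hq x) _).2
    (form_dmapL_quadric hg hq x)

lemma isFormProj_normal_quadric (hε : ε = 1 ∨ ε = -1) (hg : IsSmoothImmersion d g)
    (hq : ∀ x, formE ε n (g x) (g x) = ε) (x : N) :
    IsFormProj (formE ε n) (subProj (formE ε n) ε (coimageProj (formE ε n) (dmapL d g x)) (g x)) :=
  (isFormProj_coimageProj (formE_isSymm ε n) (nondegImage_dmapL_formE hε hg hq x)).subProj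
    (formE_isSymm ε n) (epsilon_mul_quadric hε (hq x)) (coimageProj_quadric hε hg hq x)

lemma mem_normalSpace_tanQ (x : N) (ζ : AmbE n) :
    ζ ∈ normalSpace d (formE ε n) (tanQ ε n) g x ↔
      (∀ v, formE ε n (dmapL d g x v) ζ = 0) ∧ formE ε n (g x) ζ = 0 := by
  rw [normalSpace, Submodule.mem_inf, mem_tanQ, mem_orthogonal_range_dmap, and_comm]

lemma mem_normalSpace_tanQ_iff (hε : ε = 1 ∨ ε = -1) (hg : IsSmoothImmersion d g)
    (hq : ∀ x, formE ε n (g x) (g x) = ε) (x : N) (ζ : AmbE n) :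
    ζ ∈ normalSpace d (formE ε n) (tanQ ε n) g x ↔
      subProj (formE ε n) ε (coimageProj (formE ε n) (dmapL d g x)) (g x) ζ = ζ := by
  have hnd := nondegImage_dmapL_formE hε hg hq x
  have hB := formE_isSymm ε n
  rw [subProj_eq_self_iff (isFormProj_coimageProj hB hnd) (epsilon_mul_quadric hε (hq x))
    (coimageProj_quadric hε hg hq x), coimageProj_eq_self_iff hB hnd,
    mem_normalSpace_tanQ]

lemma mem_tanQ_iff (hε : ε = 1 ∨ ε = -1) {q : AmbE n} (hq : formE ε n q q = ε)
    (ζ : AmbE n) : ζ ∈ tanQ ε n q ↔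
      subProj (formE ε n) ε (ContinuousLinearMap.id ℝ _) q ζ = ζ := by
  rw [subProj_eq_self_iff IsFormProj.id (epsilon_mul_quadric hε hq) rfl, mem_tanQ]
  simp

/-- An immersion into `Q_ε^n` has flat normal bundle if and only if it has as an immersion into
`E^{n+1}`. -/
lemma hasFlatNormalBundle_tanQ_iff (hε : ε = 1 ∨ ε = -1) (hg : IsSmoothImmersion d g)
    (hq : ∀ x, formE ε n (g x) (g x) = ε) :
    HasFlatNormalBundle d (formE ε n) (tanQ ε n) g ↔
      ∀ x, FlatJet (coimageProj (formE ε n) (dmapL d g x))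
        (fun v => dmapL d (fun y => coimageProj (formE ε n) (dmapL d g y)) x v) := by
  have hB := formE_isSymm ε n
  have hnd := nondegImage_dmapL_formE hε hg hq
  rw [hasFlatNormalBundle_iff_flatJet hB (formE_nondeg hε)
    (contMDiff_subProj (contMDiff_coimageProj hg.1 hnd) hg.1)
    (isFormProj_normal_quadric hε hg hq)
    (fun x => IsFormProj.id.subProj hB (epsilon_mul_quadric hε (hq x)) rfl)
    (fun x => mem_tanQ_iff hε (hq x)) (mem_normalSpace_tanQ_iff hε hg hq)]
  refine forall_congr' fun x => ?_
  -- Here ν = g has the derivative dg, which is tangent. Thus a = 0 and the extra condition is void.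
  rw [flatJet_coimageProj_iff hB (formE_nondeg hε) hg.1 hnd hg.1 (form_dmapL_quadric hg hq)
    (fun y => epsilon_mul_quadric hε (hq y)) (x := x) (a := fun _ => 0) (e := 0) (by simp)]
  simp

/-- A normal field is parallel if and only if its derivatives are tangent. -/
lemma isParallelNormalField_iff (hε : ε = 1 ∨ ε = -1) (hg : IsSmoothImmersion d g)
    (hq : ∀ x, formE ε n (g x) (g x) = ε) {ξ : N → AmbE n} :
    IsParallelNormalField d (formE ε n) (tanQ ε n) g ξ ↔
      ContMDiff (𝓡 d) 𝓘(ℝ, AmbE n) ∞ ξ ∧ (∀ x v, formE ε n (dmapL d g x v) (ξ x) = 0) ∧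
      (∀ x, formE ε n (g x) (ξ x) = 0) ∧ ∀ x v, ∃ w, dmapL d ξ x v = dmapL d g x w := by
  have hB := formE_isSymm ε n
  have hnd := nondegImage_dmapL_formE hε hg hq
  have hcov : ∀ x (v : EuclideanSpace ℝ (Fin d)), normalCov d (formE ε n) (tanQ ε n) g ξ x v =
      subProj (formE ε n) ε (coimageProj (formE ε n) (dmapL d g x)) (g x) (dmapL d ξ x v) :=
    fun x v => normalCov_eq_proj hB (formE_nondeg hε) (isFormProj_normal_quadric hε hg hq x)
      (IsFormProj.id.subProj hB (epsilon_mul_quadric hε (hq x)) rfl)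
      (mem_tanQ_iff hε (hq x)) (mem_normalSpace_tanQ_iff hε hg hq x) _
  have hmain : ContMDiff (𝓡 d) 𝓘(ℝ, AmbE n) ∞ ξ →
      (∀ x v, formE ε n (dmapL d g x v) (ξ x) = 0) → (∀ x, formE ε n (g x) (ξ x) = 0) →
      ∀ x (v : EuclideanSpace ℝ (Fin d)), (normalCov d (formE ε n) (tanQ ε n) g ξ x v = 0 ↔
        ∃ w, dmapL d ξ x v = dmapL d g x w) := by
    intro h1 h2 h3 x v
    -- As ⟨g, dξ⟩ = -⟨dg, ξ⟩ = 0, the derivative has no component along g, so being parallel in the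
    -- quadric and in E^{n+1} agree.
    have h4 : formE ε n (g x) (dmapL d ξ x v) = 0 := by
      have := form_dmapL_of_const (hg.mdifferentiableAt x) ((h1 x).mdifferentiableAt (by simp)) h3 v
      rwa [h2, add_zero] at this
    rw [← coimageProj_eq_zero_iff (hnd x), hcov x v, subProj_apply, h4]
    simp
  constructor
  · rintro ⟨⟨h1, h2⟩, h3⟩
    have h1' := contMDiffOn_univ.1 h1
    have h2' := fun x => (mem_normalSpace_tanQ x _).1 (h2 x (mem_univ x))
    exact ⟨h1', fun x => (h2' x).1, fun x => (h2' x).2, fun x v =>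
      (hmain h1' (fun x => (h2' x).1) (fun x => (h2' x).2) x v).1 (h3 x v)⟩
  · rintro ⟨h1, h2, h3, h4⟩
    exact ⟨⟨h1.contMDiffOn, fun x _ => (mem_normalSpace_tanQ x _).2 ⟨h2 x, h3 x⟩⟩,
      fun x v => (hmain h1 h2 h3 x v).2 (h4 x v)⟩

end QuadricImmersion

/-! ### Coordinates from a local product structure -/

section ProductParametrization

variable {d : ℕ} {M : Type*} [TopologicalSpace M]
  [ChartedSpace (EuclideanSpace ℝ (Fin (d + 1))) M] [IsManifold (𝓡 (d + 1)) ∞ M]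
  {N : Type*} [TopologicalSpace N] [ChartedSpace (EuclideanSpace ℝ (Fin d)) N]
  [IsManifold (𝓡 d) ∞ N]

/-- The parametrization of `M` obtained from a diffeomorphism of `N × I` with an open subset of `M`
and a chart of `N`. -/
lemma exists_product_parametrization {I : Set ℝ} (hI : IsOpen I) {Ψ : OpenPartialHomeomorph (N × ℝ) M}
    (hΨ : Ψ.source = univ ×ˢ I)
    (h1 : ContMDiffOn ((𝓡 d).prod 𝓘(ℝ, ℝ)) (𝓡 (d + 1)) ∞ Ψ Ψ.source)
    (h2 : ContMDiffOn (𝓡 (d + 1)) ((𝓡 d).prod 𝓘(ℝ, ℝ)) ∞ Ψ.symm Ψ.target) (x₀ : N)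
    {y : EuclideanSpace ℝ (Fin d) × ℝ} (hy1 : y.1 ∈ (extChartAt (𝓡 d) x₀).target) (hy2 : y.2 ∈ I) :
    ∃ J : EuclideanSpace ℝ (Fin d) × ℝ →L[ℝ] EuclideanSpace ℝ (Fin (d + 1)), Injective J ∧
      ∀ {W : Type} [NormedAddCommGroup W] [NormedSpace ℝ W] (H : M → W),
        MDifferentiableAt (𝓡 (d + 1)) 𝓘(ℝ, W) H (Ψ ((extChartAt (𝓡 d) x₀).symm y.1, y.2)) →
        HasFDerivAt (fun y : EuclideanSpace ℝ (Fin d) × ℝ =>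
          H (Ψ ((extChartAt (𝓡 d) x₀).symm y.1, y.2)))
          ((dmapL (d + 1) H (Ψ ((extChartAt (𝓡 d) x₀).symm y.1, y.2))).comp J) y := by
  have hsrc : ((extChartAt (𝓡 d) x₀).symm y.1, y.2) ∈ Ψ.source := by rw [hΨ]; exact ⟨trivial, hy2⟩
  have c1 : ContMDiffAt 𝓘(ℝ, EuclideanSpace ℝ (Fin d) × ℝ) ((𝓡 d).prod 𝓘(ℝ, ℝ)) ∞
      (fun y : EuclideanSpace ℝ (Fin d) × ℝ => ((extChartAt (𝓡 d) x₀).symm y.1, y.2)) y :=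
    ((contMDiffAt_chart_symm hy1).comp y contDiff_fst.contMDiff.contMDiffAt).prodMk
      contDiff_snd.contMDiff.contMDiffAt
  have c2 : ContMDiffAt 𝓘(ℝ, EuclideanSpace ℝ (Fin d) × ℝ) (𝓡 (d + 1)) ∞
      (fun y : EuclideanSpace ℝ (Fin d) × ℝ => Ψ ((extChartAt (𝓡 d) x₀).symm y.1, y.2)) y :=
    (h1.contMDiffAt (Ψ.open_source.mem_nhds hsrc)).comp y c1
  obtain ⟨J, hJ⟩ : ∃ J : EuclideanSpace ℝ (Fin d) × ℝ →L[ℝ] EuclideanSpace ℝ (Fin (d + 1)),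
      J = mfderiv 𝓘(ℝ, EuclideanSpace ℝ (Fin d) × ℝ) (𝓡 (d + 1)) (fun y =>
        Ψ ((extChartAt (𝓡 d) x₀).symm y.1, y.2)) y := ⟨_, rfl⟩
  have hH : ∀ {W : Type} [NormedAddCommGroup W] [NormedSpace ℝ W] (H : M → W),
        MDifferentiableAt (𝓡 (d + 1)) 𝓘(ℝ, W) H (Ψ ((extChartAt (𝓡 d) x₀).symm y.1, y.2)) →
        HasFDerivAt (fun y : EuclideanSpace ℝ (Fin d) × ℝ =>
          H (Ψ ((extChartAt (𝓡 d) x₀).symm y.1, y.2)))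
          ((dmapL (d + 1) H (Ψ ((extChartAt (𝓡 d) x₀).symm y.1, y.2))).comp J) y := by
    intro W _ _ H hH
    rw [hJ]
    exact (hH.hasMFDerivAt.comp y (c2.mdifferentiableAt (by simp)).hasMFDerivAt).hasFDerivAt
  refine ⟨J, ?_, hH⟩
  have htgt := Ψ.map_source hsrc
  have c3 := h2.contMDiffAt (Ψ.open_target.mem_nhds htgt)
  have c4 : ContMDiffAt (𝓡 d) 𝓘(ℝ, EuclideanSpace ℝ (Fin d)) ∞ (extChartAt (𝓡 d) x₀)
      ((Ψ.symm (Ψ ((extChartAt (𝓡 d) x₀).symm y.1, y.2))).1) := by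
    rw [Ψ.left_inv hsrc]
    refine contMDiffAt_extChartAt' ?_
    simpa using (extChartAt (𝓡 d) x₀).map_target hy1
  have c5 : ContMDiffAt (𝓡 (d + 1)) 𝓘(ℝ, EuclideanSpace ℝ (Fin d) × ℝ) ∞
      (fun m => (extChartAt (𝓡 d) x₀ (Ψ.symm m).1, (Ψ.symm m).2))
      (Ψ ((extChartAt (𝓡 d) x₀).symm y.1, y.2)) :=
    (ContMDiffAt.comp (f := fun m => (Ψ.symm m).1) _ c4 c3.fst).prodMk_space c3.snd
  -- The chain rule for the inverse coordinates, which compose with the parametrization to the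
  -- identity near y, exhibits a left inverse of J.
  have h5 := hH _ (c5.mdifferentiableAt (by simp))
  have h6 := h5.unique ((hasFDerivAt_id y).congr_of_eventuallyEq (by
    filter_upwards [((isOpen_extChartAt_target x₀).prod hI).mem_nhds ⟨hy1, hy2⟩] with w hw
    have hw' : ((extChartAt (𝓡 d) x₀).symm w.1, w.2) ∈ Ψ.source := by rw [hΨ]; exact ⟨trivial, hw.2⟩
    simp only [Ψ.left_inv hw', (extChartAt (𝓡 d) x₀).right_inv hw.1, id]))
  intro a b hab
  have h7 : ∀ a, _ = a := fun a => congrArg (fun D : EuclideanSpace ℝ (Fin d) × ℝ →L[ℝ] _ => D a) h6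
  rw [← h7 a, ← h7 b, ContinuousLinearMap.comp_apply, hab, ContinuousLinearMap.comp_apply]

end ProductParametrization

/-! ### The derivative of the tube map -/

section Tube

variable {n k : ℕ} {ε : ℝ} {U : Type*} [NormedAddCommGroup U] [NormedSpace ℝ U]

lemma hasFDerivAt_tubeMap {g : U → AmbE n} {ξ : Fin k → U → AmbE n} {g' : U →L[ℝ] AmbE n}
    {ξ' : Fin k → U →L[ℝ] AmbE n} {β : ℝ → AmbER k} {β' : AmbER k} {u : U} {s : ℝ}
    (hg : HasFDerivAt g g' u) (hξ : ∀ i, HasFDerivAt (ξ i) (ξ' i) u) (hβ : HasDerivAt β β' s) :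
    ∃ D : U × ℝ →L[ℝ] AmbER n, HasFDerivAt (fun y : U × ℝ => tubeMap g ξ y.1 (β y.2)) D (u, s) ∧
      ∀ a r, D (a, r) = inclE n ((β s).1 0 • g' a + ∑ i, (β s).1 i.succ • ξ' i a) +
        r • tubeMap g ξ u β' := by
  have hβ1 : HasFDerivAt (fun y : U × ℝ => β y.2) _ (u, s) :=
    HasFDerivAt.comp (u, s) (f := Prod.snd) hβ.hasFDerivAt hasFDerivAt_snd
  have hc : ∀ i, HasFDerivAt (fun y : U × ℝ => (β y.2).1 i) _ (u, s) := fun i =>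
    ((ContinuousLinearMap.proj (R := ℝ) (φ := fun _ : Fin (k + 1) => ℝ) i).comp
      (ContinuousLinearMap.fst ℝ (AmbE k) ℝ)).hasFDerivAt.comp (u, s) hβ1
  have hc2 : HasFDerivAt (fun y : U × ℝ => (β y.2).2) _ (u, s) :=
    (ContinuousLinearMap.snd ℝ (AmbE k) ℝ).hasFDerivAt.comp (u, s) hβ1
  have hincl : ∀ (h : U → AmbE n) (h' : U →L[ℝ] AmbE n), HasFDerivAt h h' u →
      HasFDerivAt (fun y : U × ℝ => inclE n (h y.1))
        ((inclE n).comp (h'.comp (ContinuousLinearMap.fst ℝ U ℝ))) (u, s) := fun h h' hh =>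
    (inclE n).hasFDerivAt.comp (u, s) (HasFDerivAt.comp (u, s) (f := Prod.fst) hh hasFDerivAt_fst)
  refine ⟨_, (((hc 0).smul (hincl _ _ hg)).add (HasFDerivAt.fun_sum (u := Finset.univ) fun i _ =>
    (hc (Fin.succ i)).smul (hincl _ _ (hξ i)))).add (hc2.smul_const (dt n)), fun a r => ?_⟩
  simp only [_root_.add_apply, _root_.sum_apply, _root_.smul_apply,
    ContinuousLinearMap.smulRight_apply, ContinuousLinearMap.comp_apply, map_add, map_sum, map_smul,
    tubeMap, smul_add, Finset.smul_sum, Finset.sum_add_distrib]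
  simp [inclE_apply, smul_smul]
  have h : ∀ x y : AmbE n, ((x + y, 0) : AmbER n) = (x, 0) + (y, 0) := fun x y => by simp
  rw [h]
  abel

lemma tubeMap_fst (g : U → AmbE n) (ξ : Fin k → U → AmbE n) (x : U) (y : AmbER k) :
    (tubeMap g ξ x y).1 = y.1 0 • g x + ∑ i, y.1 i.succ • ξ i x := by
  simp [tubeMap, dt, Prod.fst_sum]

lemma tubeMap_snd (g : U → AmbE n) (ξ : Fin k → U → AmbE n) (x : U) (y : AmbER k) :
    (tubeMap g ξ x y).2 = y.2 := by
  simp [tubeMap, dt, Prod.snd_sum]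

end Tube

/-! ### Partial tubes have flat normal bundle: (iii) implies (i) -/

section PartialTube

variable {n : ℕ} {ε : ℝ} {d : ℕ} {M : Type*} [TopologicalSpace M]
  [ChartedSpace (EuclideanSpace ℝ (Fin (d + 1))) M] [IsManifold (𝓡 (d + 1)) ∞ M] {F : M → AmbER n}

lemma hasDerivAt_of_contDiffOn {E : Type*} [NormedAddCommGroup E] [NormedSpace ℝ E] {α : ℝ → E}
    {I : Set ℝ} (hI : IsOpen I) (hα : ContDiffOn ℝ ∞ α I) {s : ℝ} (hs : s ∈ I) :
    HasDerivAt α (deriv α s) s ∧ HasDerivAt (deriv α) (deriv (deriv α) s) s :=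
  ⟨((hα.contDiffAt (hI.mem_nhds hs)).differentiableAt (by simp)).hasDerivAt,
    ((((hα.deriv_of_isOpen hI (m := ∞) (by simp)).contDiffAt (hI.mem_nhds hs)).differentiableAt
      (by simp))).hasDerivAt⟩

/-- A partial tube over an immersion with flat normal bundle has flat normal bundle, and is nowhere
orthogonal to `∂/∂t`. -/
theorem IsLocallyFlatPartialTube.flatJet (hε : ε = 1 ∨ ε = -1) (hF : IsSmoothImmersion (d + 1) F)
    (hq : ∀ x, formE ε n (F x).1 (F x).1 = ε) (h : IsLocallyFlatPartialTube d ε F) (p : M) :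
    (∃ v, formER ε n (dmapL (d + 1) F p v) (dt n) ≠ 0) ∧
    FlatJet (coimageProj (formER ε n) (dmapL (d + 1) F p))
      (fun v => dmapL (d + 1) (fun y => coimageProj (formER ε n) (dmapL (d + 1) F y)) p v) := by
  obtain ⟨N, tN, cN, mN, I, Ψ, g, k, ξ, α, hI, -, hsrc, hp, hΨ1, hΨ2, hgq, hg, hgflat, hξ, hξo, hα,
    -, -, hα2, hform⟩ := h p
  have hBE := formE_isSymm ε n
  have hB := formER_isSymm ε n
  have hgq' : ∀ x, formE ε n (g x) (g x) = ε := fun x => (hgq x).1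
  have hgnd := nondegImage_dmapL_formE hε hg hgq'
  have hFnd := nondegImage_dmapL_formER hε hF hq
  have hξ' := fun i => (isParallelNormalField_iff hε hg hgq').1 (hξ i)
  obtain ⟨⟨x₀, s₀⟩, hm⟩ : ∃ m, m = Ψ.symm p := ⟨_, rfl⟩
  have hs₀ : s₀ ∈ I := by
    have := Ψ.map_target hp
    rw [← hm, hsrc] at this
    exact this.2
  have hΨp : Ψ (x₀, s₀) = p := by rw [hm, Ψ.right_inv hp]
  have hu₀ := mem_extChartAt_target (I := 𝓡 d) x₀
  have hσ₀ : (extChartAt (𝓡 d) x₀).symm (extChartAt (𝓡 d) x₀ x₀) = x₀ := extChartAt_to_inv x₀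
  set σ := (extChartAt (𝓡 d) x₀).symm with hσ
  set u₀ := extChartAt (𝓡 d) x₀ x₀ with hu₀'
  set S : Set (EuclideanSpace ℝ (Fin d) × ℝ) := (extChartAt (𝓡 d) x₀).target ×ˢ I with hS
  have hSo : IsOpen S := (isOpen_extChartAt_target x₀).prod hI
  have hyS : (u₀, s₀) ∈ S := ⟨hu₀, hs₀⟩
  -- the derivatives of `g` and of the normal fields in the chart
  let g' : EuclideanSpace ℝ (Fin d) → EuclideanSpace ℝ (Fin d) →L[ℝ] AmbE n := fun u =>
    (dmapL d g (σ u)).comp (chartJac x₀ u)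
  have hg' : ∀ u ∈ (extChartAt (𝓡 d) x₀).target, HasFDerivAt (g ∘ σ) (g' u) u := fun u hu =>
    hasFDerivAt_comp_chart_symm hu (hg.mdifferentiableAt _)
  let ξ' : EuclideanSpace ℝ (Fin d) → Fin k → EuclideanSpace ℝ (Fin d) →L[ℝ] AmbE n := fun u i =>
    (dmapL d (ξ i) (σ u)).comp (chartJac x₀ u)
  have hξd : ∀ u ∈ (extChartAt (𝓡 d) x₀).target, ∀ i, HasFDerivAt (ξ i ∘ σ) (ξ' u i) u :=
    fun u hu i => hasFDerivAt_comp_chart_symm hu (((hξ' i).1 _).mdifferentiableAt (by simp))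
  -- Parallel normal fields have derivatives tangent to g, so each combination with fixed
  -- coefficients moves only in directions tangent to g.
  have hrange : ∀ u ∈ (extChartAt (𝓡 d) x₀).target, ∀ (y : AmbE k) a, ∃ b,
      y 0 • g' u a + ∑ i, y i.succ • ξ' u i a = g' u b := by
    intro u hu y a
    obtain ⟨e, he⟩ := chartJac_isInvertible hu
    have h1 : ∀ i, ∃ b, ξ' u i a = g' u b := fun i => by
      obtain ⟨w, hw⟩ := (hξ' i).2.2.2 (σ u) (chartJac x₀ u a)
      refine ⟨e.symm w, hw.trans ?_⟩
      show _ = dmapL d g (σ u) (chartJac x₀ u (e.symm w))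
      rw [← he]; simp
    choose b hb using h1
    exact ⟨y 0 • a + ∑ i, y i.succ • b i, by simp [hb]⟩
  let z : EuclideanSpace ℝ (Fin d) × ℝ → AmbER n := fun y =>
    tubeMap (g ∘ σ) (fun i => ξ i ∘ σ) y.1 (deriv α y.2)
  -- the derivative of the parametrized immersion
  have hG : ∀ y ∈ S, ∃ D : EuclideanSpace ℝ (Fin d) × ℝ →L[ℝ] AmbER n,
      HasFDerivAt (fun y : EuclideanSpace ℝ (Fin d) × ℝ => F (Ψ (σ y.1, y.2))) D y ∧
      (∀ a, ∃ b, D (a, 0) = inclE n (g' y.1 b)) ∧ D (0, 1) = z y := by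
    rintro ⟨u, s⟩ ⟨hu, hs⟩
    obtain ⟨D, hD, hDv⟩ := hasFDerivAt_tubeMap (hg' u hu) (hξd u hu)
      (hasDerivAt_of_contDiffOn hI hα hs).1
    refine ⟨D, hD.congr_of_eventuallyEq ?_, fun a => ?_, ?_⟩
    · filter_upwards [hSo.mem_nhds ⟨hu, hs⟩] with y hy
      exact hform (σ y.1) y.2 hy.2
    · obtain ⟨b, hb⟩ := hrange u hu (α s).1 a
      exact ⟨b, by rw [hDv, hb, zero_smul, add_zero]⟩
    · rw [hDv]; simp [z]
  -- The s-derivative is a combination of g, the ξ_i and ∂/∂t, all orthogonal to the image of dg.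
  have hz : ∀ y ∈ S, ∀ b, formER ε n (inclE n (g' y.1 b)) (z y) = 0 := by
    intro y hy b
    have h1 := form_dmapL_quadric hg hgq' (σ y.1) (chartJac x₀ y.1 b)
    have h2 : ∀ i, formE ε n (g' y.1 b) (ξ i (σ y.1)) = 0 := fun i => (hξ' i).2.1 _ _
    rw [formER_inclE, tubeMap_fst]
    simp only [map_add, map_sum, map_smul, comp_apply, h2]
    simp [g', h1]
  have hJ := fun y (hy : y ∈ S) => exists_product_parametrization hI hsrc hΨ1 hΨ2 x₀ hy.1 hy.2
  let Pg : N → AmbE n →L[ℝ] AmbE n := fun x => coimageProj (formE ε n) (dmapL d g x)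
  have hg'nd : ∀ y ∈ S, NondegImage (formE ε n) (g' y.1) := fun y hy =>
    nondegImage_comp (hgnd _) (chartJac_isInvertible hy.1)
  have hQ : ∀ y ∈ S, coimageProj (formER ε n) ((inclE n).comp (g' y.1)) = liftEnd n (Pg (σ y.1)) :=
    fun y hy => by
      rw [coimageProj_inclE (hg'nd y hy),
        coimageProj_comp_invertible (hgnd _) (chartJac_isInvertible hy.1)]
  -- The normal space of F is the complement of z = ∂F/∂s in the normal space of g enlarged by ∂/∂t.
  -- Positivity of the induced metric and injectivity of J give ⟨z,z⟩ ≠ 0.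
  have hsplit : ∀ y ∈ S, formER ε n (z y) (z y) ≠ 0 ∧
      coimageProj (formER ε n) (dmapL (d + 1) F (Ψ (σ y.1, y.2))) =
        subProj (formER ε n) (formER ε n (z y) (z y))⁻¹ (liftEnd n (Pg (σ y.1))) (z y) := by
    intro y hy
    obtain ⟨J, hJi, hJH⟩ := hJ y hy
    obtain ⟨D, hD, hD0, hD1⟩ := hG y hy
    have hDJ := hD.unique (hJH F (hF.mdifferentiableAt _))
    obtain ⟨hnd, heq⟩ := coimageProj_comp_injective (hFnd (Ψ (σ y.1, y.2))) hJi (by simp)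
    rw [← hDJ] at hnd heq
    have hz0 : formER ε n (z y) (z y) ≠ 0 := by
      rw [← hD1, hDJ]
      intro h0
      have h1 := (formER_dmapL_pos hε hF hq _ _).2 h0
      have h2 := hJi (h1.trans (map_zero J).symm)
      simpa using congrArg Prod.snd h2
    refine ⟨hz0, ?_⟩
    rw [← heq, coimageProj_prod_eq hB hnd (nondegImage_inclE (hg'nd y hy)) hD0
      (fun b => by rw [hD1]; exact hz y hy b) (by rw [hD1]; exact inv_mul_cancel₀ hz0), hD1, hQ y hy]
  obtain ⟨J, hJi, hJH⟩ := hJ _ hyS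
  have hsurj : Surjective J :=
    (LinearMap.injective_iff_surjective_of_finrank_eq_finrank (f := (J :
      EuclideanSpace ℝ (Fin d) × ℝ →ₗ[ℝ] EuclideanSpace ℝ (Fin (d + 1)))) (by simp)).1 hJi
  obtain ⟨D, hD, hD0, hD1⟩ := hG _ hyS
  have hDJ := hD.unique (hJH F (hF.mdifferentiableAt _))
  have hχ₀ : Ψ (σ u₀, s₀) = p := by rw [hσ₀, hΨp]
  rw [← hχ₀]
  refine ⟨⟨J (0, 1), ?_⟩, ?_⟩
  · have h1 : dmapL (d + 1) F (Ψ (σ u₀, s₀)) (J (0, 1)) = z (u₀, s₀) := by rw [← hD1, hDJ]; rfl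
    rw [h1, formER_dt, tubeMap_snd]
    have h2 := (ContinuousLinearMap.snd ℝ (AmbE k) ℝ).hasFDerivAt.comp_hasDerivAt s₀
      (hasDerivAt_of_contDiffOn hI hα hs₀).1
    have h3 := hα2 s₀ hs₀
    have h4 : deriv (fun r => (α r).2) s₀ = (deriv α s₀).2 := h2.deriv
    rwa [h4] at h3
  · have hPs := contMDiff_coimageProj hF.1 hFnd
    have hP := hJH _ ((hPs _).mdifferentiableAt (by simp))
    have hPgs := contMDiff_coimageProj hg.1 hgnd
    have hPgd : HasFDerivAt (fun y : EuclideanSpace ℝ (Fin d) × ℝ => Pg (σ y.1))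
        ((dmapL d Pg x₀).comp (ContinuousLinearMap.fst ℝ _ ℝ)) (u₀, s₀) :=
      HasFDerivAt.comp (u₀, s₀) (f := Prod.fst)
        (hasFDerivAt_comp_chart_symm_self ((hPgs x₀).mdifferentiableAt (by simp))) hasFDerivAt_fst
    obtain ⟨Q', hQd, hQv⟩ := hasFDerivAt_liftEnd hPgd
    obtain ⟨z', hzd, hzv⟩ := hasFDerivAt_tubeMap (hg' u₀ hu₀) (hξd u₀ hu₀)
      (hasDerivAt_of_contDiffOn hI hα hs₀).2
    obtain ⟨Dz, hDz, -⟩ := hasFDerivAt_form (formER ε n) hzd hzd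
    have hQform : ∀ y ∈ S, IsFormProj (formER ε n) (liftEnd n (Pg (σ y.1))) := fun y hy => by
      rw [← hQ y hy]
      exact isFormProj_coimageProj hB (nondegImage_inclE (hg'nd y hy))
    have hQself : ∀ y ∈ S, ∀ ζ, liftEnd n (Pg (σ y.1)) ζ = ζ ↔
        ∀ b, formER ε n (inclE n (g' y.1 b)) ζ = 0 := fun y hy ζ => by
      rw [← hQ y hy]
      exact coimageProj_eq_self_iff hB (nondegImage_inclE (hg'nd y hy)) ζ
    have hQz : ∀ y ∈ S, liftEnd n (Pg (σ y.1)) (z y) = z y := fun y hy =>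
      (hQself y hy _).2 (hz y hy)
    have hSn := hSo.mem_nhds hyS
    have hc := inv_mul_cancel₀ (hsplit _ hyS).1
    have hPjet := isProjJet_of_hasFDerivAt (B := formER ε n) hP
      (Filter.Eventually.of_forall fun y => (isFormProj_coimageProj hB (hFnd _)).idem)
      (Filter.Eventually.of_forall fun y => (isFormProj_coimageProj hB (hFnd _)).symm)
    have hQjet := isProjJet_of_hasFDerivAt (B := formER ε n) hQd
      (Filter.mem_of_superset hSn fun y hy => (hQform y hy).idem)
      (Filter.mem_of_superset hSn fun y hy => (hQform y hy).symm)
    have hPζ : ∀ ζ, coimageProj (formER ε n) (dmapL (d + 1) F (Ψ (σ u₀, s₀))) ζ = ζ ↔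
        liftEnd n (Pg (σ u₀)) ζ = ζ ∧ formER ε n (z (u₀, s₀)) ζ = 0 := fun ζ => by
      rw [(hsplit _ hyS).2, subProj_eq_self_iff (hQform _ hyS) hc (hQz _ hyS)]
    refine FlatJet.of_comp (φ := J) ?_ hsurj
    have hcd : DifferentiableAt ℝ (fun y => (formER ε n (z y) (z y))⁻¹) (u₀, s₀) :=
      hDz.differentiableAt.inv (hsplit _ hyS).1
    have hPd := fun ζ (hζ : formER ε n (z (u₀, s₀)) ζ = 0) => deriv_subProj_apply (z := z)
      (c := fun y => (formER ε n (z y) (z y))⁻¹) hP hQd hzd hcd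
      (Filter.mem_of_superset hSn fun y hy => (hsplit y hy).2) hζ
    -- The x-derivatives of z are tangent to g and vanish against ζ, so only the covector ds
    -- remains, with factor given by the second derivative of α.
    refine flatJet_subProj (ρ := fun v => v.2)
      (formER_nondeg hε) hPjet hQjet (hQz _ hyS) hc hPζ hPd (fun ζ hζ => ?_) ?_
    · refine ⟨formER ε n (tubeMap (g ∘ σ) (fun i => ξ i ∘ σ) u₀ (deriv (deriv α) s₀)) ζ, ?_⟩
      rintro ⟨a, r⟩
      obtain ⟨b, hb⟩ := hrange u₀ hu₀ (deriv α s₀).1 a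
      have h2 : formER ε n (inclE n (g' u₀ b)) ζ = 0 :=
        (hQself (u₀, s₀) hyS ζ).1 ((hPζ ζ).1 hζ).1 b
      rw [hzv, hb, map_add, LinearMap.add_apply, h2, map_smul, LinearMap.smul_apply, smul_eq_mul,
        zero_add]
    · have h3 : FlatJet (Pg (σ u₀)) (fun v => dmapL d Pg x₀ v) := by
        rw [hσ₀]
        exact (hasFlatNormalBundle_tanQ_iff hε hg hgq').1 hgflat x₀
      exact (flatJet_liftEnd (dP := fun v : EuclideanSpace ℝ (Fin d) × ℝ => dmapL d Pg x₀ v.1)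
        (fun v p => hQv v p)).2 (h3.comp Prod.fst)

end PartialTube

/-! ### The hull: the normal space enlarged by a fixed vector -/

section HullProjection

variable {V W : Type*} [NormedAddCommGroup V] [NormedSpace ℝ V] [FiniteDimensional ℝ V]
  [NormedAddCommGroup W] [NormedSpace ℝ W] [FiniteDimensional ℝ W] {B : LinearMap.BilinForm ℝ W}

/-- The projection onto the span of `t` and the orthogonal complement of the image of `L`. -/
noncomputable def hullProj (B : LinearMap.BilinForm ℝ W) (L : V →L[ℝ] W) (t : W) : W →L[ℝ] W :=
  subProj B (-(B (imageProj B L t) (imageProj B L t))⁻¹) (coimageProj B L) (imageProj B L t)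

variable {L : V →L[ℝ] W} {t : W}

/-- The negative constant in `hullProj` makes `subProj` add a line instead of removing one. Adding t
to the normal space is the same as adding its tangential part. -/
lemma hullProj_apply (ζ : W) : hullProj B L t ζ = coimageProj B L ζ +
    ((B (imageProj B L t) (imageProj B L t))⁻¹ * B (imageProj B L t) ζ) • imageProj B L t := by
  rw [hullProj, subProj_apply, neg_mul, neg_smul, sub_neg_eq_add]

lemma coimageProj_imageProj (hL : NondegImage B L) (x : W) :
    coimageProj B L (imageProj B L x) = 0 := by
  obtain ⟨v, hv⟩ := imageProj_mem B L x
  rw [hv, coimageProj_image hL]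

lemma form_imageProj_coimageProj (hB : B.IsSymm) (hL : NondegImage B L) (x y : W) :
    B (imageProj B L x) (coimageProj B L y) = 0 := by
  rw [← (isFormProj_coimageProj hB hL).symm, coimageProj_imageProj hL, map_zero,
    LinearMap.zero_apply]

lemma form_imageProj_self (hB : B.IsSymm) (hL : NondegImage B L) (x : W) :
    B (imageProj B L x) x = B (imageProj B L x) (imageProj B L x) := by
  have h := form_imageProj_coimageProj hB hL x x
  rw [coimageProj_apply, map_sub, sub_eq_zero] at h
  exact h

lemma form_image_imageProj (hB : B.IsSymm) (hL : NondegImage B L) (v : V) (x : W) :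
    B (L v) (imageProj B L x) = B (L v) x := by
  rw [hB.eq, form_imageProj hL, hB.eq]

lemma isFormProj_hullProj (hB : B.IsSymm) (hL : NondegImage B L)
    (ht : B (imageProj B L t) (imageProj B L t) ≠ 0) : IsFormProj B (hullProj B L t) := by
  have h := isFormProj_coimageProj hB hL
  have h0 := coimageProj_imageProj hL t
  constructor
  · intro x
    rw [hullProj_apply, hullProj_apply, map_add, map_smul, h.idem, h0, map_add, map_smul,
      form_imageProj_coimageProj hB hL]
    simp only [zero_add, smul_eq_mul, smul_zero, add_zero, mul_right_comm _ _
      (B (imageProj B L t) (imageProj B L t)), inv_mul_cancel₀ ht, one_mul]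
  · intro x y
    rw [hullProj_apply, hullProj_apply]
    simp only [map_add, map_smul, LinearMap.add_apply, LinearMap.smul_apply, h.symm, smul_eq_mul]
    have h1 : B x (imageProj B L t) = B (imageProj B L t) x := hB.eq _ _
    rw [h1]; ring

lemma hullProj_self (hB : B.IsSymm) (hL : NondegImage B L)
    (ht : B (imageProj B L t) (imageProj B L t) ≠ 0) : hullProj B L t t = t := by
  rw [hullProj_apply, form_imageProj_self hB hL, inv_mul_cancel₀ ht, one_smul, coimageProj_apply,
    sub_add_cancel]

lemma hullProj_imageProj (hL : NondegImage B L)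
    (ht : B (imageProj B L t) (imageProj B L t) ≠ 0) :
    hullProj B L t (imageProj B L t) = imageProj B L t := by
  rw [hullProj_apply, inv_mul_cancel₀ ht, one_smul, coimageProj_imageProj hL, zero_add]

/-- The normal space is in turn the complement of the tangential part of t in the hull. With this
section as z, `flatJet_of_subProj` applies. -/
lemma coimageProj_eq_subProj_hullProj :
    coimageProj B L = subProj B (B (imageProj B L t) (imageProj B L t))⁻¹ (hullProj B L t)
      (imageProj B L t) := by
  ext1 x
  rw [subProj_apply, hullProj_apply, add_sub_cancel_right]

lemma coimageProj_eq_self_iff_hullProj (hB : B.IsSymm) (hL : NondegImage B L)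
    (ht : B (imageProj B L t) (imageProj B L t) ≠ 0) (ζ : W) :
    coimageProj B L ζ = ζ ↔ hullProj B L t ζ = ζ ∧ B (imageProj B L t) ζ = 0 := by
  rw [← subProj_eq_self_iff (isFormProj_hullProj hB hL ht) (inv_mul_cancel₀ ht)
    (hullProj_imageProj hL ht), ← coimageProj_eq_subProj_hullProj]

lemma hullProj_image (hB : B.IsSymm) (hL : NondegImage B L) (v : V) :
    hullProj B L t (L v) =
      ((B (imageProj B L t) (imageProj B L t))⁻¹ * B (L v) t) • imageProj B L t := by
  rw [hullProj_apply, coimageProj_image hL, zero_add, hB.eq (imageProj B L t) (L v),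
    form_image_imageProj hB hL]

/-- The hull contains t and all normal vectors, so its complement consists of the tangent vectors
orthogonal to t. For t = ∂/∂t these are the directions of constant height. -/
lemma hullProj_eq_zero_iff (hB : B.IsSymm) (hL : NondegImage B L)
    (ht : B (imageProj B L t) (imageProj B L t) ≠ 0) (x : W) :
    hullProj B L t x = 0 ↔ ∃ v, x = L v ∧ B (L v) t = 0 := by
  constructor
  · intro h
    have h1 : B x t = 0 := by
      rw [← hullProj_self hB hL ht, ← (isFormProj_hullProj hB hL ht).symm, h, map_zero,
        LinearMap.zero_apply]
    have h2 : B (imageProj B L t) x = 0 := by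
      rw [← hullProj_imageProj hL ht, (isFormProj_hullProj hB hL ht).symm, h, map_zero]
    rw [hullProj_apply, h2, mul_zero, zero_smul, add_zero] at h
    obtain ⟨v, rfl⟩ := (coimageProj_eq_zero_iff hL x).1 h
    exact ⟨v, rfl, h1⟩
  · rintro ⟨v, rfl, hv⟩
    rw [hullProj_image hB hL, hv, mul_zero, zero_smul]

lemma contDiffAt_hullProj (hL : NondegImage B L)
    (ht : B (imageProj B L t) (imageProj B L t) ≠ 0) {n : WithTop ℕ∞} :
    ContDiffAt ℝ n (fun L : V →L[ℝ] W => hullProj B L t) L := by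
  have h1 : ContDiffAt ℝ n (fun L : V →L[ℝ] W => imageProj B L) L := contDiffAt_imageProj hL
  have h2 : ContDiffAt ℝ n (fun L : V →L[ℝ] W => imageProj B L t) L := h1.clm_apply contDiffAt_const
  have h3 : ContDiffAt ℝ n (fun L : V →L[ℝ] W =>
      LinearMap.toContinuousBilinearMap B (imageProj B L t)) L :=
    (LinearMap.toContinuousBilinearMap B).contDiff.contDiffAt.comp L h2
  have h4 : ContDiffAt ℝ n (fun L : V →L[ℝ] W => B (imageProj B L t) (imageProj B L t)) L :=
    h3.clm_apply h2
  exact (contDiffAt_const.sub h1).sub ((h4.inv ht).neg.smul (h3.smulRight h2))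

end HullProjection

/-! ### Flatness of the hull and its constancy along T -/

section HullDerivative

variable {V W : Type*} [NormedAddCommGroup V] [NormedSpace ℝ V] [FiniteDimensional ℝ V]
  [NormedAddCommGroup W] [NormedSpace ℝ W] [FiniteDimensional ℝ W] {B : LinearMap.BilinForm ℝ W}
  {L : V → V →L[ℝ] W} {H : V →L[ℝ] V →L[ℝ] W} {t : W} {u : V} {P' Q' : V →L[ℝ] W →L[ℝ] W}

lemma isProjJet_coimageProj (hB : B.IsSymm) (hL : ∀ᶠ y in nhds u, NondegImage B (L y))
    (hP : HasFDerivAt (fun y => coimageProj B (L y)) P' u) :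
    IsProjJet B (coimageProj B (L u)) (fun v => P' v) :=
  isProjJet_of_hasFDerivAt hP (hL.mono fun _ h => (isFormProj_coimageProj hB h).idem)
    (hL.mono fun _ h => (isFormProj_coimageProj hB h).symm)

lemma isProjJet_hullProj (hB : B.IsSymm) (hL : ∀ᶠ y in nhds u, NondegImage B (L y))
    (ht : ∀ᶠ y in nhds u, B (imageProj B (L y) t) (imageProj B (L y) t) ≠ 0)
    (hQ : HasFDerivAt (fun y => hullProj B (L y) t) Q' u) :
    IsProjJet B (hullProj B (L u) t) (fun v => Q' v) :=
  isProjJet_of_hasFDerivAt hQ ((hL.and ht).mono fun _ h => (isFormProj_hullProj hB h.1 h.2).idem)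
    ((hL.and ht).mono fun _ h => (isFormProj_hullProj hB h.1 h.2).symm)

lemma deriv_hullProj_self (hB : B.IsSymm) (hL : ∀ᶠ y in nhds u, NondegImage B (L y))
    (ht : ∀ᶠ y in nhds u, B (imageProj B (L y) t) (imageProj B (L y) t) ≠ 0)
    (hQ : HasFDerivAt (fun y => hullProj B (L y) t) Q' u) (v : V) : Q' v t = 0 := by
  have h1 := (hQ.clm_apply (hasFDerivAt_const t u)).unique
    ((hasFDerivAt_const t u).congr_of_eventuallyEq
      ((hL.and ht).mono fun _ h => hullProj_self hB h.1 h.2))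
  have h2 := congrArg (fun D : V →L[ℝ] W => D v) h1
  simpa using h2

lemma hasFDerivAt_imageProj_apply (hP : HasFDerivAt (fun y => coimageProj B (L y)) P' u) (x : W) :
    HasFDerivAt (fun y => imageProj B (L y) x) (-(P'.flip x)) u := by
  have h := (hasFDerivAt_const x u).sub (hP.clm_apply (hasFDerivAt_const x u))
  refine (h.congr_of_eventuallyEq (Filter.Eventually.of_forall fun y => ?_)).congr_fderiv ?_
  · show imageProj B (L y) x = x - coimageProj B (L y) x
    rw [coimageProj_apply, sub_sub_cancel]
  · ext v
    simp

lemma deriv_coimageProj_apply_of_hullProj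
    (ht : B (imageProj B (L u) t) (imageProj B (L u) t) ≠ 0)
    (hP : HasFDerivAt (fun y => coimageProj B (L y)) P' u)
    (hQ : HasFDerivAt (fun y => hullProj B (L y) t) Q' u) {ζ : W}
    (hζ : B (imageProj B (L u) t) ζ = 0) (v : V) :
    P' v ζ = Q' v ζ - ((B (imageProj B (L u) t) (imageProj B (L u) t))⁻¹ *
      B ((-(P'.flip t)) v) ζ) • imageProj B (L u) t := by
  have hz := hasFDerivAt_imageProj_apply hP t
  obtain ⟨D, hD, -⟩ := hasFDerivAt_form B hz hz
  exact deriv_subProj_apply (c := fun y => (B (imageProj B (L y) t) (imageProj B (L y) t))⁻¹)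
    hP hQ hz (hD.differentiableAt.inv ht)
    (Filter.Eventually.of_forall fun y => coimageProj_eq_subProj_hullProj) hζ v

/-- Flatness of the bundle spanned by `t` and the orthogonal complement of the image of `L`. -/
lemma flatJet_hullProj (hB : B.IsSymm) (hnd : ∀ x, (∀ y, B x y = 0) → x = 0)
    (hL : ∀ᶠ y in nhds u, NondegImage B (L y))
    (ht : ∀ᶠ y in nhds u, B (imageProj B (L y) t) (imageProj B (L y) t) ≠ 0)
    (hP : HasFDerivAt (fun y => coimageProj B (L y)) P' u)
    (hQ : HasFDerivAt (fun y => hullProj B (L y) t) Q' u)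
    (hρ : ∀ ζ, coimageProj B (L u) ζ = ζ → ∃ r, ∀ v, B (P' v ζ) t = B (L u v) t * r)
    (h : FlatJet (coimageProj B (L u)) (fun v => P' v)) :
    FlatJet (hullProj B (L u) t) (fun v => Q' v) := by
  have hL₀ := hL.self_of_nhds
  have ht₀ := ht.self_of_nhds
  have hPj := isProjJet_coimageProj hB hL hP
  refine flatJet_of_subProj hnd hPj (isProjJet_hullProj hB hL ht hQ)
    (hullProj_imageProj hL₀ ht₀) (inv_mul_cancel₀ ht₀)
    (coimageProj_eq_self_iff_hullProj hB hL₀ ht₀)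
    (fun ζ hζ v => deriv_coimageProj_apply_of_hullProj ht₀ hP hQ hζ v)
    (ρ := fun v => B (L u v) t) (fun ζ hζ => ?_) (hullProj_self hB hL₀ ht₀)
    (deriv_hullProj_self hB hL ht hQ) (by rwa [form_imageProj_self hB hL₀]) h
  obtain ⟨r, hr⟩ := hρ ζ hζ
  -- The tangential part of t is t - Pt with derivative -P'(v)t; symmetry of P' then turns the
  -- hypothesis into the required form with opposite sign.
  refine ⟨-r, fun v => ?_⟩
  have h1 := hr v
  rw [hPj.dsymm, hB.eq] at h1
  simp [h1]

/-- Sections of the hull do not change in the direction of the tangential part of `t`. -/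
lemma deriv_hullProj_tangent (hB : B.IsSymm)
    (hL : ∀ᶠ y in nhds u, NondegImage B (L y))
    (ht : ∀ᶠ y in nhds u, B (imageProj B (L y) t) (imageProj B (L y) t) ≠ 0)
    (hP : HasFDerivAt (fun y => coimageProj B (L y)) P' u)
    (hQ : HasFDerivAt (fun y => hullProj B (L y) t) Q' u)
    (hH : HasFDerivAt L H u) (hHs : ∀ v w, H v w = H w v)
    (hpos : ∀ v, B (L u v) (L u v) = 0 → v = 0)
    (hρ : ∀ ζ, coimageProj B (L u) ζ = ζ → ∃ r, ∀ v, B (P' v ζ) t = B (L u v) t * r) {T : V}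
    (hT : L u T = imageProj B (L u) t) {ζ : W} (hζ : hullProj B (L u) t ζ = ζ) : Q' T ζ = 0 := by
  have hL₀ := hL.self_of_nhds
  have ht₀ := ht.self_of_nhds
  have hPj := isProjJet_coimageProj hB hL hP
  have hQj := isProjJet_hullProj hB hL ht hQ
  have hsymm : ∀ ζ, coimageProj B (L u) ζ = ζ → ∀ v w, B (P' v ζ) (L u w) = B (P' w ζ) (L u v) := by
    have h0 : ∀ᶠ y in nhds u, ∀ v, coimageProj B (L y) (L y v) = 0 :=
      hL.mono fun _ h v => coimageProj_image h v
    intro ζ _ v w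
    rw [hPj.dsymm, hPj.dsymm, deriv_proj_tangent hP hH h0, deriv_proj_tangent hP hH h0, hHs]
  -- For normal ζ the vector Q'(T)ζ is tangent and orthogonal to t, say L w. It pairs with L w as
  -- P'(T)ζ does, that is, as P'(w)ζ with t. By `hρ` this is a multiple of ⟨L w, t⟩ = 0, hence ⟨L w,
  -- L w⟩ = 0 and w = 0.
  have main : ∀ ζ, coimageProj B (L u) ζ = ζ → Q' T ζ = 0 := by
    intro ζ hζ
    obtain ⟨hζ1, hζ2⟩ := (coimageProj_eq_self_iff_hullProj hB hL₀ ht₀ ζ).1 hζ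
    obtain ⟨w, hw, hw0⟩ := (hullProj_eq_zero_iff hB hL₀ ht₀ _).1 (hQj.proj_deriv hζ1 T)
    obtain ⟨r, hr⟩ := hρ ζ hζ
    have h1 := deriv_coimageProj_apply_of_hullProj ht₀ hP hQ hζ2 T
    have h2 : B (P' T ζ) (L u w) = 0 := by
      rw [hsymm ζ hζ, hT]
      have h3 : B (P' w ζ) (coimageProj B (L u) t) = 0 :=
        hPj.form_eq_zero (hPj.proj_deriv hζ w) (hPj.idem t)
      rw [coimageProj_apply, map_sub, hr, hw0, zero_mul, zero_sub, neg_eq_zero] at h3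
      exact h3
    have h4 : B (imageProj B (L u) t) (L u w) = 0 := by
      rw [hB.eq, form_image_imageProj hB hL₀, hw0]
    rw [h1, hw] at h2
    simp only [map_sub, map_smul, LinearMap.sub_apply, LinearMap.smul_apply, h4, smul_zero,
      sub_zero] at h2
    rw [hw, hpos w h2, map_zero]
  have h1 : B (imageProj B (L u) t) t ≠ 0 := by rwa [form_imageProj_self hB hL₀]
  -- A vector of the hull becomes normal after subtraction of a multiple of t, on which Q' vanishes.
  have h2 := main (ζ - (B (imageProj B (L u) t) ζ / B (imageProj B (L u) t) t) • t)
    ((coimageProj_eq_self_iff_hullProj hB hL₀ ht₀ _).2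
      ⟨by rw [map_sub, map_smul, hζ, hullProj_self hB hL₀ ht₀],
        by rw [map_sub, map_smul, smul_eq_mul, div_mul_cancel₀ _ h1, sub_self]⟩)
  rwa [map_sub, map_smul, deriv_hullProj_self hB hL ht hQ, smul_zero, sub_zero] at h2

end HullDerivative

/-! ### Orthonormal bases of positive definite subspaces -/

section OrthonormalFrames

variable {W : Type*} [AddCommGroup W] [Module ℝ W] [FiniteDimensional ℝ W]

lemma exists_orthonormal_frame {B : LinearMap.BilinForm ℝ W} (hB : B.IsSymm) (K : Submodule ℝ W)
    (hK : ∀ x ∈ K, 0 ≤ B x x ∧ (B x x = 0 → x = 0)) :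
    ∃ (k : ℕ) (e : Fin k → W), (∀ i, e i ∈ K) ∧ (∀ i j, B (e i) (e j) = if i = j then 1 else 0) ∧
      ∀ ζ ∈ K, (∀ i, B (e i) ζ = 0) → ζ = 0 := by
  have hBK : LinearMap.IsSymm (B.restrict K) := ⟨fun x y => hB.eq x y⟩
  obtain ⟨b, hb⟩ := LinearMap.BilinForm.exists_orthogonal_basis hBK
  have hpos : ∀ i, 0 < B (b i) (b i) := fun i => by
    refine lt_of_le_of_ne (hK _ (b i).2).1 fun h => b.ne_zero i ?_
    exact Subtype.ext ((hK _ (b i).2).2 h.symm)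
  have hort : ∀ i j, i ≠ j → B (b i) (b j) = 0 := fun i j hij => hb hij
  have hs : ∀ i, (√(B (b i) (b i)))⁻¹ ≠ 0 := fun i => inv_ne_zero (Real.sqrt_pos.2 (hpos i)).ne'
  refine ⟨_, fun i => (√(B (b i) (b i)))⁻¹ • (b i : W), fun i => K.smul_mem _ (b i).2,
    fun i j => ?_, fun ζ hζ h => ?_⟩
  · simp only [map_smul, LinearMap.smul_apply, smul_eq_mul]
    split_ifs with hij
    · subst hij
      have := Real.mul_self_sqrt (hpos i).le
      have h2 := (Real.sqrt_pos.2 (hpos i)).ne'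
      field_simp
      rw [sq, this]
    · rw [hort i j hij, mul_zero, mul_zero]
  · have h1 : ∀ i, B (b i) ζ = 0 := fun i => by
      have := h i
      simp only [map_smul, LinearMap.smul_apply, smul_eq_mul, mul_eq_zero] at this
      exact this.resolve_left (hs i)
    refine (hK ζ hζ).2 ?_
    have h2 : ζ = ∑ i, b.repr ⟨ζ, hζ⟩ i • (b i : W) := by
      have := congrArg (Submodule.subtype K) (b.sum_repr ⟨ζ, hζ⟩)
      rw [map_sum] at this
      simpa using this.symm
    have h3 : B (∑ i, b.repr ⟨ζ, hζ⟩ i • (b i : W)) ζ = 0 := by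
      simp [h1]
    rwa [← h2] at h3

end OrthonormalFrames

/-! ### The covector condition that follows from flatness -/

section CovectorCondition

variable {n : ℕ} {ε : ℝ} {d : ℕ} {M : Type*} [TopologicalSpace M]
  [ChartedSpace (EuclideanSpace ℝ (Fin d)) M] [IsManifold (𝓡 d) ∞ M] {F : M → AmbER n}

/-- If the normal bundle is flat, the derivatives of `∂/∂t` in the normal bundle are all
proportional to the same covector. -/
lemma exists_form_deriv_coimageProj_dt (hε : ε = 1 ∨ ε = -1) (hF : IsSmoothImmersion d F)
    (hq : ∀ x, formE ε n (F x).1 (F x).1 = ε) {x : M}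
    (hflat : FlatJet (coimageProj (formER ε n) (dmapL d F x))
        (fun v => dmapL d (fun y => coimageProj (formER ε n) (dmapL d F y)) x v))
    (hv : ∃ v, formER ε n (dmapL d F x v) (dt n) ≠ 0) {ζ : AmbER n}
    (hζ : coimageProj (formER ε n) (dmapL d F x) ζ = ζ) :
    ∃ r, ∀ v, formER ε n (dmapL d (fun y => coimageProj (formER ε n) (dmapL d F y)) x v ζ) (dt n) =
      formER ε n (dmapL d F x v) (dt n) * r := by
  have hB := formER_isSymm ε n
  have hnd := nondegImage_dmapL_formER hε hF hq
  have hPs := contMDiff_coimageProj hF.1 hnd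
  have hPν : ∀ x, coimageProj (formER ε n) (dmapL d F x) (horizL n (F x)) = horizL n (F x) :=
    fun x => (coimageProj_eq_self_iff hB (hnd x) _).2 (form_dmapL_horizL hF hq x)
  have hform := isFormProj_coimageProj hB (hnd x)
  obtain ⟨v₀, hv₀⟩ := hv
  set ν := horizL n (F x) with hν
  have hc : ε * formER ε n ν ν = 1 := epsilon_mul_horizL hε (hq x)
  have hζ₀ := (hform.subProj hB hc (hPν x)).idem ζ
  set ζ₀ := subProj (formER ε n) ε (coimageProj (formER ε n) (dmapL d F x)) ν ζ with hζ₀'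
  -- For the part ζ₀ normal in Q × ℝ, the Ricci condition against v₀, with ⟨F_*v₀, ∂/∂t⟩ ≠ 0, gives
  -- the proportionality. The part along ν is computed directly from dP(v)ν = dν - P dν.
  have hdec : ζ = ζ₀ + (ε * formER ε n ν ζ) • ν := by rw [hζ₀', subProj_apply, hζ, sub_add_cancel]
  have h1 := fun v => ((flatJet_coimageProj_formER_iff hε hF hq x).1 hflat).2 v v₀ ζ₀ hζ₀
  obtain ⟨-, h2⟩ := mdifferentiableAt_clm_apply ((hPs x).mdifferentiableAt (by simp))
      ((contMDiff_horizL hF x).mdifferentiableAt (by simp))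
  simp only [hPν] at h2
  set a := fun v => formER ε n (dmapL d F x v) (dt n) with ha
  have h3 : ∀ v, formER ε n (dmapL d (fun y => coimageProj (formER ε n) (dmapL d F y)) x v ν)
      (dt n) = a v * formER ε n (coimageProj (formER ε n) (dmapL d F x) (dt n)) (dt n) := by
    intro v
    have h4 := eq_sub_of_add_eq (h2 v).symm
    rw [← hν] at h4
    have h5 : formER ε n (dt n) (dt n) = 1 := by rw [formER_dt]; rfl
    rw [h4, dmapL_horizL (ε := ε) hF, map_sub (coimageProj _ _), map_smul, coimageProj_image (hnd x)]
    simp only [map_sub, map_smul, LinearMap.sub_apply, LinearMap.smul_apply, map_zero,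
      LinearMap.zero_apply, smul_eq_mul, h5, ha]
    ring
  refine ⟨formER ε n (dmapL d (fun y => coimageProj (formER ε n) (dmapL d F y)) x v₀ ζ₀) (dt n) /
      a v₀ + (ε * formER ε n ν ζ) *
      formER ε n (coimageProj (formER ε n) (dmapL d F x) (dt n)) (dt n), fun v => ?_⟩
  have h6 := h1 v
  conv_lhs => rw [hdec, map_add, map_smul, map_add, LinearMap.add_apply, map_smul,
    LinearMap.smul_apply, h3, smul_eq_mul]
  rw [mul_add, mul_div_assoc', h6, mul_div_cancel_left₀ _ hv₀]
  ring

end CovectorCondition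

/-! ### Flat immersions in a coordinate chart -/

section FlatCharts

variable {n : ℕ} {ε : ℝ} {V : Type*} [NormedAddCommGroup V] [NormedSpace ℝ V]
  [FiniteDimensional ℝ V]

/-- A parametrized immersion into `Q_ε^n × ℝ ⊆ E^{n+2}`, nowhere orthogonal to `∂/∂t`, with flat
normal bundle in `E^{n+2}`. -/
structure IsFlatParametrization (ε : ℝ) (F : V → AmbER n) (O : Set V) : Prop where
  isOpen : IsOpen O
  contDiffOn : ContDiffOn ℝ ∞ F O
  quadric : ∀ u ∈ O, (F u).1 ∈ quadric ε n
  perp : ∀ u ∈ O, ∀ v, formER ε n (fderiv ℝ F u v) (horizL n (F u)) = 0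
  pos : ∀ u ∈ O, ∀ v, formER ε n (fderiv ℝ F u v) (fderiv ℝ F u v) = 0 → v = 0
  vert : ∀ u ∈ O, ∃ v, formER ε n (fderiv ℝ F u v) (dt n) ≠ 0
  flat : ∀ u ∈ O, FlatJet (coimageProj (formER ε n) (fderiv ℝ F u))
    (fun v => fderiv ℝ (fun y => coimageProj (formER ε n) (fderiv ℝ F y)) u v)
  covector : ∀ u ∈ O, ∀ ζ, coimageProj (formER ε n) (fderiv ℝ F u) ζ = ζ → ∃ r, ∀ v,
    formER ε n (fderiv ℝ (fun y => coimageProj (formER ε n) (fderiv ℝ F y)) u v ζ) (dt n) =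
      formER ε n (fderiv ℝ F u v) (dt n) * r

lemma isFlatParametrization_chart {d : ℕ} {M : Type*} [TopologicalSpace M]
    [ChartedSpace (EuclideanSpace ℝ (Fin d)) M] [IsManifold (𝓡 d) ∞ M] {F : M → AmbER n}
    (hε : ε = 1 ∨ ε = -1) (hF : IsSmoothImmersion d F) (hq : ∀ x, (F x).1 ∈ quadric ε n)
    (hflat : ∀ x, FlatJet (coimageProj (formER ε n) (dmapL d F x))
        (fun v => dmapL d (fun y => coimageProj (formER ε n) (dmapL d F y)) x v))
    (hv : ∀ x, ∃ v, formER ε n (dmapL d F x v) (dt n) ≠ 0) (p : M) :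
    IsFlatParametrization ε (F ∘ (extChartAt (𝓡 d) p).symm) (extChartAt (𝓡 d) p).target := by
  have hq' := fun x => (hq x).1
  have hnd := nondegImage_dmapL_formER hε hF hq'
  have hPs := contMDiff_coimageProj hF.1 hnd
  have hfd : ∀ u ∈ (extChartAt (𝓡 d) p).target, fderiv ℝ (F ∘ (extChartAt (𝓡 d) p).symm) u =
      (dmapL d F ((extChartAt (𝓡 d) p).symm u)).comp (chartJac p u) := fun u hu =>
    (hasFDerivAt_comp_chart_symm hu (hF.mdifferentiableAt _)).fderiv
  have hPd : ∀ u ∈ (extChartAt (𝓡 d) p).target,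
      fderiv ℝ (fun y => coimageProj (formER ε n)
        (fderiv ℝ (F ∘ (extChartAt (𝓡 d) p).symm) y)) u =
      (dmapL d (fun y => coimageProj (formER ε n) (dmapL d F y))
        ((extChartAt (𝓡 d) p).symm u)).comp (chartJac p u) := fun u hu => by
    have h := hasFDerivAt_comp_chart_symm hu ((hPs _).mdifferentiableAt (by simp))
    refine (h.congr_of_eventuallyEq ?_).fderiv
    filter_upwards [(isOpen_extChartAt_target p).mem_nhds hu] with y hy
    exact (coimageProj_chart hF.1 hnd hy).2.symm
  refine ⟨isOpen_extChartAt_target p, fun u hu =>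
    (contDiffAt_comp_chart_symm hu (hF.1 _)).contDiffWithinAt, fun u _ => hq _, fun u hu v => ?_,
    fun u hu v hv0 => ?_, fun u hu => ?_, fun u hu => ?_, fun u hu ζ hζ => ?_⟩
  · rw [hfd u hu]
    exact form_dmapL_horizL hF hq' _ _
  · rw [hfd u hu] at hv0
    have h1 := (formER_dmapL_pos hε hF hq' _ _).2 hv0
    obtain ⟨e, he⟩ := chartJac_isInvertible hu
    rw [← he] at h1
    exact (e.map_eq_zero_iff).1 h1
  · obtain ⟨v, hv⟩ := hv ((extChartAt (𝓡 d) p).symm u)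
    obtain ⟨e, he⟩ := chartJac_isInvertible hu
    refine ⟨e.symm v, ?_⟩
    rw [hfd u hu, ← he]
    simpa using hv
  · rw [← (coimageProj_chart hF.1 hnd hu).2, hPd u hu]
    exact (hflat _).comp (chartJac p u)
  · rw [← (coimageProj_chart hF.1 hnd hu).2] at hζ
    obtain ⟨r, hr⟩ := exists_form_deriv_coimageProj_dt hε hF hq' (hflat _) (hv _) hζ
    refine ⟨r, fun v => ?_⟩
    rw [hPd u hu, hfd u hu]
    exact hr _

end FlatCharts

/-! ### Parallel frames of the hull -/

section HullOfParametrization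

variable {n : ℕ} {ε : ℝ} {V : Type*} [NormedAddCommGroup V] [NormedSpace ℝ V]
  [FiniteDimensional ℝ V]

/-- The projection onto the sum of the normal space of `F` and the line spanned by `∂/∂t`. -/
noncomputable def hullE (ε : ℝ) (F : V → AmbER n) (u : V) : AmbER n →L[ℝ] AmbER n :=
  hullProj (formER ε n) (fderiv ℝ F u) (dt n)

/-- The section `ζ` of the bundle of images of `hullE ε F` is parallel on `O`. -/
def IsHullParallelOn (ε : ℝ) (F : V → AmbER n) (O : Set V) (ζ : V → AmbER n) : Prop :=
  ∀ u ∈ O, hullE ε F u (ζ u) = ζ u ∧ HasFDerivAt ζ ((fderiv ℝ (hullE ε F) u).flip (ζ u)) u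

namespace IsFlatParametrization

variable {F : V → AmbER n} {O : Set V} {u : V}

lemma nondegImage (h : IsFlatParametrization ε F O) (hu : u ∈ O) :
    NondegImage (formER ε n) (fderiv ℝ F u) := nondegImage_of_pos (h.pos u hu)

lemma form_imageProj_ne (h : IsFlatParametrization ε F O) (hu : u ∈ O) :
    formER ε n (imageProj (formER ε n) (fderiv ℝ F u) (dt n))
      (imageProj (formER ε n) (fderiv ℝ F u) (dt n)) ≠ 0 := by
  intro h0
  obtain ⟨w, hw⟩ := imageProj_mem (formER ε n) (fderiv ℝ F u) (dt n)
  obtain ⟨v, hv⟩ := h.vert u hu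
  have h1 : w = 0 := h.pos u hu w (by rw [← hw]; exact h0)
  apply hv
  rw [← form_image_imageProj (formER_isSymm ε n) (h.nondegImage hu), hw, h1, map_zero, map_zero]

lemma contDiffAt_fderiv (h : IsFlatParametrization ε F O) (hu : u ∈ O) :
    ContDiffAt ℝ ∞ (fderiv ℝ F) u :=
  (h.contDiffOn.contDiffAt (h.isOpen.mem_nhds hu)).fderiv_right (by simp)

lemma hasFDerivAt (h : IsFlatParametrization ε F O) (hu : u ∈ O) :
    HasFDerivAt F (fderiv ℝ F u) u :=
  ((h.contDiffOn.contDiffAt (h.isOpen.mem_nhds hu)).differentiableAt (by simp)).hasFDerivAt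

lemma contDiffAt_hullE (h : IsFlatParametrization ε F O) (hu : u ∈ O) :
    ContDiffAt ℝ ∞ (hullE ε F) u :=
  (contDiffAt_hullProj (h.nondegImage hu) (h.form_imageProj_ne hu)).comp u (h.contDiffAt_fderiv hu)

lemma hasFDerivAt_hullE (h : IsFlatParametrization ε F O) (hu : u ∈ O) :
    HasFDerivAt (hullE ε F) (fderiv ℝ (hullE ε F) u) u :=
  ((h.contDiffAt_hullE hu).differentiableAt (by simp)).hasFDerivAt

lemma hasFDerivAt_coimageProj (h : IsFlatParametrization ε F O) (hu : u ∈ O) :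
    HasFDerivAt (fun y => coimageProj (formER ε n) (fderiv ℝ F y))
      (fderiv ℝ (fun y => coimageProj (formER ε n) (fderiv ℝ F y)) u) u := by
  have h1 : ContDiffAt ℝ ∞ (fun y => imageProj (formER ε n) (fderiv ℝ F y)) u :=
    (contDiffAt_imageProj (h.nondegImage hu)).comp u (h.contDiffAt_fderiv hu)
  exact ((contDiffAt_const.sub h1).differentiableAt (by simp)).hasFDerivAt

lemma isFormProj_hullE (h : IsFlatParametrization ε F O) (hu : u ∈ O) :
    IsFormProj (formER ε n) (hullE ε F u) :=
  isFormProj_hullProj (formER_isSymm ε n) (h.nondegImage hu) (h.form_imageProj_ne hu)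

lemma eventually_nondegImage (h : IsFlatParametrization ε F O) (hu : u ∈ O) :
    ∀ᶠ y in nhds u, NondegImage (formER ε n) (fderiv ℝ F y) :=
  Filter.mem_of_superset (h.isOpen.mem_nhds hu) fun _ hy => h.nondegImage hy

lemma eventually_form_imageProj_ne (h : IsFlatParametrization ε F O) (hu : u ∈ O) :
    ∀ᶠ y in nhds u, formER ε n (imageProj (formER ε n) (fderiv ℝ F y) (dt n))
      (imageProj (formER ε n) (fderiv ℝ F y) (dt n)) ≠ 0 :=
  Filter.mem_of_superset (h.isOpen.mem_nhds hu) fun _ hy => h.form_imageProj_ne hy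

lemma isProjJet_hullE (h : IsFlatParametrization ε F O) (hu : u ∈ O) :
    IsProjJet (formER ε n) (hullE ε F u) (fun v => fderiv ℝ (hullE ε F) u v) :=
  isProjJet_hullProj (formER_isSymm ε n) (h.eventually_nondegImage hu)
    (h.eventually_form_imageProj_ne hu) (h.hasFDerivAt_hullE hu)

lemma flatJet_hullE (hε : ε = 1 ∨ ε = -1) (h : IsFlatParametrization ε F O) (hu : u ∈ O) :
    FlatJet (hullE ε F u) (fun v => fderiv ℝ (hullE ε F) u v) :=
  flatJet_hullProj (formER_isSymm ε n) (formER_nondeg hε) (h.eventually_nondegImage hu)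
    (h.eventually_form_imageProj_ne hu) (h.hasFDerivAt_coimageProj hu) (h.hasFDerivAt_hullE hu)
    (h.covector u hu) (h.flat u hu)

lemma deriv_hullE_tangent (h : IsFlatParametrization ε F O) (hu : u ∈ O) {T : V}
    (hT : fderiv ℝ F u T = imageProj (formER ε n) (fderiv ℝ F u) (dt n)) {ζ : AmbER n}
    (hζ : hullE ε F u ζ = ζ) : fderiv ℝ (hullE ε F) u T ζ = 0 := by
  have h1 := h.contDiffOn.contDiffAt (h.isOpen.mem_nhds hu)
  refine deriv_hullProj_tangent (formER_isSymm ε n) (h.eventually_nondegImage hu)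
    (h.eventually_form_imageProj_ne hu) (h.hasFDerivAt_coimageProj hu) (h.hasFDerivAt_hullE hu)
    ((h.contDiffAt_fderiv hu).differentiableAt (by simp)).hasFDerivAt ?_ (h.pos u hu)
    (h.covector u hu) hT hζ
  exact (h1.isSymmSndFDerivAt (by
    rw [minSmoothness_of_isRCLikeNormedField]; exact ENat.LEInfty.out)).eq

lemma hullE_dt (h : IsFlatParametrization ε F O) (hu : u ∈ O) : hullE ε F u (dt n) = dt n :=
  hullProj_self (formER_isSymm ε n) (h.nondegImage hu) (h.form_imageProj_ne hu)

lemma deriv_hullE_dt (h : IsFlatParametrization ε F O) (hu : u ∈ O) (v : V) :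
    fderiv ℝ (hullE ε F) u v (dt n) = 0 :=
  deriv_hullProj_self (formER_isSymm ε n) (h.eventually_nondegImage hu)
    (h.eventually_form_imageProj_ne hu) (h.hasFDerivAt_hullE hu) v

lemma hullE_eq_zero_iff (h : IsFlatParametrization ε F O) (hu : u ∈ O) (x : AmbER n) :
    hullE ε F u x = 0 ↔ ∃ v, x = fderiv ℝ F u v ∧ formER ε n (fderiv ℝ F u v) (dt n) = 0 :=
  hullProj_eq_zero_iff (formER_isSymm ε n) (h.nondegImage hu) (h.form_imageProj_ne hu) x

lemma hullE_horizL (h : IsFlatParametrization ε F O) (hu : u ∈ O) :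
    hullE ε F u (horizL n (F u)) = horizL n (F u) := by
  have hB := formER_isSymm ε n
  have hP : coimageProj (formER ε n) (fderiv ℝ F u) (horizL n (F u)) = horizL n (F u) :=
    (coimageProj_eq_self_iff hB (h.nondegImage hu) _).2 (h.perp u hu)
  exact ((coimageProj_eq_self_iff_hullProj hB (h.nondegImage hu) (h.form_imageProj_ne hu) _).1 hP).1

lemma hasFDerivAt_horizL (h : IsFlatParametrization ε F O) (hu : u ∈ O) :
    HasFDerivAt (fun y => horizL n (F y)) ((horizL n).comp (fderiv ℝ F u)) u :=
  (horizL n).hasFDerivAt.comp u (h.hasFDerivAt hu)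

lemma form_eq_zero_of_hullE (h : IsFlatParametrization ε F O) (hu : u ∈ O) {x ζ : AmbER n}
    (hx : hullE ε F u x = 0) (hζ : hullE ε F u ζ = ζ) : formER ε n x ζ = 0 := by
  rw [← hζ, ← (h.isFormProj_hullE hu).symm, hx, map_zero, LinearMap.zero_apply]

lemma hullE_deriv_parallel (h : IsFlatParametrization ε F O) {ζ : V → AmbER n} {O' : Set V}
    (hO' : O' ⊆ O) (hζ : IsHullParallelOn ε F O' ζ) (hu : u ∈ O') (v : V) :
    hullE ε F u (fderiv ℝ ζ u v) = 0 := by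
  rw [(hζ u hu).2.fderiv]
  exact (h.isProjJet_hullE (hO' hu)).proj_deriv (hζ u hu).1 v

/-- Derivatives of parallel sections lie in the kernel of the hull projection, which is orthogonal
to the hull. -/
lemma form_parallel_const (h : IsFlatParametrization ε F O) {ζ ζ' : V → AmbER n} {u₀ : V} {r : ℝ}
    (hr : Metric.ball u₀ r ⊆ O) (hζ : IsHullParallelOn ε F (Metric.ball u₀ r) ζ)
    (hζ' : IsHullParallelOn ε F (Metric.ball u₀ r) ζ') (hu : u ∈ Metric.ball u₀ r) :
    formER ε n (ζ u) (ζ' u) = formER ε n (ζ u₀) (ζ' u₀) := by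
  have hD : ∀ y ∈ Metric.ball u₀ r, HasFDerivAt (fun y => formER ε n (ζ y) (ζ' y))
      (0 : V →L[ℝ] ℝ) y := by
    intro y hy
    obtain ⟨D, hD, hDv⟩ := hasFDerivAt_form (formER ε n) (hζ y hy).2 (hζ' y hy).2
    refine hD.congr_fderiv (ContinuousLinearMap.ext fun v => ?_)
    have h1 := h.hullE_deriv_parallel hr hζ hy v
    have h2 := h.hullE_deriv_parallel hr hζ' hy v
    rw [(hζ y hy).2.fderiv] at h1
    rw [(hζ' y hy).2.fderiv] at h2
    rw [hDv, h.form_eq_zero_of_hullE (hr hy) h1 (hζ' y hy).1, (formER_isSymm ε n).eq (ζ y),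
      h.form_eq_zero_of_hullE (hr hy) h2 (hζ y hy).1]
    simp
  have hr0 : 0 < r := Metric.pos_of_mem_ball hu
  exact Metric.isOpen_ball.is_const_of_fderiv_eq_zero (𝕜 := ℝ) (convex_ball u₀ r).isPreconnected
    (fun y hy => (hD y hy).differentiableAt.differentiableWithinAt) (fun y hy => (hD y hy).fderiv)
    hu (Metric.mem_ball_self hr0)

lemma isHullParallelOn_dt (h : IsFlatParametrization ε F O) {O' : Set V} (hO' : O' ⊆ O) :
    IsHullParallelOn ε F O' (fun _ => dt n) := fun _ hu =>
  ⟨h.hullE_dt (hO' hu), (hasFDerivAt_const _ _).congr_fderiv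
    (ContinuousLinearMap.ext fun v => (h.deriv_hullE_dt (hO' hu) v).symm)⟩

/-- Parallel sections with given values at a point. -/
lemma exists_parallel (hε : ε = 1 ∨ ε = -1) (h : IsFlatParametrization ε F O) (hu : u ∈ O) :
    ∃ r > 0, Metric.ball u r ⊆ O ∧ ∀ ζ₀, hullE ε F u ζ₀ = ζ₀ →
      ∃ ζ, ζ u = ζ₀ ∧ IsHullParallelOn ε F (Metric.ball u r) ζ :=
  exists_parallel_section h.isOpen hu (fun _ hy => (h.contDiffAt_hullE hy).contDiffWithinAt)
    (fun _ hy => (h.isFormProj_hullE hy).idem) fun _ hy v w _ hζ =>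
      (h.isProjJet_hullE hy).comm_of_flatJet (h.flatJet_hullE hε hy) hζ v w

/-- A parallel frame of the sum of the normal bundle and the line spanned by `∂/∂t`, that is
adapted to the position vector at `u₀`. -/
theorem exists_frame (hε : ε = 1 ∨ ε = -1) (h : IsFlatParametrization ε F O) {u₀ : V}
    (hu₀ : u₀ ∈ O) : ∃ (O' : Set V) (k : ℕ) (e : Fin (k + 1) → V → AmbER n), IsOpen O' ∧ O' ⊆ O ∧
      u₀ ∈ O' ∧ (∀ j, IsHullParallelOn ε F O' (e j)) ∧ (∀ j, ∀ u ∈ O', (e j u).2 = 0) ∧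
      (∀ u ∈ O', ∀ i j, formER ε n (e i u) (e j u) =
        if i = j then (Fin.cons ε (fun _ => 1) : Fin (k + 1) → ℝ) i else 0) ∧
      e 0 u₀ = horizL n (F u₀) ∧ ∀ u ∈ O', horizL n (F u) =
        ∑ j, ((Fin.cons ε (fun _ => 1) : Fin (k + 1) → ℝ) j *
          formER ε n (e j u) (horizL n (F u))) • e j u := by
  have hB := formER_isSymm ε n
  have hε2 := epsilon_mul_self hε
  set ν := fun u => horizL n (F u) with hν
  have hνν : ∀ u ∈ O, formER ε n (ν u) (ν u) = ε := fun u hu =>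
    (formER_horizL_self _).trans (h.quadric u hu).1
  have hνt : ∀ u, formER ε n (ν u) (dt n) = 0 := fun u => by rw [formER_dt]; rfl
  have htt : formER ε n (dt n) (dt n) = 1 := by rw [formER_dt]; rfl
  -- an orthonormal basis at `u₀`
  let K : Submodule ℝ (AmbER n) :=
    LinearMap.eqLocus (hullE ε F u₀ : AmbER n →ₗ[ℝ] AmbER n) LinearMap.id ⊓
      (LinearMap.ker (formER ε n (ν u₀)) ⊓ LinearMap.ker (formER ε n (dt n)))
  have hKmem : ∀ ζ, ζ ∈ K ↔ hullE ε F u₀ ζ = ζ ∧ formER ε n (ν u₀) ζ = 0 ∧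
      formER ε n (dt n) ζ = 0 := fun ζ => Iff.rfl
  -- The subspace K is orthogonal to ν, hence tangent to Q × ℝ, where the form is positive definite
  -- also for ε = -1.
  obtain ⟨k, e₁, he₁K, he₁o, he₁s⟩ := exists_orthonormal_frame hB K fun x hx =>
    formER_tangent_pos hε (h.quadric u₀ hu₀).1 ((hKmem x).1 hx).2.1
  let c : Fin (k + 1) → ℝ := Fin.cons ε (fun _ => 1)
  have hc : ∀ j, c j * c j = 1 := Fin.cases hε2 fun j => one_mul 1
  let e₀ : Fin (k + 1) → AmbER n := Fin.cons (ν u₀) e₁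
  have he₀Q : ∀ j, hullE ε F u₀ (e₀ j) = e₀ j :=
    Fin.cases (h.hullE_horizL hu₀) fun j => ((hKmem _).1 (he₁K j)).1
  have he₀t : ∀ j, formER ε n (e₀ j) (dt n) = 0 := Fin.cases (hνt u₀) fun j =>
    (hB.eq _ _).trans ((hKmem _).1 (he₁K j)).2.2
  have he₀o : ∀ i j, formER ε n (e₀ i) (e₀ j) = if i = j then c i else 0 := by
    refine Fin.cases (Fin.cases ?_ fun j => ?_) fun i => Fin.cases ?_ fun j => ?_
    · simpa [e₀, c] using hνν u₀ hu₀
    · simpa [e₀, (Fin.succ_ne_zero j).symm] using ((hKmem _).1 (he₁K j)).2.1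
    · simpa [e₀] using (hB.eq _ _).trans ((hKmem _).1 (he₁K i)).2.1
    · simpa [e₀, c] using he₁o i j
  have he₀s : ∀ ζ, hullE ε F u₀ ζ = ζ → formER ε n (dt n) ζ = 0 →
      (∀ j, formER ε n (e₀ j) ζ = 0) → ζ = 0 := fun ζ h1 h2 h3 =>
    he₁s ζ ((hKmem ζ).2 ⟨h1, h3 0, h2⟩) fun i => h3 i.succ
  obtain ⟨r, hr0, hrO, hpar⟩ := h.exists_parallel hε hu₀
  choose e he0 hepar using fun j => hpar (e₀ j) (he₀Q j)
  have hmem₀ : u₀ ∈ Metric.ball u₀ r := Metric.mem_ball_self hr0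
  have heo : ∀ u ∈ Metric.ball u₀ r, ∀ i j, formER ε n (e i u) (e j u) = if i = j then c i else 0 :=
    fun u hu i j => by
      rw [h.form_parallel_const hrO (hepar i) (hepar j) hu, he0, he0, he₀o]
  have het : ∀ u ∈ Metric.ball u₀ r, ∀ j, formER ε n (e j u) (dt n) = 0 := fun u hu j => by
    rw [h.form_parallel_const hrO (hepar j) (h.isHullParallelOn_dt hrO) hu, he0, he₀t]
  -- the projection to the complement of the frame vanishes near `u₀`
  let R : V → AmbER n →L[ℝ] AmbER n := fun u => hullE ε F u -
    (LinearMap.toContinuousBilinearMap (formER ε n) (dt n)).smulRight (dt n) -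
    ∑ j, c j • (LinearMap.toContinuousBilinearMap (formER ε n) (e j u)).smulRight (e j u)
  have hR : ∀ u x, R u x = hullE ε F u x - formER ε n (dt n) x • dt n -
      ∑ j, (c j * formER ε n (e j u) x) • e j u := fun u x => by
    simp [R, smul_smul]
  have hRprop : ∀ u ∈ Metric.ball u₀ r, ∀ x, hullE ε F u (R u x) = R u x ∧
      formER ε n (dt n) (R u x) = 0 ∧ ∀ j, formER ε n (e j u) (R u x) = 0 := by
    intro u hu x
    have hproj := h.isFormProj_hullE (hrO hu)
    have h1 : ∀ j, formER ε n (dt n) (e j u) = 0 := fun j => (hB.eq _ _).trans (het u hu j)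
    refine ⟨?_, ?_, fun i => ?_⟩
    · simp only [hR, map_sub, map_sum, map_smul, hproj.idem, h.hullE_dt (hrO hu), (hepar _ u hu).1]
    · simp only [hR, map_sub, map_sum, map_smul, ← hproj.symm, h.hullE_dt (hrO hu), htt, h1,
        smul_eq_mul, mul_zero, Finset.sum_const_zero, mul_one, sub_self]
    · simp only [hR, map_sub, map_sum, map_smul, ← hproj.symm, (hepar i u hu).1, het u hu,
        heo u hu, smul_eq_mul, mul_zero, sub_zero, mul_ite, Finset.sum_ite_eq, Finset.mem_univ,
        if_true]
      linear_combination (-formER ε n (e i u) x) * hc i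
  have hRfix : ∀ u ∈ Metric.ball u₀ r, ∀ x, R u (R u x) = R u x := by
    intro u hu x
    obtain ⟨h1, h2, h3⟩ := hRprop u hu x
    rw [hR u (R u x), h1, h2]
    simp [h3]
  have hR0 : R u₀ = 0 := by
    refine ContinuousLinearMap.ext fun x => ?_
    obtain ⟨h1, h2, h3⟩ := hRprop u₀ hmem₀ x
    exact he₀s _ h1 h2 fun j => by rw [← he0 j]; exact h3 j
  have hRc : ContinuousAt R u₀ := by
    have he : ∀ j, ContinuousAt (e j) u₀ := fun j => (hepar j u₀ hmem₀).2.continuousAt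
    have hb : ∀ j, ContinuousAt
        (fun u => LinearMap.toContinuousBilinearMap (formER ε n) (e j u)) u₀ := fun j =>
      ((LinearMap.toContinuousBilinearMap (formER ε n)).continuous.continuousAt).comp (he j)
    have hs : ∀ j, ContinuousAt (fun u => c j •
        (LinearMap.toContinuousBilinearMap (formER ε n) (e j u)).smulRight (e j u)) u₀ := fun j =>
      (((ContinuousLinearMap.smulRightL ℝ (AmbER n) (AmbER n)).continuous₂.continuousAt).comp
        ((hb j).prodMk (he j))).const_smul (c j)
    exact ((h.contDiffAt_hullE hu₀).continuousAt.sub continuousAt_const).sub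
      (tendsto_finsetSum _ fun j _ => hs j)
  -- An idempotent of norm less than 1 is zero. As R is continuous at u₀ and vanishes there, the
  -- frame and ∂/∂t still span the hull near u₀.
  have hRn : ∀ᶠ u in nhds u₀, ‖R u‖ < 1 := by
    have h1 : ‖R u₀‖ < 1 := by rw [hR0, norm_zero]; exact one_pos
    exact hRc.norm.preimage_mem_nhds (Iio_mem_nhds h1)
  obtain ⟨O', hO'n, hO'o, hO'm⟩ := eventually_nhds_iff.1
    (hRn.and (Metric.isOpen_ball.mem_nhds hmem₀))
  have hRz : ∀ u ∈ O', ∀ x, R u x = 0 := by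
    intro u hu x
    have h1 := (R u).le_opNorm (R u x)
    rw [hRfix u (hO'n u hu).2] at h1
    have h2 := (hO'n u hu).1
    by_contra h3
    have h4 : 0 < ‖R u x‖ := norm_pos_iff.2 h3
    nlinarith
  refine ⟨O', k, e, hO'o, fun u hu => hrO (hO'n u hu).2, hO'm,
    fun j u hu => hepar j u (hO'n u hu).2, fun j u hu => ?_, fun u hu => heo u (hO'n u hu).2,
    he0 0, fun u hu => ?_⟩
  · rw [← formER_dt (ε := ε)]
    exact het u (hO'n u hu).2 j
  · have h1 := hRz u hu (ν u)
    rw [hR, h.hullE_horizL (hrO (hO'n u hu).2), (hB.eq (dt n) (ν u)).trans (hνt u), zero_smul,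
      sub_zero, sub_eq_zero] at h1
    exact h1

end IsFlatParametrization

end HullOfParametrization

/-! ### Local inverses and auxiliary projections -/

section LocalInverse

variable {V E : Type*} [NormedAddCommGroup V] [NormedSpace ℝ V] [FiniteDimensional ℝ V]
  [NormedAddCommGroup E] [NormedSpace ℝ E] [FiniteDimensional ℝ E]

/-- The inverse function theorem, with the source restricted to points of injective derivative (an
open condition), so that the inverse is smooth on the whole target. -/
lemma exists_smooth_local_inverse (hfin : Module.finrank ℝ V = Module.finrank ℝ E) {Ω : V → E}
    {O : Set V} (hO : IsOpen O) (hΩ : ContDiffOn ℝ ∞ Ω O) {u₀ : V} (hu₀ : u₀ ∈ O)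
    (hinj : Injective (fderiv ℝ Ω u₀)) :
    ∃ Φ : OpenPartialHomeomorph V E, u₀ ∈ Φ.source ∧ Φ.source ⊆ O ∧ (∀ u, Φ u = Ω u) ∧
      ContDiffOn ℝ ∞ Φ.symm Φ.target ∧ ∀ u ∈ Φ.source, Injective (fderiv ℝ Ω u) := by
  have : CompleteSpace V := FiniteDimensional.complete ℝ V
  have hequiv : ∀ L : V →L[ℝ] E, Injective L → ∃ e : V ≃L[ℝ] E, (e : V →L[ℝ] E) = L := fun L hL =>
    ⟨(LinearEquiv.ofInjectiveOfFinrankEq (L : V →ₗ[ℝ] E) hL hfin).toContinuousLinearEquiv, by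
      ext v; rfl⟩
  have hat : ∀ u ∈ O, ContDiffAt ℝ ∞ Ω u := fun u hu => hΩ.contDiffAt (hO.mem_nhds hu)
  have hd : ∀ u ∈ O, HasFDerivAt Ω (fderiv ℝ Ω u) u := fun u hu =>
    ((hat u hu).differentiableAt (by simp)).hasFDerivAt
  obtain ⟨e, he⟩ := hequiv _ hinj
  have hd₀ : HasFDerivAt Ω (e : V →L[ℝ] E) u₀ := he ▸ hd u₀ hu₀
  let Φ₀ := (hat u₀ hu₀).toOpenPartialHomeomorph Ω hd₀ (by simp)
  have hc : ContinuousAt (fderiv ℝ Ω) u₀ := ((hat u₀ hu₀).fderiv_right (m := ∞) (by simp)).continuousAt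
  have hev' : ∀ᶠ u in nhds u₀, Injective (fderiv ℝ Ω u) :=
    hc.preimage_mem_nhds (ContinuousLinearMap.isOpen_injective.mem_nhds hinj)
  have hev : ∀ᶠ u in nhds u₀, Injective (fderiv ℝ Ω u) ∧ u ∈ O := hev'.and (hO.mem_nhds hu₀)
  obtain ⟨S, hS, hSo, huS⟩ := eventually_nhds_iff.1 hev
  let Φ := Φ₀.restrOpen S hSo
  have hsrc : ∀ u ∈ Φ.source, u ∈ S := fun u hu => hu.2
  have hcoe : ∀ u, Φ u = Ω u := fun u => rfl
  refine ⟨Φ, ⟨(hat u₀ hu₀).mem_toOpenPartialHomeomorph_source hd₀ (by simp), huS⟩,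
    fun u hu => (hS u (hsrc u hu)).2, hcoe, fun z hz => ?_, fun u hu => (hS u (hsrc u hu)).1⟩
  have hz' := hS _ (hsrc _ (Φ.map_target hz))
  obtain ⟨e', he'⟩ := hequiv _ hz'.1
  exact (Φ.contDiffAt_symm hz (f₀' := e') (he' ▸ hd _ hz'.2) (hat _ hz'.2)).contDiffWithinAt

/-- A linear map that is injective on the kernel of a nonzero functional can be followed by a
projection to a space of the dimension of this kernel, so that injectivity is preserved. -/
lemma exists_projection_injective {W : Type*} [NormedAddCommGroup W] [NormedSpace ℝ W]
    [FiniteDimensional ℝ W] (hfin : Module.finrank ℝ V = Module.finrank ℝ E + 1) (A : V →ₗ[ℝ] W)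
    {a : V →ₗ[ℝ] ℝ} (ha : a ≠ 0) (hA : ∀ v, A v = 0 → a v = 0 → v = 0) :
    ∃ p : W →L[ℝ] E, ∀ v, p (A v) = 0 → a v = 0 → v = 0 := by
  have hk : Module.finrank ℝ (LinearMap.ker a) = Module.finrank ℝ E := by
    have := Module.Dual.finrank_ker_add_one_of_ne_zero (f := a) ha
    omega
  let ι := LinearEquiv.ofFinrankEq _ _ hk
  have hinj : LinearMap.ker (A.comp (LinearMap.ker a).subtype) = ⊥ := by
    rw [LinearMap.ker_eq_bot']
    intro v hv
    exact Subtype.ext (hA v hv v.2)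
  obtain ⟨l, hl⟩ := LinearMap.exists_leftInverse_of_injective _ hinj
  refine ⟨LinearMap.toContinuousLinearMap (ι.toLinearMap.comp l), fun v hv hav => ?_⟩
  have h1 : l (A v) = ⟨v, hav⟩ := congrArg (fun D => D ⟨v, hav⟩) hl
  have h2 : ι ⟨v, hav⟩ = 0 := by rw [← h1]; exact hv
  exact congrArg Subtype.val (ι.map_eq_zero_iff.1 h2)

end LocalInverse

/-! ### Derivatives of parallel sections and of the coefficients of ν -/

section FrameDerivatives

variable {n : ℕ} {ε : ℝ} {V : Type*} [NormedAddCommGroup V] [NormedSpace ℝ V]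
  [FiniteDimensional ℝ V] {F : V → AmbER n} {O : Set V} {u : V}

namespace IsFlatParametrization

lemma horizL_fderiv_of_form_eq_zero {u : V} {v : V}
    (hv : formER ε n (fderiv ℝ F u v) (dt n) = 0) : horizL n (fderiv ℝ F u v) = fderiv ℝ F u v := by
  rw [horizL_eq_sub (ε := ε), hv, zero_smul, sub_zero]

/-- Differentiate Qν = ν, with Q the hull projection: for v orthogonal to ∂/∂t, dν(v) = F_*v lies in
the kernel of Q, so only dQ(v)ν remains. This makes the parallel section through ν immersive along
level sets of the height at the base point. -/
lemma deriv_hullE_horizL (h : IsFlatParametrization ε F O) (hu : u ∈ O) {v : V}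
    (hv : formER ε n (fderiv ℝ F u v) (dt n) = 0) :
    fderiv ℝ (hullE ε F) u v (horizL n (F u)) = fderiv ℝ F u v := by
  have h1 := ((h.hasFDerivAt_hullE hu).clm_apply (h.hasFDerivAt_horizL hu)).unique
    ((h.hasFDerivAt_horizL hu).congr_of_eventuallyEq
      (Filter.mem_of_superset (h.isOpen.mem_nhds hu) fun y hy => h.hullE_horizL hy))
  have h2 := congrArg (fun D : V →L[ℝ] AmbER n => D v) h1
  have h3 : hullE ε F u (fderiv ℝ F u v) = 0 := (h.hullE_eq_zero_iff hu _).2 ⟨v, rfl, hv⟩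
  simpa [horizL_fderiv_of_form_eq_zero hv, h3] using h2

lemma exists_tangent (h : IsFlatParametrization ε F O) (hu : u ∈ O) :
    ∃ T, fderiv ℝ F u T = imageProj (formER ε n) (fderiv ℝ F u) (dt n) ∧
      formER ε n (fderiv ℝ F u T) (dt n) ≠ 0 := by
  obtain ⟨T, hT⟩ := imageProj_mem (formER ε n) (fderiv ℝ F u) (dt n)
  refine ⟨T, hT.symm, ?_⟩
  rw [← hT, form_imageProj_self (formER_isSymm ε n) (h.nondegImage hu)]
  exact h.form_imageProj_ne hu

lemma fderiv_parallel_tangent (h : IsFlatParametrization ε F O) {O' : Set V} (hO' : O' ⊆ O)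
    {ζ : V → AmbER n} (hζ : IsHullParallelOn ε F O' ζ) (hu : u ∈ O') {T : V}
    (hT : fderiv ℝ F u T = imageProj (formER ε n) (fderiv ℝ F u) (dt n)) :
    fderiv ℝ ζ u T = 0 := by
  rw [(hζ u hu).2.fderiv]
  exact h.deriv_hullE_tangent (hO' hu) hT (hζ u hu).1

lemma contDiffOn_parallel (h : IsFlatParametrization ε F O) {O' : Set V} (hOo : IsOpen O')
    (hO' : O' ⊆ O) {ζ : V → AmbER n} (hζ : IsHullParallelOn ε F O' ζ) : ContDiffOn ℝ ∞ ζ O' := by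
  refine contDiffOn_of_hasFDerivAt_flip (A := fderiv ℝ (hullE ε F)) hOo (fun u hu => ?_)
    fun u hu => (hζ u hu).2
  exact ((h.contDiffAt_hullE (hO' hu)).fderiv_right (by simp)).contDiffWithinAt

/-- The coefficients of the position vector with respect to a parallel frame are constant in the
directions orthogonal to `∂/∂t`. -/
lemma deriv_form_parallel_horizL (h : IsFlatParametrization ε F O) {O' : Set V} (hO' : O' ⊆ O)
    {ζ : V → AmbER n} (hζ : IsHullParallelOn ε F O' ζ) (hu : u ∈ O') :
    ∃ D : V →L[ℝ] ℝ, HasFDerivAt (fun y => formER ε n (ζ y) (horizL n (F y))) D u ∧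
      ∀ v, formER ε n (fderiv ℝ F u v) (dt n) = 0 → D v = 0 := by
  obtain ⟨D, hD, hDv⟩ := hasFDerivAt_form (formER ε n) (hζ u hu).2 (h.hasFDerivAt_horizL (hO' hu))
  refine ⟨D, hD, fun v hv => ?_⟩
  have h1 := h.hullE_deriv_parallel hO' hζ hu v
  rw [(hζ u hu).2.fderiv] at h1
  have h3 : hullE ε F u (fderiv ℝ F u v) = 0 := (h.hullE_eq_zero_iff (hO' hu) _).2 ⟨v, rfl, hv⟩
  rw [hDv, h.form_eq_zero_of_hullE (hO' hu) h1 (h.hullE_horizL (hO' hu)),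
    ContinuousLinearMap.comp_apply, horizL_fderiv_of_form_eq_zero hv,
    (formER_isSymm ε n).eq (ζ u), h.form_eq_zero_of_hullE (hO' hu) h3 (hζ u hu).1, add_zero]

/-- The kernel lies in the image under F_* of the kernel of the nonzero functional ⟨F_*·, ∂/∂t⟩,
which has codimension one. This bound later identifies the kernel with the tangent space of g. -/
lemma finrank_ker_hullE (h : IsFlatParametrization ε F O) (hu : u ∈ O) :
    Module.finrank ℝ (LinearMap.ker (hullE ε F u : AmbER n →ₗ[ℝ] AmbER n)) + 1 ≤
      Module.finrank ℝ V := by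
  let a : V →ₗ[ℝ] ℝ := ((formER ε n).flip (dt n)).comp (fderiv ℝ F u : V →ₗ[ℝ] AmbER n)
  have ha : a ≠ 0 := by
    obtain ⟨v, hv⟩ := h.vert u hu
    intro h0
    exact hv (congrArg (fun D => D v) h0)
  have h1 := Module.Dual.finrank_ker_add_one_of_ne_zero (f := a) ha
  have h2 : LinearMap.ker (hullE ε F u : AmbER n →ₗ[ℝ] AmbER n) ≤
      (LinearMap.ker a).map (fderiv ℝ F u : V →ₗ[ℝ] AmbER n) := by
    intro x hx
    obtain ⟨v, hv, hv0⟩ := (h.hullE_eq_zero_iff hu x).1 hx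
    exact ⟨v, hv0, hv.symm⟩
  have h3 := (Submodule.finrank_mono h2).trans (Submodule.finrank_map_le _ _)
  omega

end IsFlatParametrization

end FrameDerivatives

/-! ### Coordinates adapted to the height and to the parallel frame -/

section AdaptedCoordinates

variable {n d : ℕ} {ε : ℝ} {V : Type*} [NormedAddCommGroup V] [NormedSpace ℝ V]
  [FiniteDimensional ℝ V] {F : V → AmbER n} {O : Set V} {u₀ : V}

/-- `univBall` has a smooth inverse on the ball. It stretches a coordinate ball to the whole
Euclidean space, which then serves as N. -/
lemma fderiv_univBall_injective {E : Type*} [NormedAddCommGroup E] [InnerProductSpace ℝ E] (c : E)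
    {r : ℝ} (hr : 0 < r) (x : E) : Injective (fderiv ℝ (OpenPartialHomeomorph.univBall c r) x) := by
  have h1 : HasFDerivAt (OpenPartialHomeomorph.univBall c r) _ x :=
    ((OpenPartialHomeomorph.contDiff_univBall (n := 1) (c := c) (r := r)).differentiable
      (by simp) x).hasFDerivAt
  have hx : OpenPartialHomeomorph.univBall c r x ∈ Metric.ball c r := by
    rw [← OpenPartialHomeomorph.univBall_target c hr]
    exact (OpenPartialHomeomorph.univBall c r).map_source (by simp)
  have h2 : HasFDerivAt (OpenPartialHomeomorph.univBall c r).symm _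
      (OpenPartialHomeomorph.univBall c r x) :=
    (((OpenPartialHomeomorph.contDiffOn_univBall_symm (n := 1) (c := c) (r := r)).contDiffAt
      (Metric.isOpen_ball.mem_nhds hx)).differentiableAt (by simp)).hasFDerivAt
  have h3 := (h2.comp x h1).unique ((hasFDerivAt_id x).congr_of_eventuallyEq
    (Filter.Eventually.of_forall fun y =>
      (OpenPartialHomeomorph.univBall c r).left_inv (by simp)))
  intro a b hab
  have h4 : ∀ a, _ = a := fun a => congrArg (fun D : E →L[ℝ] E => D a) h3
  rw [← h4 a, ← h4 b, ContinuousLinearMap.comp_apply, hab, ContinuousLinearMap.comp_apply]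

/-- Local coordinates `(x, s)` in which `s` is the height and a parallel frame is independent
of `s`. -/
theorem IsFlatParametrization.exists_adapted_coordinates (hε : ε = 1 ∨ ε = -1)
    (hfin : Module.finrank ℝ V = d + 1) (h : IsFlatParametrization ε F O) (hu₀ : u₀ ∈ O) :
    ∃ (I : Set ℝ) (Ξ : OpenPartialHomeomorph (EuclideanSpace ℝ (Fin d) × ℝ) V) (k : ℕ)
      (e : Fin (k + 1) → V → AmbER n), IsOpen I ∧ IsPreconnected I ∧ I.Nonempty ∧
      Ξ.source = univ ×ˢ I ∧ Ξ.target ⊆ O ∧ u₀ ∈ Ξ.target ∧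
      ContDiffOn ℝ ∞ Ξ Ξ.source ∧ ContDiffOn ℝ ∞ Ξ.symm Ξ.target ∧
      (∀ j, IsHullParallelOn ε F Ξ.target (e j)) ∧ (∀ j, ∀ u ∈ Ξ.target, (e j u).2 = 0) ∧
      (∀ u ∈ Ξ.target, ∀ i j, formER ε n (e i u) (e j u) =
        if i = j then (Fin.cons ε (fun _ => 1) : Fin (k + 1) → ℝ) i else 0) ∧
      (∀ u ∈ Ξ.target, horizL n (F u) = ∑ j, ((Fin.cons ε (fun _ => 1) : Fin (k + 1) → ℝ) j *
          formER ε n (e j u) (horizL n (F u))) • e j u) ∧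
      (∀ u ∈ Ξ.target, ε = -1 → 0 < (e 0 u).1 0) ∧
      (∀ u ∈ Ξ.target, 0 < ε * formER ε n (e 0 u) (horizL n (F u))) ∧
      (∀ y ∈ Ξ.source, (F (Ξ y)).2 = y.2) ∧
      (∀ y ∈ Ξ.source, ∀ j, fderiv ℝ (e j) (Ξ y) (fderiv ℝ Ξ y (0, 1)) = 0) ∧
      ∀ y ∈ Ξ.source, ∀ b, fderiv ℝ (e 0) (Ξ y) (fderiv ℝ Ξ y (b, 0)) = 0 → b = 0 := by
  obtain ⟨O', k, e, hO'o, hO', hu₀', hpar, hzero, horth, he0, hexp⟩ := h.exists_frame hε hu₀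
  have hsm := fun j => h.contDiffOn_parallel hO'o hO' (hpar j)
  have hed : ∀ j, ∀ u ∈ O', HasFDerivAt (e j) (fderiv ℝ (e j) u) u := fun j u hu =>
    (hpar j u hu).2.differentiableAt.hasFDerivAt
  -- the coordinates
  let a : V →ₗ[ℝ] ℝ := ((formER ε n).flip (dt n)).comp (fderiv ℝ F u₀ : V →ₗ[ℝ] AmbER n)
  have ha : a ≠ 0 := by
    obtain ⟨v, hv⟩ := h.vert u₀ hu₀
    exact fun h0 => hv (congrArg (fun D => D v) h0)
  -- At u₀ one has e_0 = ν, so on directions orthogonal to ∂/∂t the derivative of e_0 equals F_*,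
  -- which is injective. A suitable p retains this with only d coordinates.
  obtain ⟨p, hp⟩ := exists_projection_injective (E := EuclideanSpace ℝ (Fin d)) (by simpa using hfin)
    (fderiv ℝ (e 0) u₀ : V →ₗ[ℝ] AmbER n) ha fun v hv hav => by
      have h1 := h.deriv_hullE_horizL hu₀ (v := v) hav
      rw [← he0] at h1
      have h2 : fderiv ℝ (e 0) u₀ v = fderiv ℝ (hullE ε F) u₀ v (e 0 u₀) := by
        rw [(hpar 0 u₀ hu₀').2.fderiv]; rfl
      rw [← h2] at h1
      refine h.pos u₀ hu₀ v ?_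
      rw [← h1, show fderiv ℝ (e 0) u₀ v = 0 from hv, map_zero]
  let Ω : V → EuclideanSpace ℝ (Fin d) × ℝ := fun u => (p (e 0 u), (F u).2)
  have hΩ : ContDiffOn ℝ ∞ Ω O' := (p.contDiff.comp_contDiffOn (hsm 0)).prodMk
    (contDiff_snd.comp_contDiffOn (h.contDiffOn.mono hO'))
  have hΩd : ∀ u ∈ O', HasFDerivAt Ω ((p.comp (fderiv ℝ (e 0) u)).prod
      ((ContinuousLinearMap.snd ℝ (AmbE n) ℝ).comp (fderiv ℝ F u))) u := fun u hu =>
    (p.hasFDerivAt.comp u (hed 0 u hu)).prodMk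
      ((ContinuousLinearMap.snd ℝ (AmbE n) ℝ).hasFDerivAt.comp u (h.hasFDerivAt (hO' hu)))
  have hinj : Injective (fderiv ℝ Ω u₀) := by
    rw [(hΩd u₀ hu₀').fderiv, injective_iff_map_eq_zero]
    intro v hv
    exact hp v (congrArg Prod.fst hv) ((formER_dt _).trans (congrArg Prod.snd hv))
  -- Two open conditions: e_0 stays in the upper half space, and the coefficient of ν along e_0
  -- stays positive. For ε = -1 they put g and α on the correct sheet.
  have hev : ∀ᶠ u in nhds u₀, (u ∈ O' ∧ (ε = -1 → 0 < (e 0 u).1 0)) ∧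
      0 < ε * formER ε n (e 0 u) (horizL n (F u)) := by
    refine (Filter.Eventually.and (hO'o.mem_nhds hu₀') ?_).and ?_
    · by_cases hε1 : ε = -1
      · have hc : ContinuousAt (fun u => (e 0 u).1 0) u₀ :=
          ((continuous_apply 0).comp continuous_fst).continuousAt.comp (hed 0 u₀ hu₀').continuousAt
        have h0 : 0 < (e 0 u₀).1 0 := by rw [he0]; exact (h.quadric u₀ hu₀).2 hε1
        exact (hc.eventually (lt_mem_nhds h0)).mono fun u hu _ => hu
      · exact Filter.Eventually.of_forall fun u hu => absurd hu hε1
    · obtain ⟨D, hD, -⟩ := h.deriv_form_parallel_horizL hO' (hpar 0) hu₀'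
      have hc := hD.continuousAt.const_mul ε
      refine hc.eventually (lt_mem_nhds ?_)
      show 0 < ε * formER ε n (e 0 u₀) (horizL n (F u₀))
      rw [he0, formER_horizL_self, (h.quadric u₀ hu₀).1, epsilon_mul_self hε]
      exact one_pos
  obtain ⟨O₁, hO₁, hO₁o, hu₀₁⟩ := eventually_nhds_iff.1 hev
  have hO₁' : O₁ ⊆ O' := fun u hu => (hO₁ u hu).1.1
  obtain ⟨Φ, hΦ₀, hΦO, hΦΩ, hΦs, hΦi⟩ := exists_smooth_local_inverse (by simpa using hfin) hO₁o
    (hΩ.mono hO₁') hu₀₁ hinj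
  -- a box
  have htgt := Φ.map_source hΦ₀
  obtain ⟨⟨x₀, s₀⟩, hxs⟩ : ∃ z, Φ u₀ = z := ⟨_, rfl⟩
  rw [hxs] at htgt
  obtain ⟨r, hr, hball⟩ := Metric.isOpen_iff.1 Φ.open_target _ htgt
  rw [← ball_prod_same] at hball
  let β := OpenPartialHomeomorph.univBall x₀ r
  have hβ : ∀ x, β x ∈ Metric.ball x₀ r := fun x => by
    rw [← OpenPartialHomeomorph.univBall_target x₀ hr]
    exact β.map_source (by simp [β])
  let Ξ := (β.prod (OpenPartialHomeomorph.ofSet (Metric.ball s₀ r) Metric.isOpen_ball)).trans Φ.symm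
  have hΞs : Ξ.source = univ ×ˢ Metric.ball s₀ r := by
    ext ⟨x, s⟩
    simp only [Ξ, OpenPartialHomeomorph.trans_source, OpenPartialHomeomorph.prod_source,
      OpenPartialHomeomorph.ofSet_source, β, OpenPartialHomeomorph.univBall_source]
    constructor
    · exact fun hx => hx.1
    · exact fun hx => ⟨hx, hball ⟨hβ x, hx.2⟩⟩
  have hΞv : ∀ y, Ξ y = Φ.symm (β y.1, y.2) := fun y => rfl
  have hΞt : Ξ.target ⊆ Φ.source := fun u hu => hu.1
  have hmem : ∀ y ∈ Ξ.source, (β y.1, y.2) ∈ Φ.target := fun y hy => by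
    rw [hΞs] at hy
    exact hball ⟨hβ _, hy.2⟩
  have hΞO : ∀ y ∈ Ξ.source, Ξ y ∈ O₁ := fun y hy => hΦO (hΞt (Ξ.map_source hy))
  have hβs : ContDiff ℝ ∞ β := OpenPartialHomeomorph.contDiff_univBall
  have hΞsm : ContDiffOn ℝ ∞ Ξ Ξ.source :=
    hΦs.comp ((hβs.comp contDiff_fst).prodMk contDiff_snd).contDiffOn hmem
  have hΞd : ∀ y ∈ Ξ.source, HasFDerivAt Ξ (fderiv ℝ Ξ y) y := fun y hy =>
    ((hΞsm.contDiffAt (Ξ.open_source.mem_nhds hy)).differentiableAt (by simp)).hasFDerivAt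
  have hΩΞ : ∀ y ∈ Ξ.source, Ω (Ξ y) = (β y.1, y.2) := fun y hy => by
    rw [← hΦΩ, hΞv, Φ.right_inv (hmem y hy)]
  have hΩΞd : ∀ y ∈ Ξ.source, ∀ b t, fderiv ℝ Ω (Ξ y) (fderiv ℝ Ξ y (b, t)) =
      (fderiv ℝ β y.1 b, t) := fun y hy b t => by
    have h1 := (hΩd _ (hO₁' (hΞO y hy))).comp y (hΞd y hy)
    have h2 : HasFDerivAt (fun y : EuclideanSpace ℝ (Fin d) × ℝ => (β y.1, y.2)) _ y :=
      (HasFDerivAt.comp y (f := Prod.fst) (hβs.differentiable (by simp) y.1).hasFDerivAt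
        hasFDerivAt_fst).prodMk hasFDerivAt_snd
    have h3 := h1.unique (h2.congr_of_eventuallyEq
      (Filter.mem_of_superset (Ξ.open_source.mem_nhds hy) hΩΞ))
    rw [(hΩd _ (hO₁' (hΞO y hy))).fderiv]
    exact congrArg (fun D : EuclideanSpace ℝ (Fin d) × ℝ →L[ℝ] _ => D (b, t)) h3
  refine ⟨Metric.ball s₀ r, Ξ, k, e, Metric.isOpen_ball, (convex_ball s₀ r).isPreconnected,
    ⟨s₀, Metric.mem_ball_self hr⟩, hΞs, fun u hu => hO' (hO₁' (hΦO (hΞt hu))), ?_, hΞsm, ?_,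
    fun j u hu => hpar j u (hO₁' (hΦO (hΞt hu))), fun j u hu => hzero j u (hO₁' (hΦO (hΞt hu))),
    fun u hu => horth u (hO₁' (hΦO (hΞt hu))), fun u hu => hexp u (hO₁' (hΦO (hΞt hu))),
    fun u hu => (hO₁ u (hΦO (hΞt hu))).1.2, fun u hu => (hO₁ u (hΦO (hΞt hu))).2,
    fun y hy => congrArg Prod.snd (hΩΞ y hy), fun y hy j => ?_, fun y hy b hb => ?_⟩
  · have h1 : ((0 : EuclideanSpace ℝ (Fin d)), s₀) ∈ Ξ.source := by
      rw [hΞs]; exact ⟨trivial, Metric.mem_ball_self hr⟩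
    have h2 : Ξ (0, s₀) = u₀ := by
      rw [hΞv]
      show Φ.symm (β 0, s₀) = u₀
      rw [OpenPartialHomeomorph.univBall_apply_zero, ← hxs, Φ.left_inv hΦ₀]
    rw [← h2]
    exact Ξ.map_source h1
  · have hΩt : ContDiffOn ℝ ∞ Ω Ξ.target := hΩ.mono fun u hu => hO₁' (hΦO (hΞt hu))
    have h1 : ContDiffOn ℝ ∞ (fun u => (β.symm (Ω u).1, (Ω u).2)) Ξ.target := by
      refine ContDiffOn.prodMk (OpenPartialHomeomorph.contDiffOn_univBall_symm.comp
        (contDiff_fst.comp_contDiffOn hΩt) fun u hu => ?_) (contDiff_snd.comp_contDiffOn hΩt)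
      have h2 := hΩΞ _ (Ξ.map_target hu)
      rw [Ξ.right_inv hu] at h2
      rw [h2]
      exact hβ _
    refine h1.congr fun u hu => ?_
    rw [← hΦΩ]
    rfl
  · have hy' := hO₁' (hΞO y hy)
    obtain ⟨T, hT, hT0⟩ := h.exists_tangent (hO' hy')
    have h0 := fun j => h.fderiv_parallel_tangent hO' (hpar j) hy' hT
    have h1 : fderiv ℝ Ω (Ξ y) T = (0, formER ε n (fderiv ℝ F (Ξ y) T) (dt n)) := by
      rw [(hΩd _ hy').fderiv, formER_dt]
      simp [h0]
    -- As e_0 does not change along T, the coordinates x do not either. Thus T is a nonzero multiple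
    -- of ∂/∂s, and every e_j is independent of s.
    have h2 : (formER ε n (fderiv ℝ F (Ξ y) T) (dt n)) • fderiv ℝ Ξ y (0, 1) = T := by
      refine hΦi _ (hΞt (Ξ.map_source hy)) ?_
      rw [map_smul, hΩΞd y hy, h1]
      simp
    have h3 := h0 j
    rw [← h2, map_smul, smul_eq_zero] at h3
    refine h3.resolve_left fun h4 => hT0 ?_
    rw [← h4]
  · have h1 := hΩΞd y hy b 0
    rw [(hΩd _ (hO₁' (hΞO y hy))).fderiv] at h1
    -- In these coordinates p∘e_0 is the map β of x alone, so e_0 inherits injectivity of its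
    -- x-derivative from β.
    have h2 : p (fderiv ℝ (e 0) (Ξ y) (fderiv ℝ Ξ y (b, 0))) = fderiv ℝ β y.1 b :=
      congrArg Prod.fst h1
    rw [hb, map_zero] at h2
    exact fderiv_univBall_injective x₀ hr y.1 (h2.symm.trans (map_zero _).symm)

end AdaptedCoordinates

/-! ### From a parallel frame to a partial tube -/

section TubeCoordinates

variable {n d : ℕ} {ε : ℝ} {V : Type*} [NormedAddCommGroup V] [NormedSpace ℝ V]
  [FiniteDimensional ℝ V] {F : V → AmbER n} {O : Set V} {u₀ : V}

lemma coimageProj_eq_of_range {W : Type*} [NormedAddCommGroup W] [NormedSpace ℝ W]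
    [FiniteDimensional ℝ W] {B : LinearMap.BilinForm ℝ W} {L : V →L[ℝ] W} (hL : NondegImage B L)
    {Q : W →L[ℝ] W} (hQ : IsFormProj B Q) (hQL : ∀ v, Q (L v) = 0)
    (hLQ : ∀ x, Q x = 0 → ∃ v, x = L v) : coimageProj B L = Q := by
  refine ContinuousLinearMap.ext fun x => ?_
  rw [coimageProj_apply, sub_eq_iff_eq_add, ← sub_eq_iff_eq_add', eq_comm]
  refine imageProj_eq_of hL ?_ fun v => ?_
  · obtain ⟨v, hv⟩ := hLQ (x - Q x) (by rw [map_sub, hQ.idem, sub_self])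
    exact ⟨v, hv.symm⟩
  · rw [sub_sub_cancel, hQ.symm, hQL, map_zero]

/-- Local coordinates that exhibit the immersion as a partial tube. -/
theorem IsFlatParametrization.exists_tube_coordinates (hε : ε = 1 ∨ ε = -1)
    (hfin : Module.finrank ℝ V = d + 1) (h : IsFlatParametrization ε F O) (hu₀ : u₀ ∈ O) :
    ∃ (I : Set ℝ) (Ξ : OpenPartialHomeomorph (EuclideanSpace ℝ (Fin d) × ℝ) V) (k : ℕ)
      (e : Fin (k + 1) → EuclideanSpace ℝ (Fin d) → AmbE n) (y : Fin (k + 1) → ℝ → ℝ),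
      IsOpen I ∧ I.OrdConnected ∧ Ξ.source = univ ×ˢ I ∧ Ξ.target ⊆ O ∧ u₀ ∈ Ξ.target ∧
      ContDiffOn ℝ ∞ Ξ Ξ.source ∧ ContDiffOn ℝ ∞ Ξ.symm Ξ.target ∧
      (∀ j, ContDiff ℝ ∞ (e j)) ∧ (∀ x, e 0 x ∈ _root_.quadric ε n) ∧
      (∀ i j x, formE ε n (e i x) (e j x) =
        if i = j then (Fin.cons ε (fun _ => 1) : Fin (k + 1) → ℝ) i else 0) ∧
      (∀ x, Injective (fderiv ℝ (e 0) x)) ∧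
      (∀ j x b, ∃ b', fderiv ℝ (e j) x b = fderiv ℝ (e 0) x b') ∧
      (∀ x, FlatJet (coimageProj (formE ε n) (fderiv ℝ (e 0) x))
        (fun v => fderiv ℝ (fun x => coimageProj (formE ε n) (fderiv ℝ (e 0) x)) x v)) ∧
      (∀ j, ContDiffOn ℝ ∞ (y j) I) ∧ (∀ s ∈ I, (fun j => y j s) ∈ _root_.quadric ε k) ∧
      ∀ x, ∀ s ∈ I, F (Ξ (x, s)) = (∑ j, y j s • e j x, s) := by
  obtain ⟨I, Ξ, k, e, hI, hIc, ⟨s₀, hs₀⟩, hsrc, htgt, hu₀t, hΞ, hΞs, hpar, hzero, horth, hexp, hsheet,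
    hpos, hheight, hds, hdx⟩ := h.exists_adapted_coordinates hε hfin hu₀
  have hB := formER_isSymm ε n
  have hmem : ∀ x, ∀ s ∈ I, (x, s) ∈ Ξ.source := fun x s hs => by rw [hsrc]; exact ⟨trivial, hs⟩
  have hmt : ∀ x, ∀ s ∈ I, Ξ (x, s) ∈ Ξ.target := fun x s hs => Ξ.map_source (hmem x s hs)
  have hΞd : ∀ x, ∀ s ∈ I, HasFDerivAt Ξ (fderiv ℝ Ξ (x, s)) (x, s) := fun x s hs =>
    ((hΞ.contDiffAt (Ξ.open_source.mem_nhds (hmem x s hs))).differentiableAt (by simp)).hasFDerivAt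
  have hΞx : ∀ x, ∀ s ∈ I, HasFDerivAt (fun x => Ξ (x, s))
      ((fderiv ℝ Ξ (x, s)).comp (ContinuousLinearMap.inl ℝ _ ℝ)) x := fun x s hs =>
    (hΞd x s hs).comp x (hasFDerivAt_prodMk_left x s)
  have hΞr : ∀ x, ∀ s ∈ I, HasFDerivAt (fun s => Ξ (x, s))
      ((fderiv ℝ Ξ (x, s)).comp (ContinuousLinearMap.inr ℝ _ ℝ)) s := fun x s hs =>
    (hΞd x s hs).comp s (hasFDerivAt_prodMk_right x s)
  have hed : ∀ j, ∀ u ∈ Ξ.target, HasFDerivAt (e j) (fderiv ℝ (e j) u) u := fun j u hu =>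
    (hpar j u hu).2.differentiableAt.hasFDerivAt
  -- the directions tangent to the level sets of the height
  have hlevel : ∀ x, ∀ s ∈ I, ∀ b,
      formER ε n (fderiv ℝ F (Ξ (x, s)) (fderiv ℝ Ξ (x, s) (b, 0))) (dt n) = 0 := by
    intro x s hs b
    have h1 := ((ContinuousLinearMap.snd ℝ (AmbE n) ℝ).hasFDerivAt.comp _
      ((h.hasFDerivAt (htgt (hmt x s hs))).comp (x, s) (hΞd x s hs))).unique
      ((hasFDerivAt_snd (𝕜 := ℝ) (p := (x, s))).congr_of_eventuallyEq
        (Filter.mem_of_superset (Ξ.open_source.mem_nhds (hmem x s hs)) hheight))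
    rw [formER_dt]
    exact congrArg (fun D : EuclideanSpace ℝ (Fin d) × ℝ →L[ℝ] ℝ => D (b, 0)) h1
  -- the frame is independent of `s`
  have hconst : ∀ j x, ∀ s ∈ I, e j (Ξ (x, s)) = e j (Ξ (x, s₀)) := by
    intro j x s hs
    have hD : ∀ s ∈ I, HasFDerivAt (fun s => e j (Ξ (x, s))) (0 : ℝ →L[ℝ] AmbER n) s := by
      intro s hs
      refine ((hed j _ (hmt x s hs)).comp s (hΞr x s hs)).congr_fderiv ?_
      ext1
      exact hds _ (hmem x s hs) j
    exact hI.is_const_of_fderiv_eq_zero (𝕜 := ℝ) hIc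
      (fun s hs => (hD s hs).differentiableAt.differentiableWithinAt) (fun s hs => (hD s hs).fderiv)
      hs hs₀
  -- the coefficients are independent of `x`
  let c : Fin (k + 1) → ℝ := Fin.cons ε (fun _ => 1)
  have hcoef : ∀ j x, ∀ s ∈ I, formER ε n (e j (Ξ (x, s))) (horizL n (F (Ξ (x, s)))) =
      formER ε n (e j (Ξ (0, s))) (horizL n (F (Ξ (0, s)))) := by
    intro j x s hs
    have hD : ∀ x, HasFDerivAt (fun x => formER ε n (e j (Ξ (x, s))) (horizL n (F (Ξ (x, s)))))
        (0 : EuclideanSpace ℝ (Fin d) →L[ℝ] ℝ) x := by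
      intro x
      obtain ⟨D, hD, hD0⟩ := h.deriv_form_parallel_horizL htgt (hpar j) (hmt x s hs)
      refine (hD.comp x (hΞx x s hs)).congr_fderiv (ContinuousLinearMap.ext fun b => ?_)
      exact hD0 _ (hlevel x s hs b)
    exact is_const_of_fderiv_eq_zero (𝕜 := ℝ) (fun x => (hD x).differentiableAt)
      (fun x => (hD x).fderiv) x 0
  -- The frame along the slice s = s₀: the entry 0 is the base immersion, the others are its normal
  -- fields. In the coefficients y, the factor c j = ⟨e_j,e_j⟩ accounts for the sign of e_0.
  let g : Fin (k + 1) → EuclideanSpace ℝ (Fin d) → AmbE n := fun j x => (e j (Ξ (x, s₀))).1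
  let y : Fin (k + 1) → ℝ → ℝ := fun j s =>
    c j * formER ε n (e j (Ξ (0, s))) (horizL n (F (Ξ (0, s))))
  have hincl : ∀ j x, inclE n (g j x) = e j (Ξ (x, s₀)) := fun j x => by
    rw [inclE_apply]
    exact Prod.ext rfl (hzero j _ (hmt x s₀ hs₀)).symm
  have hsm := fun j => h.contDiffOn_parallel Ξ.open_target htgt (hpar j)
  have hΞsm : ContDiff ℝ ∞ fun x : EuclideanSpace ℝ (Fin d) => Ξ (x, s₀) :=
    contDiffOn_univ.1 (hΞ.comp (contDiff_id.prodMk contDiff_const).contDiffOn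
      fun x _ => hmem x s₀ hs₀)
  have hgsm : ∀ j, ContDiff ℝ ∞ (g j) := fun j => contDiff_fst.comp (contDiffOn_univ.1
    ((hsm j).comp hΞsm.contDiffOn fun x _ => hmt x s₀ hs₀))
  have hgd : ∀ j x, HasFDerivAt (g j) ((ContinuousLinearMap.fst ℝ (AmbE n) ℝ).comp
      ((fderiv ℝ (e j) (Ξ (x, s₀))).comp ((fderiv ℝ Ξ (x, s₀)).comp
        (ContinuousLinearMap.inl ℝ _ ℝ)))) x := fun j x =>
    (ContinuousLinearMap.fst ℝ (AmbE n) ℝ).hasFDerivAt.comp x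
      ((hed j _ (hmt x s₀ hs₀)).comp x (hΞx x s₀ hs₀))
  have hinclD : ∀ j x b, inclE n (fderiv ℝ (g j) x b) =
      fderiv ℝ (e j) (Ξ (x, s₀)) (fderiv ℝ Ξ (x, s₀) (b, 0)) := by
    intro j x b
    have h1 := ((inclE n).hasFDerivAt.comp x ((hgsm j).differentiable (by simp) x).hasFDerivAt).unique
      (((hed j _ (hmt x s₀ hs₀)).comp x (hΞx x s₀ hs₀)).congr_of_eventuallyEq
        (Filter.Eventually.of_forall (hincl j)))
    exact congrArg (fun D : EuclideanSpace ℝ (Fin d) →L[ℝ] AmbER n => D b) h1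
  have hker : ∀ j x b, hullE ε F (Ξ (x, s₀)) (inclE n (fderiv ℝ (g j) x b)) = 0 := fun j x b => by
    rw [hinclD]
    exact h.hullE_deriv_parallel htgt (hpar j) (hmt x s₀ hs₀) _
  have hginj : ∀ x, Injective (fderiv ℝ (g 0) x) := fun x => by
    rw [injective_iff_map_eq_zero]
    intro b hb
    refine hdx _ (hmem x s₀ hs₀) b ?_
    rw [← hinclD, hb, map_zero]
  -- The image of dg has dimension d and lies in the kernel of the hull projection, whose dimension
  -- is at most d; hence they agree.
  have hsurj : ∀ x z, hullE ε F (Ξ (x, s₀)) z = 0 → ∃ b, z = inclE n (fderiv ℝ (g 0) x b) := by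
    intro x z hz
    let L : EuclideanSpace ℝ (Fin d) →ₗ[ℝ] AmbER n := ((inclE n).comp (fderiv ℝ (g 0) x) : _ →L[ℝ] _)
    have hLinj : Injective L := fun b b' hb => hginj x (congrArg Prod.fst hb)
    have hle : LinearMap.range L ≤ LinearMap.ker (hullE ε F (Ξ (x, s₀)) : AmbER n →ₗ[ℝ] AmbER n) := by
      rintro _ ⟨b, rfl⟩
      exact hker 0 x b
    have hdim := h.finrank_ker_hullE (htgt (hmt x s₀ hs₀))
    have h1 := LinearMap.finrank_range_of_inj hLinj
    rw [finrank_euclideanSpace_fin] at h1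
    have h2 := Submodule.eq_of_le_of_finrank_le hle (by omega)
    obtain ⟨b, hb⟩ : z ∈ LinearMap.range L := by rw [h2]; exact hz
    exact ⟨b, hb.symm⟩
  have hnd : ∀ x, NondegImage (formE ε n) (fderiv ℝ (g 0) x) := fun x => by
    refine nondegImage_of_pos fun b hb => ?_
    obtain ⟨v, hv, -⟩ := (h.hullE_eq_zero_iff (htgt (hmt x s₀ hs₀)) _).1 (hker 0 x b)
    have h1 : formER ε n (inclE n (fderiv ℝ (g 0) x b)) (inclE n (fderiv ℝ (g 0) x b)) = 0 := by
      rw [formER_inclE]; exact hb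
    rw [hv] at h1
    have h2 := h.pos _ (htgt (hmt x s₀ hs₀)) v h1
    rw [h2, map_zero] at hv
    exact hginj x ((congrArg Prod.fst hv).trans (map_zero _).symm)
  -- The normal bundle of g plus the vertical line is the hull along the slice, so flatness of the
  -- hull passes to g.
  have hproj : ∀ x, liftEnd n (coimageProj (formE ε n) (fderiv ℝ (g 0) x)) =
      hullE ε F (Ξ (x, s₀)) := fun x => by
    rw [← coimageProj_inclE (hnd x)]
    exact coimageProj_eq_of_range (nondegImage_inclE (hnd x))
      (h.isFormProj_hullE (htgt (hmt x s₀ hs₀))) (hker 0 x) (hsurj x)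
  have hBE : ∀ i j x, formE ε n (g i x) (g j x) = if i = j then c i else 0 := fun i j x => by
    have h1 := horth _ (hmt x s₀ hs₀) i j
    rwa [← hincl, ← hincl, formER_inclE] at h1
  refine ⟨I, Ξ, k, g, y, hI, hIc.ordConnected, hsrc, htgt, hu₀t, hΞ, hΞs, hgsm, fun x =>
    ⟨by rw [hBE, if_pos rfl]; rfl, fun hε1 => hsheet _ (hmt x s₀ hs₀) hε1⟩, hBE, hginj,
    fun j x b => ?_, fun x => ?_, fun j => ?_, fun s hs => ⟨?_, fun hε1 => ?_⟩, fun x s hs => ?_⟩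
  · obtain ⟨b', hb'⟩ := hsurj x _ (hker j x b)
    exact ⟨b', congrArg Prod.fst hb'⟩
  · have h1 : DifferentiableAt ℝ (fun x => coimageProj (formE ε n) (fderiv ℝ (g 0) x)) x := by
      have h2 : ContDiffAt ℝ ∞ (fun x => imageProj (formE ε n) (fderiv ℝ (g 0) x)) x :=
        (contDiffAt_imageProj (hnd x)).comp x ((hgsm 0).contDiffAt.fderiv_right (by simp))
      exact (contDiffAt_const.sub h2).differentiableAt (by simp)
    obtain ⟨D, hD, hDv⟩ := hasFDerivAt_liftEnd h1.hasFDerivAt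
    have hQ : HasFDerivAt (fun x => hullE ε F (Ξ (x, s₀))) _ x :=
      HasFDerivAt.comp (g := hullE ε F) x (h.hasFDerivAt_hullE (htgt (hmt x s₀ hs₀))) (hΞx x s₀ hs₀)
    have h2 := hD.unique (hQ.congr_of_eventuallyEq (Filter.Eventually.of_forall hproj))
    have h3 := (h.flatJet_hullE hε (htgt (hmt x s₀ hs₀))).comp
      (fun b : EuclideanSpace ℝ (Fin d) => fderiv ℝ Ξ (x, s₀) (b, 0))
    refine (flatJet_liftEnd (D := fun v => D v) hDv).1 ?_
    rw [hproj, h2]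
    exact h3
  · have h1 : ContDiffOn ℝ ∞ (fun s => Ξ ((0 : EuclideanSpace ℝ (Fin d)), s)) I :=
      hΞ.comp (contDiff_const.prodMk contDiff_id).contDiffOn fun s hs => hmem 0 s hs
    have h2 : ContDiffOn ℝ ∞ (fun s => e j (Ξ ((0 : EuclideanSpace ℝ (Fin d)), s))) I :=
      (hsm j).comp h1 fun s hs => hmt 0 s hs
    have h3 : ContDiffOn ℝ ∞ (fun s => horizL n (F (Ξ ((0 : EuclideanSpace ℝ (Fin d)), s)))) I :=
      (horizL n).contDiff.comp_contDiffOn (h.contDiffOn.comp h1 fun s hs => htgt (hmt 0 s hs))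
    have h4 := ((LinearMap.toContinuousBilinearMap (formER ε n)).contDiff.comp_contDiffOn h2).clm_apply
      h3
    exact contDiffOn_const.mul h4
  · have hu := hmt (0 : EuclideanSpace ℝ (Fin d)) s hs
    have h1 := (formER_horizL_self (ε := ε) (F (Ξ ((0 : EuclideanSpace ℝ (Fin d)), s)))).trans
      (h.quadric _ (htgt hu)).1
    -- The relation ⟨ν,ν⟩ = ε, expanded in the frame, is the quadric equation for the coefficients.
    have h2 := congrArg (fun z => formER ε n z (horizL n (F (Ξ (0, s))))) (hexp _ hu)
    rw [h1] at h2
    simp only [map_sum, map_smul, LinearMap.sum_apply, LinearMap.smul_apply, smul_eq_mul] at h2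
    simp only [Fin.sum_univ_succ, Fin.cons_zero, Fin.cons_succ, one_mul] at h2
    rw [formE_apply]
    simp only [y, c, Fin.cons_zero, Fin.cons_succ, one_mul]
    have h3 := epsilon_mul_self hε
    linear_combination -h2 + (ε * formER ε n (e 0 (Ξ (0, s))) (horizL n (F (Ξ (0, s)))) *
      formER ε n (e 0 (Ξ (0, s))) (horizL n (F (Ξ (0, s))))) * h3
  · exact hpos _ (hmt 0 s hs)
  · have h1 := congrArg Prod.fst (hexp _ (hmt x s hs))
    refine Prod.ext ?_ (hheight _ (hmem x s hs))
    rw [Prod.fst_sum] at h1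
    refine h1.trans (Finset.sum_congr rfl fun j _ => ?_)
    simp only [y, g]
    rw [← hconst j x s hs, hcoef j x s hs]
    rfl

end TubeCoordinates

/-! ### Partial tubes from flat immersions: (i) implies (iii) -/

section Construction

variable {n d : ℕ} {ε : ℝ}

lemma dmapL_eq_fderiv {W : Type*} [NormedAddCommGroup W] [NormedSpace ℝ W]
    (G : EuclideanSpace ℝ (Fin d) → W) (x : EuclideanSpace ℝ (Fin d)) :
    dmapL d G x = fderiv ℝ G x := mfderiv_eq_fderiv

/-- A product of model spaces carries the model structure of the product vector space and the
product of the model structures; the two are equal but have to be rewritten into each other. -/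
lemma contMDiffOn_prod_self {V E H : Type*} [NormedAddCommGroup V] [NormedSpace ℝ V]
    [NormedAddCommGroup E] [NormedSpace ℝ E] [TopologicalSpace H] {I : ModelWithCorners ℝ E H}
    {M : Type*} [TopologicalSpace M] [ChartedSpace H M] {G : V × ℝ → M} {S : Set (V × ℝ)}
    (h : ContMDiffOn 𝓘(ℝ, V × ℝ) I ∞ G S) : ContMDiffOn (𝓘(ℝ, V).prod 𝓘(ℝ, ℝ)) I ∞ G S := by
  rwa [← modelWithCornersSelf_prod, chartedSpaceSelf_prod]

lemma contMDiffOn_self_prod {V E H : Type*} [NormedAddCommGroup V] [NormedSpace ℝ V]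
    [NormedAddCommGroup E] [NormedSpace ℝ E] [TopologicalSpace H] {I : ModelWithCorners ℝ E H}
    {M : Type*} [TopologicalSpace M] [ChartedSpace H M] {G : M → V × ℝ} {S : Set M}
    (h : ContMDiffOn I 𝓘(ℝ, V × ℝ) ∞ G S) : ContMDiffOn I (𝓘(ℝ, V).prod 𝓘(ℝ, ℝ)) ∞ G S := by
  rwa [← modelWithCornersSelf_prod, chartedSpaceSelf_prod]

/-- An immersion into `Q_ε^n × ℝ` that is flat in `E^{n+2}` and nowhere orthogonal to `∂/∂t` is
locally a partial tube. -/
theorem isLocallyFlatPartialTube_of_flatJet {M : Type*} [TopologicalSpace M]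
    [ChartedSpace (EuclideanSpace ℝ (Fin (d + 1))) M] [IsManifold (𝓡 (d + 1)) ∞ M] {F : M → AmbER n}
    (hε : ε = 1 ∨ ε = -1) (hF : IsSmoothImmersion (d + 1) F) (hq : ∀ x, (F x).1 ∈ quadric ε n)
    (hflat : ∀ x, FlatJet (coimageProj (formER ε n) (dmapL (d + 1) F x))
        (fun v => dmapL (d + 1) (fun y => coimageProj (formER ε n) (dmapL (d + 1) F y)) x v))
    (hv : ∀ x, ∃ v, formER ε n (dmapL (d + 1) F x v) (dt n) ≠ 0) :
    IsLocallyFlatPartialTube d ε F := by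
  intro p
  have hparam := isFlatParametrization_chart hε hF hq hflat hv p
  obtain ⟨I, Ξ, k, e, y, hI, hIc, hsrc, htgt, hpt, hΞ, hΞs, hesm, heq, heo, heinj, hepar, heflat,
    hy, hyq, hform⟩ := hparam.exists_tube_coordinates hε
      (finrank_euclideanSpace_fin (𝕜 := ℝ) (n := d + 1)) (mem_extChartAt_target (I := 𝓡 (d + 1)) p)
  have hct : (extChartAt (𝓡 (d + 1)) p).target =
      (chartAt (EuclideanSpace ℝ (Fin (d + 1))) p).target := by
    simp
  have hsymm : ∀ u, (extChartAt (𝓡 (d + 1)) p).symm u =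
      (chartAt (EuclideanSpace ℝ (Fin (d + 1))) p).symm u := fun u => by simp
  let Ψ : OpenPartialHomeomorph (EuclideanSpace ℝ (Fin d) × ℝ) M :=
    Ξ.trans (chartAt (EuclideanSpace ℝ (Fin (d + 1))) p).symm
  have hΨsrc : Ψ.source = Ξ.source := by
    refine inter_eq_left.2 fun x hx => ?_
    show Ξ x ∈ (chartAt (EuclideanSpace ℝ (Fin (d + 1))) p).target
    rw [← hct]
    exact htgt (Ξ.map_source hx)
  have hg : IsSmoothImmersion d (e 0) := ⟨(hesm 0).contMDiff, fun x => by
    have := heinj x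
    rw [← dmapL_eq_fderiv] at this
    exact this⟩
  have hgq := fun x => (heq x).1
  -- The parameter is the height itself, so the last coordinate of the curve has derivative 1, which
  -- also makes the curve regular.
  have hα : ContDiffOn ℝ ∞ (fun s => ((fun j => y j s, s) : AmbER k)) I :=
    (contDiffOn_pi.2 hy).prodMk contDiffOn_id
  have hα2 : ∀ s : ℝ, deriv (fun r : ℝ => r) s ≠ 0 := fun s => by simp
  refine ⟨EuclideanSpace ℝ (Fin d), inferInstance, inferInstance, inferInstance, I, Ψ, e 0, k,
    fun i => e i.succ, fun s => (fun j => y j s, s), hI, hIc, hΨsrc.trans hsrc, ?_, ?_, ?_, heq, hg,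
    ?_, fun i => ?_, fun i j x => ?_, hα, hyq, fun s hs h0 => ?_, fun s _ => hα2 s, fun x s hs => ?_⟩
  · refine ⟨mem_chart_source _ p, ?_⟩
    simpa using hpt
  · refine contMDiffOn_prod_self ?_
    rw [hΨsrc]
    refine ((contMDiffOn_extChartAt_symm p).comp hΞ.contMDiffOn fun x hx =>
      htgt (Ξ.map_source hx)).congr fun x _ => ?_
    exact (hsymm _).symm
  · refine contMDiffOn_self_prod ?_
    refine (hΞs.contMDiffOn.comp ((contMDiffOn_extChartAt (I := 𝓡 (d + 1)) (x := p)).mono fun x hx => ?_)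
      fun x hx => ?_).congr fun x _ => ?_
    · exact hx.1
    · simpa using hx.2
    · simp [Ψ]
  · rw [hasFlatNormalBundle_tanQ_iff hε hg hgq]
    simpa only [dmapL_eq_fderiv] using heflat
  · have hξ : ∀ x v, ∃ w, dmapL d (e i.succ) x v = dmapL d (e 0) x w := by
      simpa only [dmapL_eq_fderiv] using hepar i.succ
    have h0 : ∀ x, formE ε n (e 0 x) (e i.succ x) = 0 := fun x => by
      rw [heo, if_neg (Fin.succ_ne_zero i).symm]
    refine (isParallelNormalField_iff hε hg hgq).2 ⟨(hesm _).contMDiff, fun x v => ?_, h0, hξ⟩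
    -- Differentiating ⟨g, ξ⟩ = 0, with dξ tangent to g and hence orthogonal to g, shows that ξ is
    -- orthogonal to the image of dg.
    have h1 := form_dmapL_of_const (hg.mdifferentiableAt x)
      (((hesm i.succ).contMDiff x).mdifferentiableAt (by simp)) h0 v
    obtain ⟨w, hw⟩ := hξ x v
    rw [hw, (formE_isSymm ε n).eq, form_dmapL_quadric hg hgq, zero_add] at h1
    exact h1
  · rw [heo]
    simp
  · have h1 := (hasDerivAt_of_contDiffOn hI hα hs).1
    rw [h0] at h1
    have h2 := ((ContinuousLinearMap.snd ℝ (AmbE k) ℝ).hasFDerivAt.comp_hasDerivAt s h1).unique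
      (hasDerivAt_id s)
    simp at h2
  · have h1 := hform x s hs
    rw [comp_apply, hsymm] at h1
    refine h1.trans (Prod.ext ?_ ?_)
    · rw [tubeMap_fst, Fin.sum_univ_succ]
    · rw [tubeMap_snd]

end Construction

/-! ### The equivalence of the three conditions -/

theorem corollary3 {d n : ℕ} {ε : ℝ} (hε : ε = 1 ∨ ε = -1)
    {M : Type*} [TopologicalSpace M] [ChartedSpace (EuclideanSpace ℝ (Fin (d + 1))) M]
    [IsManifold (𝓡 (d + 1)) ∞ M]
    (f : M → quadric ε n × ℝ) (hf : IsSmoothImmersion (d + 1) (inclQR ε n ∘ f)) :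
    List.TFAE [
      (∀ x : M, fieldT (d + 1) ε f x ≠ 0) ∧
        HasFlatNormalBundle (d + 1) (formER ε n) (tanER n) (inclQR ε n ∘ f),
      HasFlatNormalBundle (d + 1) (formER ε n) (tanQR ε n) (inclQR ε n ∘ f) ∧ IsClassA (d + 1) ε f,
      IsLocallyFlatPartialTube d ε (inclQR ε n ∘ f)] := by
  have hq : ∀ x, formE ε n ((inclQR ε n ∘ f) x).1 ((inclQR ε n ∘ f) x).1 = ε :=
    formE_inclQR_comp f
  have hflat := hasFlatNormalBundle_tanER_iff hε hf hq
  have hT : ∀ x (v : EuclideanSpace ℝ (Fin (d + 1))),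
      formER ε n (dmapL (d + 1) (inclQR ε n ∘ f) x v) (dt n) =
        formER ε n (dmapL (d + 1) (inclQR ε n ∘ f) x v)
          (dmapL (d + 1) (inclQR ε n ∘ f) x (fieldT (d + 1) ε f x)) := fun x v =>
    form_dmapL_dt hε hf hq (dmapL_fieldT hε hf x) v
  tfae_have 1 ↔ 2 := flat_tanER_iff_flat_tanQR_and_isClassA hε hf
  tfae_have 3 → 1 := by
    intro h
    have h1 := h.flatJet hε hf hq
    refine ⟨fun x hx => ?_, hflat.2 fun x => (h1 x).2⟩
    obtain ⟨v, hv⟩ := (h1 x).1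
    refine hv ((hT x v).trans ?_)
    rw [hx]
    exact (congrArg _ (map_zero (dmapL (d + 1) (inclQR ε n ∘ f) x))).trans (map_zero _)
  tfae_have 1 → 3 := by
    rintro ⟨h1, h2⟩
    refine isLocallyFlatPartialTube_of_flatJet hε hf (fun x => (f x).1.2) (hflat.1 h2) fun x =>
      ⟨fieldT (d + 1) ε f x, fun h => h1 x ?_⟩
    -- T itself is the direction not orthogonal to ∂/∂t, since ⟨f̃_*T, ∂/∂t⟩ = ⟨f̃_*T, f̃_*T⟩.
    exact (formER_dmapL_pos hε hf hq _ _).2 ((hT x _).symm.trans h)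
  tfae_finish
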